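/- Let $S^1=\mathbb R/\mathbb Z$, let $H^r=H^r(S^1)$ denote the $L^2$-based Sobolev spaces of real-valued functions on $S^1$, let $\mu(u)=\int_{S^1}u\,dx$ be the mean of $u$, and let $A=\mu-\partial_x^2$, which is an isomorphism of $H^r$ onto $H^{r-2}$. Let $s>5/2$, and let $u_o\in H^s(S^1)$ have non-zero mean, $\mu(u_o)\neq 0$. Suppose that either $Au_o(x)=\mu(u_o)-\partial_x^2u_o(x)\ge 0$ for all $x\in S^1$, or $Au_o(x)\le 0$ for all $x\in S^1$. Then the Cauchy problem for the $\mu$HS equation, $$u_t+uu_x+A^{-1}\partial_x\Big(2\mu(u)u+\tfrac12u_x^2\Big)=0,\qquad u(0,x)=u_o(x),\qquad x\in S^1,\ t\in\mathbb R,$$ has a unique global solution $u$ in the space $C(\mathbb R,H^s(S^1))\cap C^1(\mathbb R,H^{s-1}(S^1))$. -/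

import Mathlib

open MeasureTheory AddCircle
open scoped ENNReal ComplexConjugate

noncomputable section

/-- Real-valued `L²` functions on the circle `S¹ = ℝ/ℤ`, for the Haar (= Lebesgue) measure of
total mass one. -/
abbrev L2Circle : Type := Lp ℝ 2 (haarAddCircle : Measure UnitAddCircle)

/-- The `k`-th Fourier coefficient `∫ f(x) e^{-2πikx} dx` of a real `L²` function. -/
def coef (f : L2Circle) (k : ℤ) : ℂ := fourierCoeff (fun x => ((f x : ℝ) : ℂ)) k

/-- The weight `⟨k⟩^s = (1 + (2πk)²)^{s/2}`. -/
def bracket (s : ℝ) (k : ℤ) : ℝ := (1 + (2 * Real.pi * k) ^ 2) ^ (s / 2)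

/-- The complexification of a real `L²` function. -/
def cplx (f : L2Circle) : Lp ℂ 2 (haarAddCircle : Measure UnitAddCircle) :=
  (Complex.ofRealCLM).compLp f

theorem cplx_ae (f : L2Circle) :
    (cplx f : UnitAddCircle → ℂ) =ᵐ[haarAddCircle] fun x => ((f x : ℝ) : ℂ) :=
  ContinuousLinearMap.coeFn_compLp Complex.ofRealCLM f

theorem coef_eq_repr (f : L2Circle) (k : ℤ) : coef f k = fourierBasis.repr (cplx f) k := by
  rw [fourierBasis_repr, coef]
  exact congrFun (fourierCoeff_congr_ae (cplx_ae f)).symm k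

theorem coef_integrable (f : L2Circle) :
    Integrable (fun x => ((f x : ℝ) : ℂ)) (haarAddCircle : Measure UnitAddCircle) :=
  ((Lp.memLp f).integrable (by norm_num)).ofReal

theorem coef_add (f g : L2Circle) (k : ℤ) : coef (f + g) k = coef f k + coef g k := by
  have h := congrFun (fourierCoeff.add (coef_integrable f) (coef_integrable g)) k
  rw [Pi.add_apply] at h
  rw [coef, coef, coef, ← h]
  refine congrFun (fourierCoeff_congr_ae ?_) k
  filter_upwards [Lp.coeFn_add f g] with x hx
  rw [hx, Pi.add_apply, Pi.add_apply, Complex.ofReal_add]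

theorem coef_smul (c : ℝ) (f : L2Circle) (k : ℤ) : coef (c • f) k = (c : ℂ) * coef f k := by
  rw [coef, coef, ← smul_eq_mul, ← fourierCoeff.const_smul]
  refine congrFun (fourierCoeff_congr_ae ?_) k
  filter_upwards [Lp.coeFn_smul c f] with x hx
  rw [hx, Pi.smul_apply, Pi.smul_apply, smul_eq_mul, smul_eq_mul, Complex.ofReal_mul]

theorem coef_zero (k : ℤ) : coef 0 k = 0 := by
  have h := coef_smul 0 0 k
  simpa using h

theorem coef_neg (f : L2Circle) (k : ℤ) : coef (-f) k = -coef f k := by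
  have h := coef_smul (-1) f k
  simpa using h

theorem coef_sub (f g : L2Circle) (k : ℤ) : coef (f - g) k = coef f k - coef g k := by
  rw [sub_eq_add_neg, coef_add, coef_neg, sub_eq_add_neg]

theorem fourierCoeff_conj (F : UnitAddCircle → ℂ) (k : ℤ) :
    fourierCoeff (fun x => conj (F x)) k = conj (fourierCoeff F (-k)) := by
  simp only [fourierCoeff]
  rw [← integral_conj]
  congr 1
  ext x
  simp

theorem coef_conj (f : L2Circle) (k : ℤ) : coef f (-k) = conj (coef f k) := by
  have h := fourierCoeff_conj (fun x => ((f x : ℝ) : ℂ)) (-k)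
  simpa [coef] using h

theorem coef_ext {f g : L2Circle} (h : ∀ k, coef f k = coef g k) : f = g := by
  have h1 : cplx f = cplx g := by
    apply fourierBasis.repr.injective
    ext k
    rw [← coef_eq_repr, ← coef_eq_repr, h]
  apply Lp.ext
  filter_upwards [cplx_ae f, cplx_ae g] with x hx hy
  rw [h1, hy] at hx
  exact_mod_cast hx.symm

/-- Riesz–Fischer: a square-summable sequence with the symmetry `c(-k) = conj c(k)` is the sequence
of Fourier coefficients of a real `L²` function. -/
theorem exists_coef (c : ℤ → ℂ) (hc : Memℓp c 2) (hs : ∀ k, c (-k) = conj (c k)) :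
    ∃ f : L2Circle, ∀ k, coef f k = c k := by
  set F : Lp ℂ 2 (haarAddCircle : Measure UnitAddCircle) :=
    fourierBasis.repr.symm (⟨c, hc⟩ : lp (fun _ : ℤ => ℂ) 2) with hF
  have hFc : ∀ k, fourierCoeff (F : UnitAddCircle → ℂ) k = c k := by
    intro k
    rw [← fourierBasis_repr, hF, LinearIsometryEquiv.apply_symm_apply]
  have hFi : Integrable (F : UnitAddCircle → ℂ) haarAddCircle :=
    (Lp.memLp F).integrable (by norm_num)
  have hFi' : Integrable (fun x => conj ((F : UnitAddCircle → ℂ) x)) haarAddCircle :=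
    (Complex.conjCLE.integrable_comp_iff (φ := (F : UnitAddCircle → ℂ))).2 hFi
  refine ⟨(Complex.reCLM).compLp F, fun k => ?_⟩
  have h1 : coef ((Complex.reCLM).compLp F) k = fourierCoeff
      ((1 / 2 : ℂ) • ((F : UnitAddCircle → ℂ) + fun x => conj ((F : UnitAddCircle → ℂ) x))) k := by
    refine congrFun (fourierCoeff_congr_ae ?_) k
    filter_upwards [ContinuousLinearMap.coeFn_compLp Complex.reCLM F] with x hx
    rw [hx]
    simp [Complex.add_conj]
  rw [h1]
  have h2 := fourierCoeff.const_smul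
    ((F : UnitAddCircle → ℂ) + fun x => conj ((F : UnitAddCircle → ℂ) x)) (1 / 2 : ℂ) k
  rw [h2, fourierCoeff.add hFi hFi', Pi.add_apply, fourierCoeff_conj, hFc, hFc, hs]
  simp
  ring

theorem bracket_pos (s : ℝ) (k : ℤ) : 0 < bracket s k := by
  unfold bracket; positivity

theorem bracket_mono {s t : ℝ} (h : t ≤ s) (k : ℤ) : bracket t k ≤ bracket s k := by
  unfold bracket
  apply Real.rpow_le_rpow_of_exponent_le
  · nlinarith [sq_nonneg (2 * Real.pi * (k : ℝ))]
  · linarith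

theorem bracket_sub_one (s : ℝ) (k : ℤ) :
    bracket (s - 1) k * |2 * Real.pi * k| ≤ bracket s k := by
  have h1 : bracket s k = bracket (s - 1) k * bracket 1 k := by
    unfold bracket
    rw [← Real.rpow_add (by positivity)]
    congr 1; ring
  rw [h1]
  refine mul_le_mul_of_nonneg_left ?_ (bracket_pos _ _).le
  unfold bracket
  rw [← Real.sqrt_eq_rpow]
  apply Real.abs_le_sqrt
  linarith

theorem memlp_of_le {a b : ℤ → ℂ} (C : ℝ) (hb : Memℓp b 2) (h : ∀ k, ‖a k‖ ≤ C * ‖b k‖) :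
    Memℓp a 2 := by
  have hb2 : Memℓp (fun k => (C : ℂ) * b k) 2 := hb.const_mul (C : ℂ)
  rw [memℓp_gen_iff (by norm_num)] at hb2 ⊢
  refine Summable.of_nonneg_of_le (fun k => by positivity) (fun k => ?_) hb2
  refine Real.rpow_le_rpow (norm_nonneg _) ((h k).trans ?_) (by norm_num)
  rw [norm_mul, Complex.norm_real]
  exact mul_le_mul_of_nonneg_right (le_abs_self C) (norm_nonneg _)

/-- `H^s(S¹)`, `s ≥ 0`, as a subspace of `L²(S¹)`: the functions with
`∑ₖ (1 + (2πk)²)^s |f̂(k)|² < ∞`. -/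
def sobolevSubmodule (s : ℝ) : Submodule ℝ L2Circle where
  carrier := {f | Memℓp (fun k : ℤ => (bracket s k : ℂ) * coef f k) 2}
  zero_mem' := by
    have h : (fun k : ℤ => (bracket s k : ℂ) * coef 0 k) = 0 := by
      ext k; simp [coef_zero]
    simp only [Set.mem_ofPred_eq, h]
    exact zero_memℓp
  add_mem' := by
    intro f g hf hg
    have h : (fun k : ℤ => (bracket s k : ℂ) * coef (f + g) k) =
        (fun k : ℤ => (bracket s k : ℂ) * coef f k) +
          fun k : ℤ => (bracket s k : ℂ) * coef g k := by
      ext k; simp [coef_add, mul_add]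
    simp only [Set.mem_ofPred_eq, h]
    exact Memℓp.add hf hg
  smul_mem' := by
    intro c f hf
    refine memlp_of_le |c| hf (fun k => ?_)
    rw [coef_smul]
    simp only [norm_mul, Complex.norm_real, Real.norm_eq_abs]
    apply le_of_eq
    ring

/-- The Sobolev space `H^s(S¹)`, `s ≥ 0`, of real-valued functions on the circle. It carries the
`H^s` norm (see `Sobolev.norm_sq`), not the `L²` norm of the ambient space. -/
def Sobolev (s : ℝ) : Type := sobolevSubmodule s

namespace Sobolev

variable {s t : ℝ}

instance : AddCommGroup (Sobolev s) := inferInstanceAs (AddCommGroup (sobolevSubmodule s))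

instance : Module ℝ (Sobolev s) := inferInstanceAs (Module ℝ (sobolevSubmodule s))

/-- The inclusion of `H^s` in `L²`. -/
def toL2 : Sobolev s →ₗ[ℝ] L2Circle := (sobolevSubmodule s).subtype

/-- An `L²` function with finite `H^s` norm, as an element of `H^s`. -/
def mk (f : L2Circle) (hf : Memℓp (fun k : ℤ => (bracket s k : ℂ) * coef f k) 2) : Sobolev s :=
  ⟨f, hf⟩

theorem toL2_mk (f : L2Circle) (hf : Memℓp (fun k : ℤ => (bracket s k : ℂ) * coef f k) 2) :
    toL2 (mk f hf) = f := rfl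

/-- An element of `H^s` is used as a function on the circle (defined up to null sets). -/
instance : CoeFun (Sobolev s) (fun _ => UnitAddCircle → ℝ) := ⟨fun f => (toL2 f : UnitAddCircle → ℝ)⟩

theorem toL2_injective : Function.Injective (toL2 : Sobolev s → L2Circle) :=
  Subtype.val_injective

theorem memlp (f : Sobolev s) : Memℓp (fun k : ℤ => (bracket s k : ℂ) * coef (toL2 f) k) 2 :=
  f.2

theorem ext_coef {f g : Sobolev s} (h : ∀ k, coef (toL2 f) k = coef (toL2 g) k) : f = g :=
  toL2_injective (coef_ext h)

/-- The weighted Fourier coefficients `⟨k⟩^s f̂(k)`, as an element of `ℓ²(ℤ)`. -/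
def weighted : Sobolev s →ₗ[ℝ] lp (fun _ : ℤ => ℂ) 2 where
  toFun f := ⟨fun k => (bracket s k : ℂ) * coef (toL2 f) k, memlp f⟩
  map_add' f g := by
    ext k
    change (bracket s k : ℂ) * coef (toL2 (f + g)) k =
      (bracket s k : ℂ) * coef (toL2 f) k + (bracket s k : ℂ) * coef (toL2 g) k
    rw [map_add, coef_add, mul_add]
  map_smul' c f := by
    ext k
    simp [coef_smul]
    ring

theorem weighted_injective : Function.Injective (weighted : Sobolev s →ₗ[ℝ] _) := by
  intro f g h
  apply ext_coef
  intro k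
  have h1 : (bracket s k : ℂ) * coef (toL2 f) k = (bracket s k : ℂ) * coef (toL2 g) k :=
    congrFun (congrArg Subtype.val h) k
  exact mul_left_cancel₀ (by exact_mod_cast (bracket_pos s k).ne') h1

instance : NormedAddCommGroup (Sobolev s) :=
  NormedAddCommGroup.induced (Sobolev s) (lp (fun _ : ℤ => ℂ) 2) weighted weighted_injective

instance : NormedSpace ℝ (Sobolev s) :=
  NormedSpace.induced ℝ (Sobolev s) (lp (fun _ : ℤ => ℂ) 2) weighted

theorem norm_sq (f : Sobolev s) :
    ‖f‖ ^ 2 = ∑' k : ℤ, (1 + (2 * Real.pi * k) ^ 2) ^ s * ‖coef (toL2 f) k‖ ^ 2 := by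
  have h1 : ‖f‖ = ‖weighted f‖ := rfl
  have h2 := lp.norm_rpow_eq_tsum (p := 2) (by norm_num) (weighted f)
  rw [h1]
  simp only [ENNReal.toReal_ofNat, Real.rpow_ofNat] at h2
  rw [h2]
  refine tsum_congr fun k => ?_
  have h3 : (weighted f) k = (bracket s k : ℂ) * coef (toL2 f) k := rfl
  rw [h3, norm_mul, mul_pow, Complex.norm_real, Real.norm_eq_abs, sq_abs]
  congr 1
  unfold bracket
  rw [← Real.rpow_natCast, ← Real.rpow_mul (by positivity)]
  congr 1
  push_cast
  ring

/-- Construction of elements of `H^s`, `s ≥ 0`, from their Fourier coefficients. -/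
theorem exists_of_coef (hs : 0 ≤ s) (c : ℤ → ℂ)
    (hc : Memℓp (fun k : ℤ => (bracket s k : ℂ) * c k) 2) (hr : ∀ k, c (-k) = conj (c k)) :
    ∃ f : Sobolev s, ∀ k, coef (toL2 f) k = c k := by
  have h1 : Memℓp c 2 := by
    refine memlp_of_le 1 hc (fun k => ?_)
    rw [one_mul, norm_mul, Complex.norm_real, Real.norm_eq_abs, abs_of_pos (bracket_pos s k)]
    have h2 : 1 ≤ bracket s k := by
      have h3 := bracket_mono hs k
      simpa [bracket] using h3
    nlinarith [norm_nonneg (c k)]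
  obtain ⟨f, hf⟩ := exists_coef c h1 hr
  refine ⟨mk f (by simpa only [hf] using hc), fun k => ?_⟩
  rw [toL2_mk, hf]

/-- The inclusion `H^s ⊆ H^t` for `t ≤ s`. -/
def incl (h : t ≤ s) : Sobolev s →ₗ[ℝ] Sobolev t where
  toFun f := mk (toL2 f) (by
    refine memlp_of_le 1 (memlp f) (fun k => ?_)
    simp only [norm_mul, Complex.norm_real, Real.norm_eq_abs, one_mul,
      abs_of_pos (bracket_pos _ k)]
    exact mul_le_mul_of_nonneg_right (bracket_mono h k) (norm_nonneg _))
  map_add' f g := toL2_injective (by rw [toL2_mk, map_add, map_add, toL2_mk, toL2_mk])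
  map_smul' c f := toL2_injective (by
    rw [toL2_mk, map_smul, RingHom.id_apply, map_smul, toL2_mk])

theorem toL2_incl (h : t ≤ s) (f : Sobolev s) : toL2 (incl h f) = toL2 f :=
  toL2_mk _ _

theorem exists_dx (hs : 1 ≤ s) (f : Sobolev s) :
    ∃ g : Sobolev (s - 1), ∀ k, coef (toL2 g) k = 2 * Real.pi * Complex.I * k * coef (toL2 f) k := by
  refine exists_of_coef (by linarith) _ ?_ ?_
  · refine memlp_of_le 1 (memlp f) (fun k => ?_)
    have h1 : ‖(2 * Real.pi * Complex.I * k : ℂ)‖ = |2 * Real.pi * k| := by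
      simp [abs_mul]
    rw [norm_mul, norm_mul _ (coef _ _), norm_mul (bracket s k : ℂ), h1, Complex.norm_real, Complex.norm_real, Real.norm_eq_abs,
      Real.norm_eq_abs, abs_of_pos (bracket_pos _ k), abs_of_pos (bracket_pos _ k), one_mul,
      ← mul_assoc]
    exact mul_le_mul_of_nonneg_right (bracket_sub_one s k) (norm_nonneg _)
  · intro k
    rw [coef_conj]
    simp [Complex.conj_ofNat]

/-- The underlying function of `Sobolev.dx`. -/
def dxFun (hs : 1 ≤ s) (f : Sobolev s) : Sobolev (s - 1) := (exists_dx hs f).choose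

theorem coef_dxFun (hs : 1 ≤ s) (f : Sobolev s) (k : ℤ) :
    coef (toL2 (dxFun hs f)) k = 2 * Real.pi * Complex.I * k * coef (toL2 f) k :=
  (exists_dx hs f).choose_spec k

/-- The derivative `∂ₓ : H^s → H^{s-1}`, `s ≥ 1`: the function whose Fourier coefficients are
`2πik f̂(k)` (that is, the weak derivative). -/
def dx (hs : 1 ≤ s) : Sobolev s →ₗ[ℝ] Sobolev (s - 1) where
  toFun := dxFun hs
  map_add' f g := by
    apply ext_coef
    intro k
    rw [map_add, coef_add, coef_dxFun, coef_dxFun, coef_dxFun, map_add, coef_add]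
    ring
  map_smul' c f := by
    apply ext_coef
    intro k
    rw [RingHom.id_apply, map_smul, coef_smul, coef_dxFun, coef_dxFun, map_smul, coef_smul]
    ring

theorem coef_dx (hs : 1 ≤ s) (f : Sobolev s) (k : ℤ) :
    coef (toL2 (dx hs f)) k = 2 * Real.pi * Complex.I * k * coef (toL2 f) k :=
  coef_dxFun hs f k

/-- The mean `μ(f) = ∫_{S¹} f dx`. -/
def mean (f : Sobolev s) : ℝ := ∫ x, f x ∂haarAddCircle

theorem coef_zero_eq_mean (f : Sobolev s) : coef (toL2 f) 0 = (mean f : ℂ) := by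
  rw [coef, fourierCoeff, mean, ← integral_complex_ofReal]
  simp

theorem coef_const (k : ℤ) : coef (Lp.const 2 haarAddCircle (1 : ℝ)) k = if k = 0 then 1 else 0 := by
  have h1 : coef (Lp.const 2 haarAddCircle (1 : ℝ)) k =
      fourierCoeff (fourier 0 : UnitAddCircle → ℂ) k := by
    refine congrFun (fourierCoeff_congr_ae ?_) k
    filter_upwards [Lp.coeFn_const 2 (haarAddCircle : Measure UnitAddCircle) (1 : ℝ)] with x hx
    rw [hx]
    simp
  rw [h1, fourierCoeff_fourier]
  simp [Pi.single_apply]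

/-- The constant function `1`, as an element of `H^s`. -/
def one : Sobolev s := mk (Lp.const 2 haarAddCircle (1 : ℝ)) (by
  refine memℓp_gen (summable_of_ne_finset_zero (s := {0}) fun k hk => ?_)
  have h0 : k ≠ 0 := by simpa using hk
  rw [coef_const]
  simp [h0])

theorem coef_one (k : ℤ) : coef (toL2 (one : Sobolev s)) k = if k = 0 then 1 else 0 := by
  rw [one, toL2_mk, coef_const]

/-- The operator `A = μ - ∂ₓ² : H^s → H^{s-2}`, `s ≥ 2`. -/
def muA (hs : 2 ≤ s) (f : Sobolev s) : Sobolev (s - 2) :=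
  mean f • one - incl (by linarith) (dx (by linarith) (dx (by linarith) f))

theorem coef_muA (hs : 2 ≤ s) (f : Sobolev s) (k : ℤ) :
    coef (toL2 (muA hs f)) k =
      (if k = 0 then 1 else (2 * Real.pi * k) ^ 2 : ℂ) * coef (toL2 f) k := by
  rw [muA, map_sub, map_smul, coef_sub, coef_smul, coef_one, toL2_incl, coef_dx, coef_dx]
  split_ifs with h
  · subst h
    simp [coef_zero_eq_mean]
  · linear_combination
      -((2 * Real.pi * k : ℂ) ^ 2 * coef (toL2 f) k) * Complex.I_mul_I

theorem muA_bijective (hs : 2 ≤ s) : Function.Bijective (muA hs) := by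
  have hm : ∀ k : ℤ, (if k = 0 then 1 else (2 * Real.pi * k) ^ 2 : ℂ) ≠ 0 := by
    intro k
    split_ifs with h
    · exact one_ne_zero
    · have := Real.pi_ne_zero
      simp [h, this]
  constructor
  · intro f g h
    apply ext_coef
    intro k
    have h1 := congrArg (fun w => coef (toL2 w) k) h
    simp only [coef_muA] at h1
    exact mul_left_cancel₀ (hm k) h1
  · intro w
    obtain ⟨f, hf⟩ := exists_of_coef (s := s) (by linarith)
      (fun k => (if k = 0 then 1 else (2 * Real.pi * k) ^ 2 : ℂ)⁻¹ * coef (toL2 w) k)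
      (by
        refine memlp_of_le 2 (memlp w) (fun k => ?_)
        have h1 : bracket s k = bracket (s - 2) k * (1 + (2 * Real.pi * k) ^ 2) := by
          unfold bracket
          rw [← Real.rpow_add_one (by positivity)]
          congr 1; ring
        have h2 : ‖(if k = 0 then 1 else (2 * Real.pi * k) ^ 2 : ℂ)⁻¹‖ *
            (1 + (2 * Real.pi * k) ^ 2) ≤ 2 := by
          split_ifs with h
          · subst h; norm_num
          · have h3 : (1 : ℝ) ≤ |(k : ℝ)| := by
              exact_mod_cast Int.one_le_abs h
            have h4 : (1 : ℝ) ≤ (2 * Real.pi * k) ^ 2 := by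
              rw [← sq_abs, abs_mul, abs_of_pos (by positivity)]
              have h5 : (1 : ℝ) ≤ 2 * Real.pi * |(k : ℝ)| := by
                nlinarith [Real.pi_gt_three]
              nlinarith
            have h6 : ‖((2 * Real.pi * k) ^ 2 : ℂ)⁻¹‖ = ((2 * Real.pi * k) ^ 2)⁻¹ := by
              rw [norm_inv]
              congr 1
              have h7 : ((2 * Real.pi * k) ^ 2 : ℂ) = (((2 * Real.pi * k) ^ 2 : ℝ) : ℂ) := by
                push_cast; ring
              rw [h7, Complex.norm_real, Real.norm_eq_abs, abs_of_nonneg (sq_nonneg _)]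
            rw [h6, inv_mul_le_iff₀ (by linarith)]
            linarith
        rw [norm_mul, norm_mul, norm_mul, Complex.norm_real, Complex.norm_real, Real.norm_eq_abs,
          Real.norm_eq_abs, abs_of_pos (bracket_pos _ k), abs_of_pos (bracket_pos _ k), h1]
        have h8 : 0 ≤ bracket (s - 2) k * ‖coef (toL2 w) k‖ :=
          mul_nonneg (bracket_pos _ k).le (norm_nonneg _)
        nlinarith [mul_le_mul_of_nonneg_right h2 h8])
      (by
        intro k
        rw [coef_conj]
        by_cases h : k = 0
        · simp [h]
        · simp [h, Complex.conj_ofNat])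
    refine ⟨f, ext_coef fun k => ?_⟩
    rw [coef_muA, hf, ← mul_assoc, mul_inv_cancel₀ (hm k), one_mul]

/-- The inverse `A⁻¹ : H^{s-2} → H^s` of the bijection `A = μ - ∂ₓ²`, `s ≥ 2`. -/
def muAInv (hs : 2 ≤ s) : Sobolev (s - 2) → Sobolev s :=
  (Equiv.ofBijective (muA hs) (muA_bijective hs)).symm

theorem muA_muAInv (hs : 2 ≤ s) (w : Sobolev (s - 2)) : muA hs (muAInv hs w) = w :=
  (Equiv.ofBijective (muA hs) (muA_bijective hs)).apply_symm_apply w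

theorem muAInv_muA (hs : 2 ≤ s) (f : Sobolev s) : muAInv hs (muA hs f) = f :=
  (Equiv.ofBijective (muA hs) (muA_bijective hs)).symm_apply_apply f

end Sobolev

open Sobolev in
/-- `u` is a global solution in `C(ℝ, H^s) ∩ C¹(ℝ, H^{s-1})` of the Cauchy problem
`u_t + u u_x + A⁻¹ ∂ₓ (2 μ(u) u + ½ u_x²) = 0`, `u(0) = u₀`.
In `equation`, `h` is the function `2 μ(u) u + ½ u_x²` viewed as an element of `H^{s-1}`
(to which it belongs automatically, since `H^{s-1}` is an algebra for `s > 3/2`), and `u_t(t)` is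
the derivative at `t` of `u` as a curve in `H^{s-1}`. -/
structure IsGlobalSolution {s : ℝ} (hs : 2 ≤ s) (u₀ : Sobolev s) (u : ℝ → Sobolev s) : Prop where
  continuous : Continuous u
  contDiff : ContDiff ℝ 1 (fun t => (incl (sub_le_self s zero_le_one) (u t) : Sobolev (s - 1)))
  initial : u 0 = u₀
  equation : ∀ t : ℝ, ∃ h : Sobolev (s - 1),
    (∀ᵐ x ∂haarAddCircle,
      h x = 2 * mean (u t) * u t x + 1 / 2 * (dx (one_le_two.trans hs) (u t) x) ^ 2) ∧
    (∀ᵐ x ∂haarAddCircle,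
      (deriv (fun τ => (incl (sub_le_self s zero_le_one) (u τ) : Sobolev (s - 1))) t) x
        + u t x * dx (one_le_two.trans hs) (u t) x
        + muAInv hs (incl (by linarith) (dx (by linarith) h)) x = 0)

end

/-!
The momentum `m = A u` of a solution satisfies `m_t + u m_x + 2 u_x m = 0`. Along the flow
`η_t = u ∘ η` this says that `(m ∘ η) η_ξ²` is conserved, so that `m` keeps its sign, and so does
the total momentum `∫ m`. As `u_x` is the integral of the bounded function `g'` against `m`, where
`g` is the Green function of `A`, a momentum of one sign bounds `u_x` by a multiple of `|∫ m|`, for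
all times. This a priori bound makes the solution global.

Existence. In the Lagrangian variable `ℓ = log η_ξ` the equation reads `ℓ_t = u_x ∘ η`. Since
`m dx = f e^{-ℓ} dξ` with `f` the initial momentum, the right-hand side `lagV f ℓ` is an explicit
integral expression in `ℓ` that loses no derivative: this is an ordinary differential equation with
a locally Lipschitz field on the continuous functions on `[0, 1]`. The bound on `u_x` keeps `ℓ`
bounded on bounded time intervals, hence a solution exists on every interval (`exists_isLagFlow`).
Pushing `f e^{-ℓ} dξ` forward by the flow gives Fourier coefficients `lagM` that are bounded in
`ℓ²` and solve the momentum equation coefficient by coefficient (`exists_isMomentumSolution`).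

Regularity. The weighted energy `∑ ⟨k⟩^{2σ} |m(k)|²` is first regularized, with weights
`⟨k⟩^σ / (1 + ε⟨k⟩)^K`. The transport term is skew-symmetric up to a derivative of `u`, and the
commutator of the weight with `u` costs no derivative of `m`, uniformly in `ε`
(`exists_energy_flux_bound`). As the velocity is two derivatives smoother than the momentum,
regularity is gained in steps of `1/4` from `σ = 0` to `σ = s - 2`, and the energy is Lipschitz in
time (`IsMomentumSolution.propagation`). Convergence of all the coefficients and of the norm is
convergence in norm, so that `u` is continuous with values in `H^s`
(`IsMomentumSolution.isRegularVelocity`); the equation then makes it `C¹` with values in `H^{s-1}`.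

Uniqueness is an `L²` energy estimate for the difference of two solutions
(`IsVelocitySolution.unique`). It also glues the solutions on bounded intervals to a global one.
-/

/-! ### The weights `⟨k⟩^s` and the symbol of `A` -/

theorem bracket_add (s t : ℝ) (k : ℤ) : bracket (s + t) k = bracket s k * bracket t k := by
  unfold bracket
  rw [add_div, Real.rpow_add (by positivity)]

theorem bracket_zero (k : ℤ) : bracket 0 k = 1 := by simp [bracket]

theorem bracket_two_mul (s : ℝ) (k : ℤ) : bracket (2 * s) k = bracket s k ^ 2 := by
  rw [two_mul, bracket_add, sq]

theorem bracket_two (k : ℤ) : bracket 2 k = 1 + (2 * Real.pi * k) ^ 2 := by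
  unfold bracket; norm_num

theorem bracket_neg_exp_mul (s : ℝ) (k : ℤ) : bracket (-s) k * bracket s k = 1 := by
  rw [← bracket_add, neg_add_cancel, bracket_zero]

theorem bracket_eq_rpow (s : ℝ) (k : ℤ) : bracket s k = bracket 1 k ^ s := by
  unfold bracket
  rw [← Real.rpow_mul (by positivity)]
  congr 1; ring

theorem bracket_one_sq (k : ℤ) : bracket 1 k ^ 2 = 1 + (2 * Real.pi * k) ^ 2 := by
  rw [← bracket_two_mul, mul_one, bracket_two]

theorem one_le_bracket {s : ℝ} (hs : 0 ≤ s) (k : ℤ) : 1 ≤ bracket s k := by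
  rw [← bracket_zero k]; exact bracket_mono hs k

theorem abs_two_pi_mul_le_bracket_one (k : ℤ) : |2 * Real.pi * k| ≤ bracket 1 k := by
  refine abs_le_of_sq_le_sq ?_ (bracket_pos 1 k).le
  rw [bracket_one_sq]; linarith

theorem abs_le_bracket_one (k : ℤ) : |(k : ℝ)| ≤ bracket 1 k := by
  refine le_trans ?_ (abs_two_pi_mul_le_bracket_one k)
  rw [abs_mul, abs_of_pos (by positivity : 0 < 2 * Real.pi)]
  nlinarith [abs_nonneg (k : ℝ), Real.pi_gt_three]

theorem abs_bracket_one_sub_le (k l : ℤ) :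
    |bracket 1 k - bracket 1 l| ≤ 2 * Real.pi * |((k - l : ℤ) : ℝ)| := by
  have h1 : |2 * Real.pi * k| ≤ bracket 1 k := abs_two_pi_mul_le_bracket_one k
  have h2 : |2 * Real.pi * l| ≤ bracket 1 l := abs_two_pi_mul_le_bracket_one l
  have hp := bracket_pos 1 k
  have hq := bracket_pos 1 l
  have h3 := bracket_one_sq k
  have h4 := bracket_one_sq l
  have h5 : |bracket 1 k - bracket 1 l| * (bracket 1 k + bracket 1 l) ≤
      (2 * Real.pi * |((k - l : ℤ) : ℝ)|) * (bracket 1 k + bracket 1 l) := by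
    calc |bracket 1 k - bracket 1 l| * (bracket 1 k + bracket 1 l)
        = |(bracket 1 k - bracket 1 l) * (bracket 1 k + bracket 1 l)| := by
          rw [abs_mul, abs_of_pos (add_pos hp hq)]
      _ = |(2 * Real.pi * ((k - l : ℤ) : ℝ)) * (2 * Real.pi * k + 2 * Real.pi * l)| := by
          congr 1; push_cast; linear_combination h3 - h4
      _ = (2 * Real.pi * |((k - l : ℤ) : ℝ)|) * |2 * Real.pi * k + 2 * Real.pi * l| := by
          rw [abs_mul, abs_mul, abs_of_pos (by positivity : 0 < 2 * Real.pi)]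
      _ ≤ _ := by
          refine mul_le_mul_of_nonneg_left ?_ (by positivity)
          exact (abs_add_le _ _).trans (add_le_add h1 h2)
  exact le_of_mul_le_mul_right h5 (add_pos hp hq)

theorem bracket_one_le_add (k l : ℤ) : bracket 1 k ≤ bracket 1 (k - l) + bracket 1 l := by
  have h1 := abs_two_pi_mul_le_bracket_one (k - l)
  have h2 := abs_two_pi_mul_le_bracket_one l
  have hp := bracket_pos 1 (k - l)
  have hq := bracket_pos 1 l
  have h3 := bracket_one_sq (k - l)
  have h4 := bracket_one_sq l
  refine (sq_le_sq₀ (bracket_pos 1 k).le (by positivity)).1 ?_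
  rw [bracket_one_sq]
  have h5 : (2 * Real.pi * ((k - l : ℤ) : ℝ)) * (2 * Real.pi * l) ≤
      bracket 1 (k - l) * bracket 1 l := by
    refine (le_abs_self _).trans ?_
    rw [abs_mul]
    exact mul_le_mul h1 h2 (abs_nonneg _) hp.le
  push_cast at h3 h5
  nlinarith

theorem bracket_le_add {s : ℝ} (hs : 0 ≤ s) (k l : ℤ) :
    bracket s k ≤ 2 ^ s * (bracket s (k - l) + bracket s l) := by
  rw [bracket_eq_rpow s k, bracket_eq_rpow s (k - l), bracket_eq_rpow s l]
  have hp := bracket_pos 1 (k - l)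
  have hq := bracket_pos 1 l
  have h0 := bracket_one_le_add k l
  have h1 : ∀ x : ℝ, 0 < x → bracket 1 k ≤ 2 * x → bracket 1 k ^ s ≤ 2 ^ s * x ^ s := by
    intro x hx h
    rw [← Real.mul_rpow (by norm_num) hx.le]
    exact Real.rpow_le_rpow (bracket_pos 1 k).le h hs
  rcases le_total (bracket 1 (k - l)) (bracket 1 l) with h | h
  · refine (h1 _ hq (by linarith)).trans ?_
    have : 0 ≤ bracket 1 (k - l) ^ s := by positivity
    gcongr; linarith
  · refine (h1 _ hp (by linarith)).trans ?_
    have : 0 ≤ bracket 1 l ^ s := by positivity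
    gcongr; linarith

theorem summable_bracket {s : ℝ} (hs : s < -1) : Summable (fun k : ℤ => bracket s k) := by
  have h1 := (Real.summable_abs_int_rpow (b := -s) (by linarith))
  refine Summable.of_norm_bounded_eventually h1 ?_
  have : {0}ᶜ ∈ (Filter.cofinite : Filter ℤ) := (Set.finite_singleton (0 : ℤ)).compl_mem_cofinite
  filter_upwards [this] with k hk
  have hk0 : k ≠ 0 := hk
  rw [Real.norm_eq_abs, abs_of_pos (bracket_pos _ _), bracket_eq_rpow, neg_neg]
  exact Real.rpow_le_rpow_of_nonpos (by positivity) (abs_le_bracket_one k) (by linarith)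

/-- The symbol of `A = μ - ∂ₓ²`: multiplication of the `k`-th Fourier coefficient by `1` for
`k = 0` and by `(2πk)²` otherwise. -/
noncomputable def symb (k : ℤ) : ℝ := if k = 0 then 1 else (2 * Real.pi * k) ^ 2

theorem symb_zero : symb 0 = 1 := by simp [symb]

theorem symb_of_ne {k : ℤ} (hk : k ≠ 0) : symb k = (2 * Real.pi * k) ^ 2 := by simp [symb, hk]

theorem symb_neg (k : ℤ) : symb (-k) = symb k := by simp [symb]

theorem one_le_sq_two_pi_mul {k : ℤ} (hk : k ≠ 0) : (1 : ℝ) ≤ (2 * Real.pi * k) ^ 2 := by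
  have h3 : (1 : ℝ) ≤ |(k : ℝ)| := by exact_mod_cast Int.one_le_abs hk
  rw [← sq_abs, abs_mul, abs_of_pos (by positivity)]
  have h5 : (1 : ℝ) ≤ 2 * Real.pi * |(k : ℝ)| := by nlinarith [Real.pi_gt_three]
  nlinarith

theorem one_le_symb (k : ℤ) : 1 ≤ symb k := by
  unfold symb; split_ifs with h
  · exact le_rfl
  · exact one_le_sq_two_pi_mul h

theorem symb_pos (k : ℤ) : 0 < symb k := one_pos.trans_le (one_le_symb k)

theorem bracket_le_two_symb (k : ℤ) : bracket 2 k ≤ 2 * symb k := by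
  rw [bracket_two]; unfold symb; split_ifs with h
  · subst h; norm_num
  · linarith [one_le_sq_two_pi_mul h]

/-! ### Summation inequalities -/

theorem summable_mul_of_sq {ι : Type*} {a c : ι → ℝ} (ha : Summable fun k => a k ^ 2)
    (hc : Summable fun k => c k ^ 2) : Summable fun k => a k * c k := by
  refine Summable.of_norm_bounded ((ha.add hc).mul_left (1 / 2)) fun k => ?_
  rw [Real.norm_eq_abs, abs_mul, ← sq_abs (a k), ← sq_abs (c k)]
  nlinarith [sq_nonneg (|a k| - |c k|)]

theorem sq_tsum_mul_le {ι : Type*} {a c : ι → ℝ} (ha0 : ∀ k, 0 ≤ a k) (hc0 : ∀ k, 0 ≤ c k)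
    (ha : Summable fun k => a k ^ 2) (hc : Summable fun k => c k ^ 2) :
    (∑' k, a k * c k) ^ 2 ≤ (∑' k, a k ^ 2) * ∑' k, c k ^ 2 := by
  have h := Real.inner_le_Lp_mul_Lq_tsum_of_nonneg (p := 2) (q := 2)
    Real.HolderConjugate.two_two ha0 hc0 (by simpa using ha) (by simpa using hc)
  simp only [Real.rpow_ofNat, ← Real.sqrt_eq_rpow] at h
  have h0 : 0 ≤ ∑' k, a k * c k := tsum_nonneg fun k => mul_nonneg (ha0 k) (hc0 k)
  calc _ ≤ (√(∑' k, a k ^ 2) * √(∑' k, c k ^ 2)) ^ 2 := pow_le_pow_left₀ h0 h 2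
    _ = _ := by
      rw [mul_pow, Real.sq_sqrt (tsum_nonneg fun k => sq_nonneg _),
        Real.sq_sqrt (tsum_nonneg fun k => sq_nonneg _)]

/-- The change of variables `(k, l) ↦ (k - l, l)`. -/
def subEquiv : ℤ × ℤ ≃ ℤ × ℤ where
  toFun p := (p.1 - p.2, p.2)
  invFun p := (p.1 + p.2, p.2)
  left_inv p := by simp
  right_inv p := by simp

theorem summable_conv {b c : ℤ → ℝ} (hb0 : ∀ k, 0 ≤ b k) (hc0 : ∀ k, 0 ≤ c k)
    (hb : Summable b) (hc : Summable c) : Summable fun p : ℤ × ℤ => b (p.1 - p.2) * c p.2 :=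
  (subEquiv.summable_iff (f := fun p : ℤ × ℤ => b p.1 * c p.2)).2 (hb.mul_of_nonneg hc hb0 hc0)

theorem tsum_conv {b c : ℤ → ℝ} (hb0 : ∀ k, 0 ≤ b k) (hc0 : ∀ k, 0 ≤ c k)
    (hb : Summable b) (hc : Summable c) :
    ∑' p : ℤ × ℤ, b (p.1 - p.2) * c p.2 = (∑' k, b k) * ∑' k, c k := by
  rw [hb.tsum_mul_tsum hc (hb.mul_of_nonneg hc hb0 hc0)]
  exact subEquiv.tsum_eq fun p : ℤ × ℤ => b p.1 * c p.2

/-- The change of variables `(k, l) ↦ (k - l, k)`. -/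
def subEquiv' : ℤ × ℤ ≃ ℤ × ℤ where
  toFun p := (p.1 - p.2, p.1)
  invFun p := (p.2, p.2 - p.1)
  left_inv p := by simp
  right_inv p := by simp

theorem summable_conv' {b c : ℤ → ℝ} (hb0 : ∀ k, 0 ≤ b k) (hc0 : ∀ k, 0 ≤ c k)
    (hb : Summable b) (hc : Summable c) : Summable fun p : ℤ × ℤ => b (p.1 - p.2) * c p.1 :=
  (subEquiv'.summable_iff (f := fun p : ℤ × ℤ => b p.1 * c p.2)).2 (hb.mul_of_nonneg hc hb0 hc0)

theorem tsum_conv' {b c : ℤ → ℝ} (hb0 : ∀ k, 0 ≤ b k) (hc0 : ∀ k, 0 ≤ c k)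
    (hb : Summable b) (hc : Summable c) :
    ∑' p : ℤ × ℤ, b (p.1 - p.2) * c p.1 = (∑' k, b k) * ∑' k, c k := by
  rw [hb.tsum_mul_tsum hc (hb.mul_of_nonneg hc hb0 hc0)]
  exact subEquiv'.tsum_eq fun p : ℤ × ℤ => b p.1 * c p.2

/-- Trilinear form of Young's inequality `ℓ² · (ℓ¹ ∗ ℓ²)`. -/
theorem young_trilinear {a b c : ℤ → ℝ} (ha0 : ∀ k, 0 ≤ a k) (hb0 : ∀ k, 0 ≤ b k)
    (hc0 : ∀ k, 0 ≤ c k) (ha : Summable fun k => a k ^ 2) (hb : Summable b)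
    (hc : Summable fun k => c k ^ 2) :
    Summable (fun p : ℤ × ℤ => a p.1 * b (p.1 - p.2) * c p.2) ∧
      ∑' p : ℤ × ℤ, a p.1 * b (p.1 - p.2) * c p.2 ≤
        (∑' k, b k) * ((∑' k, a k ^ 2) + ∑' k, c k ^ 2) / 2 := by
  have h1 := summable_conv hb0 (fun k => sq_nonneg (c k)) hb hc
  have h2 := summable_conv' hb0 (fun k => sq_nonneg (a k)) hb ha
  have h3 : ∀ p : ℤ × ℤ, a p.1 * b (p.1 - p.2) * c p.2 ≤
      (1 / 2) * (b (p.1 - p.2) * c p.2 ^ 2 + b (p.1 - p.2) * a p.1 ^ 2) := by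
    intro p
    nlinarith [mul_nonneg (hb0 (p.1 - p.2)) (sq_nonneg (a p.1 - c p.2))]
  have h4 : Summable (fun p : ℤ × ℤ => a p.1 * b (p.1 - p.2) * c p.2) :=
    Summable.of_nonneg_of_le
      (fun p => mul_nonneg (mul_nonneg (ha0 _) (hb0 _)) (hc0 _)) h3 ((h1.add h2).mul_left _)
  refine ⟨h4, ?_⟩
  refine (h4.tsum_le_tsum h3 ((h1.add h2).mul_left _)).trans (le_of_eq ?_)
  rw [tsum_mul_left, h1.tsum_add h2, tsum_conv hb0 (fun k => sq_nonneg (c k)) hb hc,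
    tsum_conv' hb0 (fun k => sq_nonneg (a k)) hb ha]
  ring

/-- Young's inequality `‖b ∗ c‖_{ℓ²} ≤ ‖b‖_{ℓ¹} ‖c‖_{ℓ²}`. -/
theorem young_sq {b c : ℤ → ℝ} (hb0 : ∀ k, 0 ≤ b k)
    (hc0 : ∀ k, 0 ≤ c k) (hb : Summable b) (hc : Summable fun k => c k ^ 2) :
    (∀ k, Summable fun l => b (k - l) * c l) ∧
    Summable (fun k => (∑' l, b (k - l) * c l) ^ 2) ∧
      ∑' k, (∑' l, b (k - l) * c l) ^ 2 ≤ (∑' k, b k) ^ 2 * ∑' k, c k ^ 2 := by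
  have h1 := summable_conv hb0 (fun k => sq_nonneg (c k)) hb hc
  have hbk : ∀ k, Summable fun l => b (k - l) := fun k =>
    (Equiv.subLeft k).summable_iff.2 hb
  have hbs : ∀ k, ∑' l, b (k - l) = ∑' l, b l := fun k => (Equiv.subLeft k).tsum_eq b
  have hx : ∀ k l, b (k - l) * c l = √(b (k - l)) * (√(b (k - l)) * c l) := by
    intro k l
    rw [← mul_assoc, Real.mul_self_sqrt (hb0 _)]
  have hy : ∀ k l, (√(b (k - l)) * c l) ^ 2 = b (k - l) * c l ^ 2 := by
    intro k l
    rw [mul_pow, Real.sq_sqrt (hb0 _)]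
  have hk : ∀ k, (∑' l, b (k - l) * c l) ^ 2 ≤ (∑' l, b l) * ∑' l, b (k - l) * c l ^ 2 := by
    intro k
    simp_rw [hx]
    refine (sq_tsum_mul_le (fun l => Real.sqrt_nonneg _)
      (fun l => mul_nonneg (Real.sqrt_nonneg _) (hc0 l)) ?_ ?_).trans (le_of_eq ?_)
    · simpa only [Real.sq_sqrt (hb0 _)] using hbk k
    · simpa only [hy] using h1.prod_factor k
    · simp_rw [hy, Real.sq_sqrt (hb0 _)]
      rw [hbs]
  have h5 := h1.prod.mul_left (∑' l, b l)
  have h6 : Summable (fun k => (∑' l, b (k - l) * c l) ^ 2) :=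
    Summable.of_nonneg_of_le (fun k => sq_nonneg _) hk h5
  refine ⟨fun k => ?_, h6, ?_⟩
  · simp_rw [hx]
    refine summable_mul_of_sq ?_ ?_
    · simpa only [Real.sq_sqrt (hb0 _)] using hbk k
    · simpa only [hy] using h1.prod_factor k
  · refine (h6.tsum_le_tsum hk h5).trans (le_of_eq ?_)
    rw [tsum_mul_left, ← h1.tsum_prod, tsum_conv hb0 (fun k => sq_nonneg (c k)) hb hc]
    ring

/-- `ℓ²` with weight `⟨k⟩^s` embeds in `ℓ¹` for `s > 1/2`. -/
theorem summable_of_weighted {s : ℝ} (hs : 1 / 2 < s) {a : ℤ → ℝ} (ha0 : ∀ k, 0 ≤ a k)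
    (ha : Summable fun k => (bracket s k * a k) ^ 2) :
    Summable a ∧ (∑' k, a k) ^ 2 ≤ (∑' k, bracket (-(2 * s)) k) *
      ∑' k, (bracket s k * a k) ^ 2 := by
  have h0 : ∀ k, a k = bracket (-s) k * (bracket s k * a k) := by
    intro k; rw [← mul_assoc, bracket_neg_exp_mul, one_mul]
  have h1 : (fun k => bracket (-(2 * s)) k) = fun k => bracket (-s) k ^ 2 := by
    ext k; rw [← bracket_two_mul]; congr 1; ring
  have h2 : Summable fun k => bracket (-s) k ^ 2 := by
    rw [← h1]; exact summable_bracket (by linarith)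
  have h3 : Summable a := by
    rw [funext h0]
    exact summable_mul_of_sq h2 ha
  refine ⟨h3, ?_⟩
  rw [h1]
  calc (∑' k, a k) ^ 2 = (∑' k, bracket (-s) k * (bracket s k * a k)) ^ 2 := by
        simp_rw [← h0]
    _ ≤ _ := sq_tsum_mul_le (fun k => (bracket_pos _ k).le)
        (fun k => mul_nonneg (bracket_pos _ k).le (ha0 k)) h2 ha

/-! ### Regularized weights and their commutators -/

/-- The weight `⟨k⟩^σ / (1 + ε⟨k⟩)^K`: a regularization of `⟨k⟩^σ` that decays at infinity. -/
noncomputable def regWeight (σ ε : ℝ) (K : ℕ) (k : ℤ) : ℝ :=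
  bracket σ k / (1 + ε * bracket 1 k) ^ K

theorem regWeight_pos {σ ε : ℝ} (hε : 0 ≤ ε) (K : ℕ) (k : ℤ) : 0 < regWeight σ ε K k := by
  have := bracket_pos 1 k
  have := bracket_pos σ k
  unfold regWeight; positivity

theorem regWeight_le {σ ε : ℝ} (hε : 0 ≤ ε) (K : ℕ) (k : ℤ) :
    regWeight σ ε K k ≤ bracket σ k := by
  have := bracket_pos 1 k
  refine div_le_self (bracket_pos σ k).le (one_le_pow₀ ?_)
  nlinarith

theorem regWeight_mul_bracket_two_le {σ ε : ℝ} (hε : 0 < ε) {K : ℕ} (hK : σ + 2 ≤ K) (k : ℤ) :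
    regWeight σ ε K k * bracket 2 k ≤ ε⁻¹ ^ K := by
  have hb := bracket_pos 1 k
  rw [regWeight, div_mul_eq_mul_div, ← bracket_add, div_le_iff₀ (by positivity)]
  calc bracket (σ + 2) k ≤ bracket K k := bracket_mono hK k
    _ = bracket 1 k ^ K := by rw [bracket_eq_rpow, Real.rpow_natCast]
    _ = ε⁻¹ ^ K * (ε * bracket 1 k) ^ K := by
        rw [← mul_pow, inv_mul_cancel_left₀ hε.ne']
    _ ≤ _ := by gcongr; linarith

theorem pow_sub_one_le {R : ℝ} (hR : 1 ≤ R) (hR2 : R ≤ 2) (K : ℕ) :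
    R ^ K - 1 ≤ K * 2 ^ K * (R - 1) := by
  have h1 : (1 : ℝ) + K * (R⁻¹ - 1) ≤ R⁻¹ ^ K := by
    have h := one_add_mul_le_pow (a := R⁻¹ - 1) (by
      have : 0 < R⁻¹ := by positivity
      linarith) K
    simpa using h
  have hR0 : 0 < R := by linarith
  have h2 : R ^ K * R⁻¹ ^ K = 1 := by
    rw [← mul_pow, mul_inv_cancel₀ hR0.ne', one_pow]
  have h3 : R ^ K ≤ 2 ^ K := pow_le_pow_left₀ hR0.le hR2 K
  have h4 : 1 - R⁻¹ ≤ R - 1 := by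
    have : R * R⁻¹ = 1 := mul_inv_cancel₀ hR0.ne'
    nlinarith [sq_nonneg (R - 1), inv_pos.2 hR0]
  have h5 : R ^ K - 1 ≤ R ^ K * (K * (1 - R⁻¹)) := by
    have h6 : 0 < R ^ K := by positivity
    nlinarith
  calc _ ≤ _ := h5
    _ ≤ 2 ^ K * (K * (R - 1)) := by
        have : 0 ≤ 1 - R⁻¹ := by rw [sub_nonneg]; exact inv_le_one_of_one_le₀ hR
        gcongr
    _ = _ := by ring

theorem regWeight_ratio {σ ε : ℝ} (hσ : 0 ≤ σ) (hε : 0 ≤ ε) {K : ℕ} (hK : σ ≤ K) {k l : ℤ}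
    (h : bracket 1 l ≤ bracket 1 k) :
    regWeight σ ε K k ≤ regWeight σ ε K l * (bracket 1 k / bracket 1 l) ^ K ∧
      regWeight σ ε K l ≤ regWeight σ ε K k * (bracket 1 k / bracket 1 l) ^ K := by
  have hx := bracket_pos 1 l
  have hy := bracket_pos 1 k
  unfold regWeight
  rw [bracket_eq_rpow σ k, bracket_eq_rpow σ l]
  set x := bracket 1 l
  set y := bracket 1 k
  have hR : 1 ≤ y / x := (one_le_div hx).2 h
  have hyx : y = x * (y / x) := by field_simp
  set R := y / x
  have h1 : y ^ σ ≤ x ^ σ * R ^ K := by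
    rw [hyx, Real.mul_rpow hx.le (by positivity), ← Real.rpow_natCast R K]
    gcongr
  have h2 : 1 + ε * y ≤ (1 + ε * x) * R := by
    rw [hyx]; nlinarith
  constructor
  · rw [div_mul_eq_mul_div]
    gcongr
  · rw [div_mul_eq_mul_div, div_le_div_iff₀ (by positivity) (by positivity), mul_assoc,
      mul_comm (R ^ K), ← mul_pow]
    gcongr

/-- The commutator estimate behind the propagation of regularity: the weight at `k` differs from the
weight at `l` by a derivative on the low frequency, uniformly in the regularization `ε`. -/
theorem exists_regWeight_commutator {σ : ℝ} (hσ : 0 ≤ σ) {K : ℕ} (hK : σ ≤ K) :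
    ∃ C, 0 ≤ C ∧ ∀ ε, 0 ≤ ε → ∀ k l : ℤ,
      |regWeight σ ε K k - regWeight σ ε K l| * |(l : ℝ)| +
        regWeight σ ε K k * |((k - l : ℤ) : ℝ)| ≤
      C * |((k - l : ℤ) : ℝ)| * (regWeight σ ε K l + bracket σ (k - l)) := by
  refine ⟨4 * Real.pi * (K * 2 ^ K) + 2 ^ K + (4 * Real.pi + 1) * (6 * Real.pi) ^ σ,
    by positivity, fun ε hε k l => ?_⟩
  have hx := bracket_pos 1 l
  have hy := bracket_pos 1 k
  have hwk := regWeight_pos (σ := σ) hε K k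
  have hwl := regWeight_pos (σ := σ) hε K l
  have hbj := bracket_pos σ (k - l)
  have hd := abs_bracket_one_sub_le k l
  have hl := abs_le_bracket_one l
  have hj0 := abs_nonneg (((k - l : ℤ) : ℝ))
  set j := |((k - l : ℤ) : ℝ)| with hj
  set wk := regWeight σ ε K k
  set wl := regWeight σ ε K l
  set x := bracket 1 l
  set y := bracket 1 k
  rcases le_or_gt |y - x| (x / 2) with h | h
  · -- comparable frequencies
    have key : wk ≤ 2 ^ K * wl ∧ |wk - wl| ≤ K * 2 ^ K * (2 * |y - x| / x) * wl := by
      rcases le_total x y with hxy | hxy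
      · obtain ⟨h1, h2⟩ := regWeight_ratio hσ hε hK hxy
        have hR1 : 1 ≤ y / x := (one_le_div hx).2 hxy
        have hR2 : y / x ≤ 2 := by
          rw [div_le_iff₀ hx]; linarith [le_abs_self (y - x)]
        have h3 := pow_sub_one_le hR1 hR2 K
        have h4 : (y / x) ^ K ≤ 2 ^ K := pow_le_pow_left₀ (by positivity) hR2 K
        have h5 : 1 ≤ (y / x) ^ K := one_le_pow₀ hR1
        have h6 : y / x - 1 ≤ 2 * |y - x| / x := by
          rw [div_sub_one hx.ne']
          have := abs_nonneg (y - x)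
          gcongr; linarith [le_abs_self (y - x)]
        have h7 : (y / x) ^ K - 1 ≤ K * 2 ^ K * (2 * |y - x| / x) :=
          h3.trans (mul_le_mul_of_nonneg_left h6 (by positivity))
        refine ⟨h1.trans (by rw [mul_comm]; gcongr), ?_⟩
        rw [abs_le]
        change wk ≤ wl * _ at h1
        change wl ≤ wk * _ at h2
        have h8 : wl * ((y / x) ^ K - 1) ≤ wl * (K * 2 ^ K * (2 * |y - x| / x)) :=
          mul_le_mul_of_nonneg_left h7 hwl.le
        constructor
        · by_contra hcon
          have : wk < wl := by nlinarith [mul_nonneg hwl.le (sub_nonneg.2 h5)]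
          nlinarith
        · linarith
      · obtain ⟨h2, h1⟩ := regWeight_ratio hσ hε hK hxy
        have hyx2 : x ≤ 2 * y := by linarith [neg_abs_le (y - x)]
        have hR1 : 1 ≤ x / y := (one_le_div hy).2 hxy
        have hR2 : x / y ≤ 2 := by rw [div_le_iff₀ hy]; linarith
        have h3 := pow_sub_one_le hR1 hR2 K
        have h4 : (x / y) ^ K ≤ 2 ^ K := pow_le_pow_left₀ (by positivity) hR2 K
        have h5 : 1 ≤ (x / y) ^ K := one_le_pow₀ hR1
        have h6 : x / y - 1 ≤ 2 * |y - x| / x := by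
          rw [div_sub_one hy.ne', div_le_div_iff₀ hy hx, abs_of_nonpos (by linarith)]
          nlinarith
        have h7 : (x / y) ^ K - 1 ≤ K * 2 ^ K * (2 * |y - x| / x) :=
          h3.trans (mul_le_mul_of_nonneg_left h6 (by positivity))
        refine ⟨h1.trans (by rw [mul_comm]; gcongr), ?_⟩
        rw [abs_le]
        change wk ≤ wl * _ at h1
        change wl ≤ wk * _ at h2
        have h8 : wl * ((x / y) ^ K - 1) ≤ wl * (K * 2 ^ K * (2 * |y - x| / x)) :=
          mul_le_mul_of_nonneg_left h7 hwl.le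
        constructor
        · by_contra hcon
          have : wk < wl := by nlinarith [mul_nonneg hwl.le (sub_nonneg.2 h5)]
          nlinarith
        · linarith
    obtain ⟨h1, h2⟩ := key
    have h3 : |wk - wl| * |(l : ℝ)| ≤ 4 * Real.pi * (K * 2 ^ K) * j * wl := by
      calc _ ≤ (K * 2 ^ K * (2 * |y - x| / x) * wl) * x := by gcongr
        _ = K * 2 ^ K * 2 * wl * |y - x| := by field_simp
        _ ≤ K * 2 ^ K * 2 * wl * (2 * Real.pi * j) := by gcongr
        _ = _ := by ring
    have h4 : wk * j ≤ 2 ^ K * j * wl := by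
      calc _ ≤ (2 ^ K * wl) * j := by gcongr
        _ = _ := by ring
    have h5 : 0 ≤ (4 * Real.pi + 1) * (6 * Real.pi) ^ σ * j * (wl + bracket σ (k - l)) := by
      positivity
    have h6 : 0 ≤ (4 * Real.pi * (K * 2 ^ K) + 2 ^ K) * j * bracket σ (k - l) := by positivity
    linarith
  · -- the difference of the frequencies dominates
    have hx4 : x ≤ 4 * Real.pi * j := by linarith
    have hy6 : y ≤ 6 * Real.pi * j := by
      have := le_abs_self (y - x)
      linarith
    have hjb : j ≤ bracket 1 (k - l) := abs_le_bracket_one (k - l)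
    have hb : ∀ i : ℤ, bracket 1 i ≤ 6 * Real.pi * j →
        regWeight σ ε K i ≤ (6 * Real.pi) ^ σ * bracket σ (k - l) := by
      intro i hi
      refine (regWeight_le hε K i).trans ?_
      rw [bracket_eq_rpow σ i, bracket_eq_rpow σ (k - l),
        ← Real.mul_rpow (by positivity) (bracket_pos _ _).le]
      exact Real.rpow_le_rpow (bracket_pos _ _).le
        (hi.trans (mul_le_mul_of_nonneg_left hjb (by positivity))) hσ
    have h1 : wk ≤ _ := hb k hy6
    have h2 : wl ≤ _ := hb l (hx4.trans (by gcongr; norm_num))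
    have h3 : |wk - wl| ≤ (6 * Real.pi) ^ σ * bracket σ (k - l) := by
      rw [abs_le]; constructor <;> linarith
    have h4 : |wk - wl| * |(l : ℝ)| ≤ ((6 * Real.pi) ^ σ * bracket σ (k - l)) *
        (4 * Real.pi * j) := by
      gcongr; exact hl.trans hx4
    have h5 : wk * j ≤ (6 * Real.pi) ^ σ * bracket σ (k - l) * j := by gcongr
    have h6 : 0 ≤ (4 * Real.pi * (K * 2 ^ K) + 2 ^ K) * j * (wl + bracket σ (k - l)) := by
      positivity
    have h7 : 0 ≤ (4 * Real.pi + 1) * (6 * Real.pi) ^ σ * j * wl := by positivity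
    linarith

/-! ### Transport terms are skew-symmetric up to a derivative of the velocity -/

/-- `⟨a, p ∂ₓ a⟩` on the Fourier side. Its real part loses no derivative of `a`, because `p` is the
sequence of Fourier coefficients of a real function. -/
theorem abs_re_tsum_transport_le {a p : ℤ → ℂ} (hp : ∀ k, p (-k) = conj (p k))
    (ha : Summable fun k => (bracket 1 k * ‖a k‖) ^ 2)
    (hps : Summable fun k => bracket 1 k * ‖p k‖) :
    Summable (fun q : ℤ × ℤ => conj (a q.1) * (Complex.I * q.2) * p (q.1 - q.2) * a q.2) ∧
    |(∑' q : ℤ × ℤ, conj (a q.1) * (Complex.I * q.2) * p (q.1 - q.2) * a q.2).re| ≤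
      (∑' k, bracket 1 k * ‖p k‖) * (∑' k, ‖a k‖ ^ 2) / 2 := by
  set X : ℤ × ℤ → ℂ := fun q => conj (a q.1) * (Complex.I * q.2) * p (q.1 - q.2) * a q.2
  have hb1 : ∀ k, 1 ≤ bracket 1 k := one_le_bracket zero_le_one
  have ha2 : Summable fun k => ‖a k‖ ^ 2 := by
    refine Summable.of_nonneg_of_le (fun k => by positivity) (fun k => ?_) ha
    gcongr
    exact le_mul_of_one_le_left (norm_nonneg _) (hb1 k)
  have hbp0 : ∀ k, 0 ≤ bracket 1 k * ‖p k‖ := fun k =>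
    mul_nonneg (bracket_pos _ _).le (norm_nonneg _)
  have hX : Summable X := by
    refine Summable.of_norm_bounded (young_trilinear (a := fun k => ‖a k‖) (fun k => norm_nonneg _)
      hbp0 (fun k => mul_nonneg (bracket_pos 1 k).le (norm_nonneg (a k))) ha2 hps ha).1
      fun q => ?_
    simp only [X, norm_mul, RCLike.norm_conj, Complex.norm_I, one_mul, Complex.norm_intCast]
    have h1 := abs_le_bracket_one q.2
    have h2 := hb1 (q.1 - q.2)
    calc ‖a q.1‖ * |(q.2 : ℝ)| * ‖p (q.1 - q.2)‖ * ‖a q.2‖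
        = ‖a q.1‖ * (1 * ‖p (q.1 - q.2)‖) * (|(q.2 : ℝ)| * ‖a q.2‖) := by ring
      _ ≤ _ := by gcongr
  refine ⟨hX, ?_⟩
  have hX' : Summable fun q : ℤ × ℤ => conj (X q.swap) := by
    have h1 : Summable fun q : ℤ × ℤ => X q.swap :=
      (Equiv.prodComm ℤ ℤ).summable_iff.2 hX
    exact Complex.summable_conj.2 h1
  have hsum : ((2 * (∑' q, X q).re : ℝ) : ℂ) = ∑' q, (X q + conj (X q.swap)) := by
    have h1 : ∑' q : ℤ × ℤ, conj (X q.swap) = conj (∑' q, X q) := by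
      rw [← Complex.conj_tsum, (Equiv.prodComm ℤ ℤ).tsum_eq X |>.symm]
      rfl
    rw [hX.tsum_add hX', h1, Complex.add_conj]
  have hpt : ∀ q : ℤ × ℤ, ‖X q + conj (X q.swap)‖ ≤
      ‖a q.1‖ * (bracket 1 (q.1 - q.2) * ‖p (q.1 - q.2)‖) * ‖a q.2‖ := by
    intro q
    have h1 : X q + conj (X q.swap) =
        -(conj (a q.1) * (Complex.I * ((q.1 - q.2 : ℤ) : ℂ)) * p (q.1 - q.2) * a q.2) := by
      simp only [X, Prod.fst_swap, Prod.snd_swap, map_mul, Complex.conj_conj, Complex.conj_I,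
        map_intCast]
      rw [← hp, neg_sub]
      push_cast
      ring
    rw [h1, norm_neg]
    simp only [norm_mul, RCLike.norm_conj, Complex.norm_I, one_mul, Complex.norm_intCast]
    have h2 := abs_le_bracket_one (q.1 - q.2)
    rw [← mul_assoc]
    gcongr
  obtain ⟨hy1, hy2⟩ := young_trilinear (a := fun k => ‖a k‖) (fun k => norm_nonneg _)
      hbp0 (fun k => norm_nonneg (a k)) ha2 hps ha2
  have h3 : ‖∑' q, (X q + conj (X q.swap))‖ ≤ _ :=
    tsum_of_norm_bounded hy1.hasSum hpt
  rw [← hsum, Complex.norm_real, Real.norm_eq_abs, abs_mul, abs_two] at h3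
  linarith

/-! ### The momentum equation on the Fourier side -/

/-- The velocity `u = A⁻¹ m` on the Fourier side. -/
noncomputable def vel (m : ℤ → ℂ) (k : ℤ) : ℂ := m k / symb k

/-- The `k`-th Fourier coefficient of `-(u m_x + 2 u_x m)`, where `u = A⁻¹ m`. -/
noncomputable def momentumRHS (m : ℤ → ℂ) (k : ℤ) : ℂ :=
  -∑' l : ℤ, 2 * Real.pi * Complex.I * (2 * k - l) * vel m (k - l) * m l

theorem vel_neg {m : ℤ → ℂ} (hm : ∀ k, m (-k) = conj (m k)) (k : ℤ) :
    vel m (-k) = conj (vel m k) := by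
  simp [vel, hm, symb_neg]

theorem norm_vel (m : ℤ → ℂ) (k : ℤ) : ‖vel m k‖ = ‖m k‖ / symb k := by
  rw [vel, norm_div, Complex.norm_real, Real.norm_eq_abs, abs_of_pos (symb_pos k)]

theorem norm_vel_le (m : ℤ → ℂ) (k : ℤ) : ‖vel m k‖ ≤ 2 * bracket (-2) k * ‖m k‖ := by
  rw [norm_vel, div_le_iff₀ (symb_pos k)]
  have h1 := bracket_le_two_symb k
  have h2 := bracket_neg_exp_mul 2 k
  have h3 := bracket_pos (-2) k
  have h4 : 1 ≤ 2 * bracket (-2) k * symb k := by nlinarith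
  nlinarith [norm_nonneg (m k)]

theorem norm_momentumRHS_term_le {m : ℤ → ℂ} {M : ℝ} (hM : ∀ l, ‖m l‖ ≤ M) (k l : ℤ) :
    ‖2 * Real.pi * Complex.I * (2 * k - l) * vel m (k - l) * m l‖ ≤
      4 * Real.pi * M * bracket 1 k * (bracket 1 (k - l) * ‖vel m (k - l)‖) := by
  have h0 : ‖(2 * k - l : ℂ)‖ ≤ 2 * (bracket 1 k * bracket 1 (k - l)) := by
    have e : (2 * k - l : ℂ) = ((2 * k - l : ℤ) : ℂ) := by push_cast; ring
    rw [e, Complex.norm_intCast]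
    have h1 := abs_le_bracket_one k
    have h2 := abs_le_bracket_one (k - l)
    have h3 := one_le_bracket zero_le_one k
    have h4 := one_le_bracket zero_le_one (k - l)
    have h5 : ((2 * k - l : ℤ) : ℝ) = k + ((k - l : ℤ) : ℝ) := by push_cast; ring
    rw [h5]
    have h6 := abs_add_le (k : ℝ) ((k - l : ℤ) : ℝ)
    nlinarith
  have hpi : ‖(2 * Real.pi * Complex.I : ℂ)‖ = 2 * Real.pi := by
    simp [abs_of_pos Real.pi_pos]
  rw [norm_mul, norm_mul, norm_mul, hpi]
  calc _ ≤ 2 * Real.pi * (2 * (bracket 1 k * bracket 1 (k - l))) * ‖vel m (k - l)‖ * M := by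
        have := bracket_pos 1 k
        have := bracket_pos 1 (k - l)
        gcongr
        exact hM l
    _ = _ := by ring

theorem norm_momentumRHS_le {m : ℤ → ℂ} {M : ℝ} (hM : ∀ l, ‖m l‖ ≤ M)
    (hv : Summable fun k => bracket 1 k * ‖vel m k‖) (k : ℤ) :
    Summable (fun l : ℤ => 2 * Real.pi * Complex.I * (2 * k - l) * vel m (k - l) * m l) ∧
    ‖momentumRHS m k‖ ≤
      4 * Real.pi * M * bracket 1 k * ∑' j, bracket 1 j * ‖vel m j‖ := by
  have h1 : Summable fun l => bracket 1 (k - l) * ‖vel m (k - l)‖ :=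
    (Equiv.subLeft k).summable_iff.2 hv
  have h2 : ∑' l, bracket 1 (k - l) * ‖vel m (k - l)‖ = ∑' j, bracket 1 j * ‖vel m j‖ :=
    (Equiv.subLeft k).tsum_eq fun j => bracket 1 j * ‖vel m j‖
  have h3 := h1.mul_left (4 * Real.pi * M * bracket 1 k)
  refine ⟨Summable.of_norm_bounded h3 (norm_momentumRHS_term_le hM k), ?_⟩
  rw [momentumRHS, norm_neg, ← h2, ← tsum_mul_left]
  exact tsum_of_norm_bounded h3.hasSum (norm_momentumRHS_term_le hM k)

/-- The flux of the regularized energy `∑ w(k)² |m(k)|²`, bounded uniformly in the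
regularization. -/
theorem exists_energy_flux_bound {σ : ℝ} (hσ : 0 ≤ σ) {K : ℕ} (hK : σ + 2 ≤ K) :
    ∃ C, 0 ≤ C ∧ ∀ ε, 0 < ε → ∀ m : ℤ → ℂ, (∀ k, m (-k) = conj (m k)) →
      (Summable fun k => ‖m k‖ ^ 2) → (Summable fun k => bracket (1 + σ) k * ‖vel m k‖) →
      |∑' k, regWeight σ ε K k ^ 2 * (2 * (conj (m k) * momentumRHS m k).re)| ≤
        C * (∑' k, bracket (1 + σ) k * ‖vel m k‖) *
          ((∑' k, (regWeight σ ε K k * ‖m k‖) ^ 2) + ∑' k, ‖m k‖ ^ 2) := by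
  obtain ⟨C, hC0, hC⟩ := exists_regWeight_commutator hσ (K := K) (by linarith)
  refine ⟨2 * Real.pi + 12 * Real.pi * C, by positivity, fun ε hε m hm hm2 hv => ?_⟩
  set w := regWeight σ ε K with hw
  have hw0 : ∀ k, 0 < w k := fun k => regWeight_pos hε.le K k
  set W := ε⁻¹ ^ K with hW
  have hwb : ∀ k, w k * bracket 2 k ≤ W := fun k => regWeight_mul_bracket_two_le hε hK k
  have hW0 : 0 ≤ W := by positivity
  have hb : ∀ k, 1 ≤ bracket 1 k := one_le_bracket zero_le_one
  have hb12 : ∀ k, bracket 1 k ≤ bracket 2 k := bracket_mono one_le_two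
  have hwb1 : ∀ k, w k * bracket 1 k ≤ W := fun k =>
    (mul_le_mul_of_nonneg_left (hb12 k) (hw0 k).le).trans (hwb k)
  have hw1 : ∀ k, w k ≤ W := fun k =>
    (le_mul_of_one_le_right (hw0 k).le (hb k)).trans (hwb1 k)
  set V : ℤ → ℝ := fun k => bracket (1 + σ) k * ‖vel m k‖ with hV
  have hV0 : ∀ k, 0 ≤ V k := fun k => mul_nonneg (bracket_pos _ _).le (norm_nonneg _)
  have hbV : ∀ k, bracket 1 k * ‖vel m k‖ ≤ V k := fun k =>
    mul_le_mul_of_nonneg_right (bracket_mono (by linarith) k) (norm_nonneg _)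
  have hvV : ∀ k, ‖vel m k‖ ≤ V k := fun k =>
    (le_mul_of_one_le_left (norm_nonneg _) (hb k)).trans (hbV k)
  have hv1 : Summable fun k => bracket 1 k * ‖vel m k‖ :=
    Summable.of_nonneg_of_le (fun k => mul_nonneg (bracket_pos _ _).le (norm_nonneg _)) hbV hv
  have hpi : ‖(2 * Real.pi * Complex.I : ℂ)‖ = 2 * Real.pi := by
    simp [abs_of_pos Real.pi_pos]
  -- square summability of the weighted coefficients
  have hsq : ∀ (g : ℤ → ℝ) (G : ℝ), (∀ k, 0 ≤ g k) → (∀ k, g k ≤ G) →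
      Summable fun k => (g k * ‖m k‖) ^ 2 := by
    intro g G hg hG
    refine Summable.of_nonneg_of_le (fun k => by positivity) (fun k => ?_) (hm2.mul_left (G ^ 2))
    rw [mul_pow]
    have := hg k
    have := hG k
    gcongr
  have ha := hsq w W (fun k => (hw0 k).le) hw1
  have ha1 := hsq (fun k => bracket 1 k * w k) W
    (fun k => mul_nonneg (bracket_pos _ _).le (hw0 k).le) (fun k => by rw [mul_comm]; exact hwb1 k)
  have ha2 := hsq (fun k => w k * (w k * bracket 1 k)) (W * W)
    (fun k => mul_nonneg (hw0 k).le (mul_nonneg (hw0 k).le (bracket_pos _ _).le))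
    (fun k => mul_le_mul (hw1 k) (hwb1 k) (mul_nonneg (hw0 k).le (bracket_pos _ _).le) hW0)
  -- the transport term
  set X : ℤ × ℤ → ℂ := fun q =>
    conj ((w q.1 : ℂ) * m q.1) * (Complex.I * q.2) * vel m (q.1 - q.2) * ((w q.2 : ℂ) * m q.2)
  obtain ⟨hXs, hXb⟩ := abs_re_tsum_transport_le (a := fun k => (w k : ℂ) * m k) (p := vel m)
    (vel_neg hm) (by
      refine ha1.congr fun k => ?_
      rw [norm_mul, Complex.norm_real, Real.norm_eq_abs, abs_of_pos (hw0 k), mul_assoc]) hv1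
  have hnorm : ∀ k, ‖(w k : ℂ) * m k‖ = w k * ‖m k‖ := fun k => by
    rw [norm_mul, Complex.norm_real, Real.norm_eq_abs, abs_of_pos (hw0 k)]
  simp only [hnorm] at hXb
  -- the full double series
  set F : ℤ × ℤ → ℂ := fun q => (w q.1 : ℂ) ^ 2 * (conj (m q.1) *
    (2 * Real.pi * Complex.I * (2 * q.1 - q.2) * vel m (q.1 - q.2) * m q.2)) with hF
  set Y : ℤ × ℤ → ℂ := fun q => F q - 2 * Real.pi * X q with hY
  have hYb : ∀ q, ‖Y q‖ ≤ 4 * Real.pi * C *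
      ((w q.1 * ‖m q.1‖) * V (q.1 - q.2) * (w q.2 * ‖m q.2‖) +
        (w q.1 * ‖m q.1‖) * V (q.1 - q.2) * ‖m q.2‖) := by
    intro q
    have h1 : Y q = (w q.1 : ℂ) * ((((w q.1 - w q.2) * q.2 +
        2 * w q.1 * ((q.1 - q.2 : ℤ) : ℝ) : ℝ)) : ℂ) *
          (2 * Real.pi * Complex.I) * conj (m q.1) * vel m (q.1 - q.2) * m q.2 := by
      simp only [hY, hF, X, map_mul, Complex.conj_ofReal]
      push_cast
      ring
    rw [h1, norm_mul, norm_mul, norm_mul, norm_mul, norm_mul, hpi, RCLike.norm_conj,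
      Complex.norm_real, Complex.norm_real, Real.norm_eq_abs, Real.norm_eq_abs, abs_of_pos (hw0 _)]
    have h2 := hC ε hε.le q.1 q.2
    rw [← hw] at h2
    have h3 : |(w q.1 - w q.2) * q.2 + 2 * w q.1 * ((q.1 - q.2 : ℤ) : ℝ)| ≤
        2 * (C * bracket 1 (q.1 - q.2) * (w q.2 * bracket σ (q.1 - q.2) +
          bracket σ (q.1 - q.2))) := by
      have hj := abs_le_bracket_one (q.1 - q.2)
      have hσ1 := one_le_bracket hσ (q.1 - q.2)
      calc _ ≤ |w q.1 - w q.2| * |(q.2 : ℝ)| + 2 * w q.1 * |((q.1 - q.2 : ℤ) : ℝ)| := by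
            refine (abs_add_le _ _).trans (le_of_eq ?_)
            rw [abs_mul, abs_mul, abs_of_pos (by linarith [hw0 q.1] : 0 < 2 * w q.1)]
        _ ≤ 2 * (|w q.1 - w q.2| * |(q.2 : ℝ)| + w q.1 * |((q.1 - q.2 : ℤ) : ℝ)|) := by
            have : 0 ≤ |w q.1 - w q.2| * |(q.2 : ℝ)| := by positivity
            linarith
        _ ≤ 2 * (C * |((q.1 - q.2 : ℤ) : ℝ)| * (w q.2 + bracket σ (q.1 - q.2))) := by gcongr
        _ ≤ _ := by
            have := hw0 q.2
            have := bracket_pos σ (q.1 - q.2)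
            have := bracket_pos 1 (q.1 - q.2)
            gcongr
            exact le_mul_of_one_le_right (hw0 _).le hσ1
    calc _ ≤ w q.1 * (2 * (C * bracket 1 (q.1 - q.2) * (w q.2 * bracket σ (q.1 - q.2) +
          bracket σ (q.1 - q.2)))) * (2 * Real.pi) * ‖m q.1‖ * ‖vel m (q.1 - q.2)‖ * ‖m q.2‖ := by
            have := hw0 q.1
            gcongr
      _ = _ := by
            simp only [hV, bracket_add 1 σ]
            ring
  obtain ⟨hy1, hy1b⟩ := young_trilinear (a := fun k => w k * ‖m k‖) (b := V)
    (c := fun k => w k * ‖m k‖)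
    (fun k => mul_nonneg (hw0 k).le (norm_nonneg _)) hV0
    (fun k => mul_nonneg (hw0 k).le (norm_nonneg _)) ha hv ha
  obtain ⟨hy2, hy2b⟩ := young_trilinear (a := fun k => w k * ‖m k‖) (b := V)
    (c := fun k => ‖m k‖)
    (fun k => mul_nonneg (hw0 k).le (norm_nonneg _)) hV0 (fun k => norm_nonneg _) ha hv hm2
  have hYmaj := (hy1.add hy2).mul_left (4 * Real.pi * C)
  have hYs : Summable Y := Summable.of_norm_bounded hYmaj hYb
  have hYsum : ‖∑' q, Y q‖ ≤ 4 * Real.pi * C * ((∑' k, V k) *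
      ((∑' k, (w k * ‖m k‖) ^ 2) + ∑' k, (w k * ‖m k‖) ^ 2) / 2 +
      (∑' k, V k) * ((∑' k, (w k * ‖m k‖) ^ 2) + ∑' k, ‖m k‖ ^ 2) / 2) := by
    refine (tsum_of_norm_bounded hYmaj.hasSum hYb).trans ?_
    rw [tsum_mul_left, hy1.tsum_add hy2]
    gcongr
  have hFs : Summable F := by
    have h1 : F = fun q => Y q + 2 * Real.pi * X q := by
      ext q; simp only [hY]; ring
    rw [h1]
    exact hYs.add (hXs.mul_left _)
  have hFsum : ∑' q, F q = (∑' q, Y q) + 2 * Real.pi * ∑' q, X q := by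
    rw [← tsum_mul_left, ← hYs.tsum_add (hXs.mul_left _)]
    refine tsum_congr fun q => ?_
    simp only [hY]; ring
  have hFsum2 : ∑' q, F q = -∑' k, (w k : ℂ) ^ 2 * (conj (m k) * momentumRHS m k) := by
    rw [hFs.tsum_prod, ← tsum_neg]
    refine tsum_congr fun k => ?_
    simp only [hF]
    rw [tsum_mul_left, tsum_mul_left, momentumRHS]
    ring
  have hsm : Summable fun k => (w k : ℂ) ^ 2 * (conj (m k) * momentumRHS m k) := by
    have h1 := hFs.prod.neg
    refine h1.congr fun k => ?_
    simp only [hF]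
    rw [tsum_mul_left, tsum_mul_left, momentumRHS]
    ring
  have hre : ∑' k, w k ^ 2 * (2 * (conj (m k) * momentumRHS m k).re) =
      -(2 * (∑' q, F q).re) := by
    rw [hFsum2, Complex.neg_re, Complex.re_tsum hsm, mul_neg, neg_neg, ← tsum_mul_left]
    refine tsum_congr fun k => ?_
    rw [← Complex.ofReal_pow, Complex.re_ofReal_mul]
    ring
  rw [hre, hFsum, abs_neg, abs_mul, abs_two, Complex.add_re]
  have h2pi : (2 * Real.pi * ∑' q, X q : ℂ).re = 2 * Real.pi * (∑' q, X q).re := by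
    rw [← Complex.re_ofReal_mul]; push_cast; rfl
  rw [h2pi]
  have hV1 : ∑' k, bracket 1 k * ‖vel m k‖ ≤ ∑' k, V k := hv1.tsum_le_tsum hbV hv
  have hE0 : 0 ≤ ∑' k, (w k * ‖m k‖) ^ 2 := tsum_nonneg fun k => sq_nonneg _
  have hM0 : 0 ≤ ∑' k, ‖m k‖ ^ 2 := tsum_nonneg fun k => sq_nonneg _
  have hV0' : 0 ≤ ∑' k, V k := tsum_nonneg hV0
  have hXb' : |(∑' q, X q).re| ≤ (∑' k, V k) * (∑' k, (w k * ‖m k‖) ^ 2) / 2 :=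
    hXb.trans (by gcongr)
  have hYre := (Complex.abs_re_le_norm (∑' q, Y q)).trans hYsum
  set E := ∑' k, (w k * ‖m k‖) ^ 2
  set M := ∑' k, ‖m k‖ ^ 2
  set S := ∑' k, V k
  have h1 : |(∑' q, Y q).re + 2 * Real.pi * (∑' q, X q).re| ≤
      4 * Real.pi * C * (S * (E + E) / 2 + S * (E + M) / 2) + 2 * Real.pi * (S * E / 2) := by
    refine (abs_add_le _ _).trans (add_le_add hYre ?_)
    rw [abs_mul, abs_of_pos Real.two_pi_pos]
    gcongr
  have h2 : 0 ≤ S * M * Real.pi := by positivity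
  have h3 : 0 ≤ C * (S * M * Real.pi) := by positivity
  nlinarith

/-- Gronwall's inequality, in both directions of time. -/
theorem abs_le_mul_exp_of_abs_deriv_le {y y' : ℝ → ℝ} {C T : ℝ}
    (hy : ∀ t ∈ Set.Ioo (-T) T, HasDerivAt y (y' t) t)
    (hb : ∀ t ∈ Set.Ioo (-T) T, |y' t| ≤ C * |y t|) {t : ℝ} (ht : t ∈ Set.Ioo (-T) T) :
    |y t| ≤ |y 0| * Real.exp (C * |t|) := by
  have key : ∀ z z' : ℝ → ℝ, (∀ t ∈ Set.Ioo (-T) T, HasDerivAt z (z' t) t) →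
      (∀ t ∈ Set.Ioo (-T) T, |z' t| ≤ C * |z t|) → ∀ t, 0 ≤ t → t ∈ Set.Ioo (-T) T →
      |z t| ≤ |z 0| * Real.exp (C * t) := by
    intro z z' hz hzb t ht0 ht
    have hsub : ∀ x ∈ Set.Icc 0 t, x ∈ Set.Ioo (-T) T := fun x hx =>
      ⟨by linarith [hx.1, ht.1, ht.2], hx.2.trans_lt ht.2⟩
    have h := norm_le_gronwallBound_of_norm_deriv_right_le (f := z) (f' := z') (δ := |z 0|)
      (K := C) (ε := 0) (a := 0) (b := t)
      (fun x hx => (hz x (hsub x hx)).continuousAt.continuousWithinAt)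
      (fun x hx => (hz x (hsub x ⟨hx.1, hx.2.le⟩)).hasDerivWithinAt) le_rfl
      (fun x hx => by simpa using hzb x (hsub x ⟨hx.1, hx.2.le⟩)) t ⟨ht0, le_rfl⟩
    simpa [gronwallBound_ε0] using h
  rcases le_total 0 t with h | h
  · rw [abs_of_nonneg h]; exact key y y' hy hb t h ht
  · rw [abs_of_nonpos h]
    have hneg : ∀ x ∈ Set.Ioo (-T) T, -x ∈ Set.Ioo (-T) T := fun x hx =>
      ⟨by linarith [hx.2], by linarith [hx.1]⟩
    have h1 := key (fun x => y (-x)) (fun x => -y' (-x))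
      (fun x hx => by
        have := (hy (-x) (hneg x hx)).scomp x (hasDerivAt_neg x)
        simpa [Function.comp_def] using this)
      (fun x hx => by simpa using hb (-x) (hneg x hx)) (-t) (by linarith) (hneg t ht)
    simpa using h1

/-! ### Propagation of Sobolev regularity -/

/-- A family of Fourier coefficients of real functions that solves the momentum equation
`m_t + u m_x + 2 u_x m = 0`, `m = A u`, coefficient by coefficient for `|t| < T`. -/
structure IsMomentumSolution (T : ℝ) (m : ℝ → ℤ → ℂ) : Prop where
  conj_symm : ∀ t ∈ Set.Ioo (-T) T, ∀ k, m t (-k) = conj (m t k)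
  hasDerivAt : ∀ t ∈ Set.Ioo (-T) T, ∀ k, HasDerivAt (fun τ => m τ k) (momentumRHS (m t) k) t

/-- The `H^σ` norm of `m t` is bounded for `|t| < T`. -/
def BddWeighted (T σ : ℝ) (m : ℝ → ℤ → ℂ) : Prop :=
  ∃ B, ∀ t ∈ Set.Ioo (-T) T, (Summable fun k => (bracket σ k * ‖m t k‖) ^ 2) ∧
    ∑' k, (bracket σ k * ‖m t k‖) ^ 2 ≤ B

theorem summable_weighted_mono {σ τ : ℝ} (h : τ ≤ σ) {a : ℤ → ℂ}
    (ha : Summable fun k => (bracket σ k * ‖a k‖) ^ 2) :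
    (Summable fun k => (bracket τ k * ‖a k‖) ^ 2) ∧
      ∑' k, (bracket τ k * ‖a k‖) ^ 2 ≤ ∑' k, (bracket σ k * ‖a k‖) ^ 2 := by
  have h1 : ∀ k, (bracket τ k * ‖a k‖) ^ 2 ≤ (bracket σ k * ‖a k‖) ^ 2 := fun k => by
    have := bracket_pos τ k
    have := bracket_mono h k
    gcongr
  have h2 := Summable.of_nonneg_of_le (fun k => sq_nonneg _) h1 ha
  exact ⟨h2, h2.tsum_le_tsum h1 ha⟩

theorem hasDerivAt_norm_sq {z : ℝ → ℂ} {z' : ℂ} {t : ℝ} (h : HasDerivAt z z' t) :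
    HasDerivAt (fun τ => ‖z τ‖ ^ 2) (2 * (conj (z t) * z').re) t := by
  have h1 := h.norm_sq
  rwa [Complex.inner, mul_comm z'] at h1

theorem tendsto_regWeight (σ : ℝ) (K : ℕ) (k : ℤ) :
    Filter.Tendsto (fun ε => regWeight σ ε K k) (nhdsWithin 0 (Set.Ioi 0))
      (nhds (bracket σ k)) := by
  have h1 : ContinuousAt (fun ε => regWeight σ ε K k) 0 := by
    unfold regWeight
    refine ContinuousAt.div (by fun_prop) (by fun_prop) (by simp)
  have h2 := h1.tendsto
  simp only [regWeight, zero_mul, add_zero, one_pow, div_one] at h2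
  exact h2.mono_left nhdsWithin_le_nhds

theorem hasDerivAt_regEnergy {T σ ε B S : ℝ} {K : ℕ} (hK : σ + 2 ≤ K) (hε : 0 < ε)
    {m : ℝ → ℤ → ℂ} (hm : IsMomentumSolution T m)
    (hB : ∀ t ∈ Set.Ioo (-T) T, (Summable fun k => ‖m t k‖ ^ 2) ∧ ∑' k, ‖m t k‖ ^ 2 ≤ B)
    (hS : ∀ t ∈ Set.Ioo (-T) T, (Summable fun k => bracket 1 k * ‖vel (m t) k‖) ∧
      ∑' k, bracket 1 k * ‖vel (m t) k‖ ≤ S) {t : ℝ} (ht : t ∈ Set.Ioo (-T) T) :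
    HasDerivAt (fun τ => ∑' k, (regWeight σ ε K k * ‖m τ k‖) ^ 2)
      (∑' k, regWeight σ ε K k ^ 2 * (2 * (conj (m t k) * momentumRHS (m t) k).re)) t := by
  have hnorm : ∀ τ ∈ Set.Ioo (-T) T, ∀ k, ‖m τ k‖ ≤ √B := by
    intro τ hτ k
    apply Real.le_sqrt_of_sq_le
    exact ((hB τ hτ).1.le_tsum k fun j _ => sq_nonneg _).trans (hB τ hτ).2
  have hB0 : 0 ≤ √B := Real.sqrt_nonneg _
  have hW : Summable fun k : ℤ =>
      (8 * Real.pi * √B ^ 2 * S * (ε⁻¹ ^ K) ^ 2) * bracket (-3) k :=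
    (summable_bracket (by norm_num)).mul_left _
  have hw0 : ∀ k, 0 < regWeight σ ε K k := fun k => regWeight_pos hε.le K k
  have hS0 : 0 ≤ S := le_trans (tsum_nonneg fun k =>
    mul_nonneg (bracket_pos _ _).le (norm_nonneg _)) (hS t ht).2
  refine hasDerivAt_tsum_of_isPreconnected (𝕜 := ℝ) (F := ℝ) (y₀ := t)
    (g := fun k τ => (regWeight σ ε K k * ‖m τ k‖) ^ 2)
    (g' := fun k τ => regWeight σ ε K k ^ 2 * (2 * (conj (m τ k) * momentumRHS (m τ) k).re)) hW isOpen_Ioo isPreconnected_Ioo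
    (fun k τ hτ => ?_) (fun k τ hτ => ?_) ht ?_ ht
  · simp only [mul_pow]
    exact (hasDerivAt_norm_sq (hm.hasDerivAt τ hτ k)).const_mul _
  · have h1 := (norm_momentumRHS_le (hnorm τ hτ) (hS τ hτ).1 k).2
    have h2 : |(conj (m τ k) * momentumRHS (m τ) k).re| ≤
        √B * (4 * Real.pi * √B * bracket 1 k * S) := by
      refine (Complex.abs_re_le_norm _).trans ?_
      rw [norm_mul, RCLike.norm_conj]
      have := bracket_pos 1 k
      refine mul_le_mul (hnorm τ hτ k) (h1.trans ?_) (norm_nonneg _) hB0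
      exact mul_le_mul_of_nonneg_left (hS τ hτ).2 (by positivity)
    have h3 : regWeight σ ε K k ^ 2 * bracket 1 k ≤ (ε⁻¹ ^ K) ^ 2 * bracket (-3) k := by
      have e : bracket 1 k = bracket 2 k ^ 2 * bracket (-3) k := by
        rw [← bracket_two_mul, ← bracket_add]; norm_num
      rw [e, ← mul_assoc, ← mul_pow]
      have := bracket_pos (-3) k
      have := bracket_pos 2 k
      have := hw0 k
      gcongr
      exact regWeight_mul_bracket_two_le hε hK k
    rw [Real.norm_eq_abs, abs_mul, abs_of_pos (pow_pos (hw0 k) 2), abs_mul, abs_two]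
    calc _ ≤ regWeight σ ε K k ^ 2 * (2 * (√B * (4 * Real.pi * √B * bracket 1 k * S))) := by
          gcongr
      _ = (8 * Real.pi * √B ^ 2 * S) * (regWeight σ ε K k ^ 2 * bracket 1 k) := by ring
      _ ≤ (8 * Real.pi * √B ^ 2 * S) * ((ε⁻¹ ^ K) ^ 2 * bracket (-3) k) := by gcongr
      _ = _ := by ring
  · have hw1 : ∀ k, regWeight σ ε K k ≤ ε⁻¹ ^ K := fun k =>
      (le_mul_of_one_le_right (hw0 k).le (one_le_bracket zero_le_two k)).trans
        (regWeight_mul_bracket_two_le hε hK k)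
    refine Summable.of_nonneg_of_le (fun k => sq_nonneg _) (fun k => ?_)
      ((hB t ht).1.mul_left ((ε⁻¹ ^ K) ^ 2))
    rw [mul_pow]
    have := hw0 k
    have := hw1 k
    gcongr

/-- Energy estimate: `H^σ` regularity of the momentum propagates, with a Lipschitz norm, as long as
the velocity is controlled in a weaker norm. -/
theorem IsMomentumSolution.bddWeighted_of_vel {T σ S : ℝ} (hσ : 0 ≤ σ)
    {m : ℝ → ℤ → ℂ} (hm : IsMomentumSolution T m) (hT : 0 < T) (h0 : BddWeighted T 0 m)
    (hS : ∀ t ∈ Set.Ioo (-T) T, (Summable fun k => bracket (1 + σ) k * ‖vel (m t) k‖) ∧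
      ∑' k, bracket (1 + σ) k * ‖vel (m t) k‖ ≤ S)
    (hi : Summable fun k => (bracket σ k * ‖m 0 k‖) ^ 2) :
    BddWeighted T σ m ∧ ∃ L, ∀ s ∈ Set.Ioo (-T) T, ∀ t ∈ Set.Ioo (-T) T,
      |(∑' k, (bracket σ k * ‖m t k‖) ^ 2) - ∑' k, (bracket σ k * ‖m s k‖) ^ 2| ≤
        L * |t - s| := by
  obtain ⟨K, hK⟩ := exists_nat_ge (σ + 2)
  obtain ⟨C, hC0, hC⟩ := exists_energy_flux_bound hσ hK
  obtain ⟨B, hB⟩ := h0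
  simp only [bracket_zero, one_mul] at hB
  have h0T : (0 : ℝ) ∈ Set.Ioo (-T) T := ⟨by linarith, hT⟩
  have hB0 : 0 ≤ B := le_trans (tsum_nonneg fun k => sq_nonneg _) (hB 0 h0T).2
  have hS0 : 0 ≤ S := le_trans (tsum_nonneg fun k =>
    mul_nonneg (bracket_pos _ _).le (norm_nonneg _)) (hS 0 h0T).2
  have hS1 : ∀ t ∈ Set.Ioo (-T) T, (Summable fun k => bracket 1 k * ‖vel (m t) k‖) ∧
      ∑' k, bracket 1 k * ‖vel (m t) k‖ ≤ S := by
    intro t ht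
    have h1 : ∀ k, bracket 1 k * ‖vel (m t) k‖ ≤ bracket (1 + σ) k * ‖vel (m t) k‖ := fun k =>
      mul_le_mul_of_nonneg_right (bracket_mono (by linarith) k) (norm_nonneg _)
    have h2 := Summable.of_nonneg_of_le
      (fun k => mul_nonneg (bracket_pos 1 k).le (norm_nonneg _)) h1 (hS t ht).1
    exact ⟨h2, (h2.tsum_le_tsum h1 (hS t ht).1).trans (hS t ht).2⟩
  set E : ℝ → ℝ → ℝ := fun ε t => ∑' k, (regWeight σ ε K k * ‖m t k‖) ^ 2 with hE
  set Φ : ℝ → ℝ → ℝ := fun ε t =>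
    ∑' k, regWeight σ ε K k ^ 2 * (2 * (conj (m t k) * momentumRHS (m t) k).re) with hΦ
  have hE0 : ∀ ε t, 0 ≤ E ε t := fun ε t => tsum_nonneg fun k => sq_nonneg _
  have hd : ∀ ε, 0 < ε → ∀ t ∈ Set.Ioo (-T) T, HasDerivAt (E ε) (Φ ε t) t :=
    fun ε hε t ht => hasDerivAt_regEnergy hK hε hm hB hS1 ht
  set Λ := C * S with hΛ
  have hΛ0 : 0 ≤ Λ := mul_nonneg hC0 hS0
  have hflux : ∀ ε, 0 < ε → ∀ t ∈ Set.Ioo (-T) T, |Φ ε t| ≤ Λ * (E ε t + B) := by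
    intro ε hε t ht
    refine (hC ε hε (m t) (hm.conj_symm t ht) (hB t ht).1 (hS t ht).1).trans ?_
    have h1 := (hB t ht).2
    have h2 := (hS t ht).2
    have h3 : 0 ≤ ∑' k, ‖m t k‖ ^ 2 := tsum_nonneg fun k => sq_nonneg _
    have h4 := hE0 ε t
    simp only [hE] at h4
    simp only [hE, hΛ]
    gcongr
  set E0 := ∑' k, (bracket σ k * ‖m 0 k‖) ^ 2 with hE0def
  set B' := (E0 + B) * Real.exp (Λ * T) with hB'
  have hreg_le : ∀ ε, 0 < ε → ∀ a : ℤ → ℂ, ∀ k,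
      (regWeight σ ε K k * ‖a k‖) ^ 2 ≤ (bracket σ k * ‖a k‖) ^ 2 := fun ε hε a k => by
    have := regWeight_pos (σ := σ) hε.le K k
    have := regWeight_le (σ := σ) hε.le K k
    gcongr
  have hbound : ∀ ε, 0 < ε → ∀ t ∈ Set.Ioo (-T) T, E ε t + B ≤ B' := by
    intro ε hε t ht
    have h1 := abs_le_mul_exp_of_abs_deriv_le (y := fun τ => E ε τ + B) (y' := Φ ε) (C := Λ)
      (fun τ hτ => (hd ε hε τ hτ).add_const B)
      (fun τ hτ => by
        rw [abs_of_nonneg (add_nonneg (hE0 ε τ) hB0)]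
        exact hflux ε hε τ hτ) ht
    rw [abs_of_nonneg (add_nonneg (hE0 ε t) hB0), abs_of_nonneg (add_nonneg (hE0 ε 0) hB0)] at h1
    refine h1.trans ?_
    have h2 : E ε 0 ≤ E0 :=
      (Summable.of_nonneg_of_le (fun k => sq_nonneg _) (hreg_le ε hε (m 0)) hi).tsum_le_tsum
        (hreg_le ε hε (m 0)) hi
    have h3 : |t| ≤ T := abs_le.2 ⟨ht.1.le, ht.2.le⟩
    have h4 := hE0 ε 0
    rw [hB']
    gcongr
  have hregs : ∀ ε, 0 < ε → ∀ t ∈ Set.Ioo (-T) T,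
      Summable fun k => (regWeight σ ε K k * ‖m t k‖) ^ 2 := by
    intro ε hε t ht
    refine Summable.of_nonneg_of_le (fun k => sq_nonneg _) (fun k => ?_)
      ((hB t ht).1.mul_left ((ε⁻¹ ^ K) ^ 2))
    rw [mul_pow]
    have h1 := regWeight_pos (σ := σ) hε.le K k
    have h2 := (le_mul_of_one_le_right h1.le (one_le_bracket zero_le_two k)).trans
        (regWeight_mul_bracket_two_le hε hK k)
    gcongr
  have hfin : ∀ t ∈ Set.Ioo (-T) T, ∀ s : Finset ℤ,
      ∑ k ∈ s, (bracket σ k * ‖m t k‖) ^ 2 ≤ B' := by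
    intro t ht s
    have h1 : Filter.Tendsto (fun ε => ∑ k ∈ s, (regWeight σ ε K k * ‖m t k‖) ^ 2)
        (nhdsWithin 0 (Set.Ioi 0)) (nhds (∑ k ∈ s, (bracket σ k * ‖m t k‖) ^ 2)) :=
      tendsto_finsetSum _ fun k _ => ((tendsto_regWeight σ K k).mul_const _).pow 2
    refine le_of_tendsto h1 ?_
    filter_upwards [self_mem_nhdsWithin] with ε hε
    have h2 := (hregs ε hε t ht).sum_le_tsum s fun k _ => sq_nonneg _
    have h3 := hbound ε hε t ht
    simp only [hE] at h3
    linarith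
  have hsum : ∀ t ∈ Set.Ioo (-T) T, Summable fun k => (bracket σ k * ‖m t k‖) ^ 2 :=
    fun t ht => summable_of_sum_le (fun k => sq_nonneg _) (hfin t ht)
  refine ⟨⟨B', fun t ht => ⟨hsum t ht, (hsum t ht).tsum_le_of_sum_le (hfin t ht)⟩⟩, Λ * B',
    fun s hs t ht => ?_⟩
  have hlim : ∀ t ∈ Set.Ioo (-T) T, Filter.Tendsto (fun ε => E ε t)
      (nhdsWithin 0 (Set.Ioi 0)) (nhds (∑' k, (bracket σ k * ‖m t k‖) ^ 2)) := by
    intro t ht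
    refine tendsto_tsum_of_dominated_convergence (hsum t ht)
      (fun k => ((tendsto_regWeight σ K k).mul_const _).pow 2) ?_
    filter_upwards [self_mem_nhdsWithin] with ε hε k
    rw [Real.norm_eq_abs, abs_of_nonneg (sq_nonneg _)]
    exact hreg_le ε hε (m t) k
  refine le_of_tendsto ((hlim t ht).sub (hlim s hs)).abs ?_
  filter_upwards [self_mem_nhdsWithin] with ε hε
  have h1 := (convex_Ioo (-T) T).norm_image_sub_le_of_norm_hasDerivWithin_le (f := E ε)
    (f' := Φ ε) (C := Λ * B') (fun x hx => (hd ε hε x hx).hasDerivWithinAt)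
    (fun x hx => (hflux ε hε x hx).trans
      (mul_le_mul_of_nonneg_left (hbound ε hε x hx) hΛ0)) hs ht
  simpa [Real.norm_eq_abs] using h1

/-- The velocity gains more than one derivative over the momentum, in `ℓ¹`. -/
theorem BddWeighted.vel_bound {T σ σ' : ℝ} {m : ℝ → ℤ → ℂ} (hm : BddWeighted T σ' m)
    (h : σ ≤ σ' + 1 / 4) :
    ∃ S, ∀ t ∈ Set.Ioo (-T) T, (Summable fun k => bracket (1 + σ) k * ‖vel (m t) k‖) ∧
      ∑' k, bracket (1 + σ) k * ‖vel (m t) k‖ ≤ S := by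
  obtain ⟨B, hB⟩ := hm
  have hZ : (0 : ℝ) ≤ ∑' k : ℤ, bracket (-(2 * (3 / 4 : ℝ))) k :=
    tsum_nonneg fun k => (bracket_pos _ _).le
  refine ⟨2 * √((∑' k, bracket (-(2 * (3 / 4 : ℝ))) k) * B), fun t ht => ?_⟩
  have h1 : ∀ k, bracket (1 + σ) k * ‖vel (m t) k‖ ≤ 2 * (bracket (-(3 / 4)) k *
      (bracket σ' k * ‖m t k‖)) := by
    intro k
    calc _ ≤ bracket (1 + σ) k * (2 * bracket (-2) k * ‖m t k‖) :=
          mul_le_mul_of_nonneg_left (norm_vel_le _ k) (bracket_pos _ _).le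
      _ = 2 * (bracket (1 + σ + -2) k * ‖m t k‖) := by rw [bracket_add (1 + σ)]; ring
      _ ≤ 2 * (bracket (-(3 / 4) + σ') k * ‖m t k‖) := by
          gcongr; exact bracket_mono (by linarith) k
      _ = _ := by rw [bracket_add]; ring
  have h2 : ∀ k, bracket (3 / 4) k * (bracket (-(3 / 4)) k * (bracket σ' k * ‖m t k‖)) =
      bracket σ' k * ‖m t k‖ := by
    intro k
    rw [← mul_assoc, mul_comm (bracket (3 / 4) k), bracket_neg_exp_mul, one_mul]
  obtain ⟨h3, h4⟩ := summable_of_weighted (s := 3 / 4) (by norm_num)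
    (a := fun k => bracket (-(3 / 4)) k * (bracket σ' k * ‖m t k‖))
    (fun k => mul_nonneg (bracket_pos _ _).le (mul_nonneg (bracket_pos _ _).le (norm_nonneg _)))
    (by simpa only [h2] using (hB t ht).1)
  simp only [h2] at h4
  have h5 := Summable.of_nonneg_of_le
    (fun k => mul_nonneg (bracket_pos (1 + σ) k).le (norm_nonneg _)) h1 (h3.mul_left 2)
  refine ⟨h5, (h5.tsum_le_tsum h1 (h3.mul_left 2)).trans ?_⟩
  rw [tsum_mul_left]
  gcongr
  apply Real.le_sqrt_of_sq_le
  exact h4.trans (mul_le_mul_of_nonneg_left (hB t ht).2 hZ)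

/-- A momentum bounded in `L²` keeps the Sobolev regularity of its initial value, and its Sobolev
norm is Lipschitz in time: the regularity is gained in steps of `1/4`. -/
theorem IsMomentumSolution.propagation {T σ : ℝ} (hσ : 0 ≤ σ)
    {m : ℝ → ℤ → ℂ} (hm : IsMomentumSolution T m) (hT : 0 < T) (h0 : BddWeighted T 0 m)
    (hi : Summable fun k => (bracket σ k * ‖m 0 k‖) ^ 2) :
    BddWeighted T σ m ∧ ∃ L, ∀ s ∈ Set.Ioo (-T) T, ∀ t ∈ Set.Ioo (-T) T,
      |(∑' k, (bracket σ k * ‖m t k‖) ^ 2) - ∑' k, (bracket σ k * ‖m s k‖) ^ 2| ≤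
        L * |t - s| := by
  have hb : ∀ n : ℕ, BddWeighted T (min σ (n / 4)) m := by
    intro n
    induction n with
    | zero => simpa [hσ] using h0
    | succ n ih =>
      have h1 : min σ ((n + 1 : ℕ) / 4) ≤ min σ (n / 4) + 1 / 4 := by
        rw [min_add]
        refine min_le_min (by linarith) ?_
        push_cast; linarith
      obtain ⟨S, hS⟩ := ih.vel_bound h1
      exact (hm.bddWeighted_of_vel (le_min hσ (by positivity)) hT h0 hS
        (summable_weighted_mono (min_le_left _ _) hi).1).1
  obtain ⟨n, hn⟩ := exists_nat_ge (4 * σ)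
  have h1 := hb n
  rw [min_eq_left (by linarith)] at h1
  obtain ⟨S, hS⟩ := h1.vel_bound (σ := σ) (by linarith)
  exact hm.bddWeighted_of_vel hσ hT h0 hS hi

/-! ### The velocity equation on the Fourier side -/

/-- The convolution of two sequences: the Fourier coefficients of a product. -/
noncomputable def convSeq (a c : ℤ → ℂ) (k : ℤ) : ℂ := ∑' l, a (k - l) * c l

/-- The derivative `∂ₓ` on the Fourier side. -/
noncomputable def dSeq (v : ℤ → ℂ) (k : ℤ) : ℂ := 2 * Real.pi * Complex.I * k * v k

/-- The `k`-th Fourier coefficient of `-u u_x - A⁻¹ ∂ₓ (2 μ(u) u + ½ u_x²)`. -/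
noncomputable def velocityRHS (v : ℤ → ℂ) (k : ℤ) : ℂ :=
  -convSeq v (dSeq v) k - 2 * Real.pi * Complex.I * k / symb k *
    (2 * v 0 * v k + 1 / 2 * convSeq (dSeq v) (dSeq v) k)

theorem convSeq_bound {a c : ℤ → ℂ} {M : ℝ} (ha : Summable fun k => ‖a k‖)
    (hc : ∀ k, ‖c k‖ ≤ M) (k : ℤ) :
    (Summable fun l => a (k - l) * c l) ∧ ‖convSeq a c k‖ ≤ (∑' j, ‖a j‖) * M := by
  have h1 : Summable fun l => ‖a (k - l)‖ := (Equiv.subLeft k).summable_iff.2 ha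
  have h2 : ∑' l, ‖a (k - l)‖ = ∑' j, ‖a j‖ := (Equiv.subLeft k).tsum_eq fun j => ‖a j‖
  have h3 : ∀ l, ‖a (k - l) * c l‖ ≤ ‖a (k - l)‖ * M := fun l => by
    rw [norm_mul]; exact mul_le_mul_of_nonneg_left (hc l) (norm_nonneg _)
  refine ⟨Summable.of_norm_bounded (h1.mul_right M) h3, ?_⟩
  have h4 := tsum_of_norm_bounded (h1.mul_right M).hasSum h3
  rwa [tsum_mul_right, h2] at h4

theorem convSeq_comm (a c : ℤ → ℂ) (k : ℤ) : convSeq a c k = convSeq c a k := by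
  unfold convSeq
  rw [← (Equiv.subLeft k).tsum_eq]
  refine tsum_congr fun l => ?_
  simp [mul_comm]

theorem norm_dSeq (v : ℤ → ℂ) (k : ℤ) : ‖dSeq v k‖ = 2 * Real.pi * |(k : ℝ)| * ‖v k‖ := by
  simp [dSeq, abs_of_pos Real.pi_pos]

theorem norm_dSeq_le (v : ℤ → ℂ) (k : ℤ) : ‖dSeq v k‖ ≤ 2 * Real.pi * (bracket 2 k * ‖v k‖) := by
  rw [norm_dSeq, mul_assoc]
  have := (abs_le_bracket_one k).trans (bracket_mono one_le_two k)
  gcongr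

/-- Sums against a sequence that is odd under the reflection `l ↦ k - l` vanish. -/
theorem tsum_eq_zero_of_reflect {f : ℤ → ℂ} (k : ℤ) (h : ∀ l, f (k - l) = -f l) :
    ∑' l, f l = 0 := by
  have h1 : ∑' l, f l = -∑' l, f l := by
    conv_lhs => rw [← (Equiv.subLeft k).tsum_eq]
    rw [← tsum_neg]
    exact tsum_congr fun l => h l
  exact self_eq_neg.1 h1

theorem summable_of_bracket_two {v : ℤ → ℂ} (hv : Summable fun k => bracket 2 k * ‖v k‖) :
    (Summable fun k => bracket 1 k * ‖v k‖) ∧ (Summable fun k => ‖v k‖) ∧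
      Summable fun k => ‖dSeq v k‖ := by
  refine ⟨Summable.of_nonneg_of_le (fun k => ?_) (fun k => ?_) hv,
    Summable.of_nonneg_of_le (fun k => norm_nonneg _) (fun k => ?_) hv,
    Summable.of_nonneg_of_le (fun k => norm_nonneg _) (norm_dSeq_le v) (hv.mul_left _)⟩
  · exact mul_nonneg (bracket_pos _ _).le (norm_nonneg _)
  · exact mul_le_mul_of_nonneg_right (bracket_mono one_le_two k) (norm_nonneg _)
  · exact le_mul_of_one_le_left (norm_nonneg _) (one_le_bracket zero_le_two k)

theorem le_tsum_norm {v : ℤ → ℂ} (hv : Summable fun k => ‖v k‖) (k : ℤ) : ‖v k‖ ≤ ∑' j, ‖v j‖ :=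
  hv.le_tsum k fun _ _ => norm_nonneg _

theorem symb_mul_vel (m : ℤ → ℂ) (k : ℤ) : (symb k : ℂ) * vel m k = m k := by
  rw [vel, mul_div_cancel₀]
  exact_mod_cast (symb_pos k).ne'

/-- `u_t + u u_x + A⁻¹ ∂ₓ (2 μ(u) u + ½ u_x²) = 0` is `A⁻¹` applied to `m_t + u m_x + 2 u_x m = 0`.
On the Fourier side the two differ by a series that is odd under `l ↦ k - l`. -/
theorem velocityRHS_vel {m : ℤ → ℂ} (hm : Summable fun k => ‖m k‖) (k : ℤ) :
    velocityRHS (vel m) k = momentumRHS m k / symb k := by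
  have hv : Summable fun k => bracket 2 k * ‖vel m k‖ := by
    refine Summable.of_nonneg_of_le (fun k => mul_nonneg (bracket_pos _ _).le (norm_nonneg _))
      (fun k => ?_) (hm.mul_left 2)
    have h1 := norm_vel_le m k
    have h2 := bracket_neg_exp_mul 2 k
    calc _ ≤ bracket 2 k * (2 * bracket (-2) k * ‖m k‖) :=
          mul_le_mul_of_nonneg_left h1 (bracket_pos _ _).le
      _ = _ := by linear_combination 2 * ‖m k‖ * h2
  obtain ⟨hv1, hv0, hvd⟩ := summable_of_bracket_two hv
  have sA := (norm_momentumRHS_le (le_tsum_norm hm) hv1 k).1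
  have sB := (convSeq_bound hv0 (le_tsum_norm hvd) k).1
  have sC := (convSeq_bound hvd (le_tsum_norm hvd) k).1
  by_cases hk : k = 0
  · subst hk
    have h1 : convSeq (vel m) (dSeq (vel m)) 0 = 0 := by
      refine tsum_eq_zero_of_reflect 0 fun l => ?_
      simp only [dSeq, zero_sub, neg_neg]
      push_cast
      ring
    have h2 : momentumRHS m 0 = 0 := by
      rw [momentumRHS, neg_eq_zero]
      refine tsum_eq_zero_of_reflect 0 fun l => ?_
      simp only [zero_sub, neg_neg, ← symb_mul_vel m, symb_neg]
      push_cast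
      ring
    simp [velocityRHS, h1, h2]
  · have hs : (symb k : ℂ) ≠ 0 := by exact_mod_cast (symb_pos k).ne'
    rw [eq_div_iff hs]
    -- the zero mode of the symbol, which produces the term `2 μ(u) u`
    have hδ : Summable fun l : ℤ => if l = 0 then
        2 * Real.pi * Complex.I * (2 * k) * vel m k * vel m 0 else 0 :=
      summable_of_ne_finset_zero (s := {0}) fun l hl => if_neg (by simpa using hl)
    have hδs := tsum_ite_eq (0 : ℤ) fun _ => 2 * Real.pi * Complex.I * (2 * k) * vel m k * vel m 0
    have hsk : (symb k : ℂ) = (2 * Real.pi * k) ^ 2 := by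
      rw [symb_of_ne hk]; push_cast; ring
    have key : ∑' l, (2 * Real.pi * Complex.I * (2 * k - l) * vel m (k - l) * m l
        - (if l = 0 then 2 * Real.pi * Complex.I * (2 * k) * vel m k * vel m 0 else 0)
        - (symb k : ℂ) * (vel m (k - l) * dSeq (vel m) l)
        - Real.pi * Complex.I * k * (dSeq (vel m) (k - l) * dSeq (vel m) l)) = 0 := by
      have h1 : ∀ l : ℤ, (2 * Real.pi * Complex.I * (2 * k - l) * vel m (k - l) * m l
          - (if l = 0 then 2 * Real.pi * Complex.I * (2 * k) * vel m k * vel m 0 else 0)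
          - (symb k : ℂ) * (vel m (k - l) * dSeq (vel m) l)
          - Real.pi * Complex.I * k * (dSeq (vel m) (k - l) * dSeq (vel m) l)) =
          2 * Real.pi * Complex.I * (2 * Real.pi) ^ 2 * ((2 * k - l) * l ^ 2 - k ^ 2 * l
            + 1 / 2 * k * (k - l) * l) * (vel m (k - l) * vel m l) := by
        intro l
        have e : (Complex.I) ^ 2 = -1 := Complex.I_sq
        rw [hsk]
        by_cases hl : l = 0
        · subst hl
          rw [← symb_mul_vel m 0, symb_zero]
          simp [dSeq]
        · rw [if_neg hl, ← symb_mul_vel m l, symb_of_ne hl]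
          simp only [dSeq]
          push_cast
          linear_combination (-4 * Real.pi ^ 3 * Complex.I * k * (k - l) * l *
            vel m (k - l) * vel m l) * e
      simp_rw [h1]
      refine tsum_eq_zero_of_reflect k fun l => ?_
      rw [sub_sub_cancel]
      push_cast
      ring
    rw [((sA.sub hδ).sub (sB.mul_left _)).tsum_sub (sC.mul_left _),
      (sA.sub hδ).tsum_sub (sB.mul_left _), sA.tsum_sub hδ, hδs, tsum_mul_left, tsum_mul_left]
      at key
    have hc1 : convSeq (vel m) (dSeq (vel m)) k = ∑' l, vel m (k - l) * dSeq (vel m) l := rfl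
    have hc2 : convSeq (dSeq (vel m)) (dSeq (vel m)) k =
      ∑' l, dSeq (vel m) (k - l) * dSeq (vel m) l := rfl
    rw [momentumRHS, velocityRHS, sub_mul, mul_right_comm _ _ (symb k : ℂ), div_mul_cancel₀ _ hs,
      hc1, hc2]
    linear_combination key

/-- A family of Fourier coefficients of real functions that solves the equation
`u_t + u u_x + A⁻¹ ∂ₓ (2 μ(u) u + ½ u_x²) = 0`, coefficient by coefficient for `|t| < T`. -/
structure IsVelocitySolution (T : ℝ) (v : ℝ → ℤ → ℂ) : Prop where
  conj_symm : ∀ t ∈ Set.Ioo (-T) T, ∀ k, v t (-k) = conj (v t k)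
  hasDerivAt : ∀ t ∈ Set.Ioo (-T) T, ∀ k, HasDerivAt (fun τ => v τ k) (velocityRHS (v t) k) t

theorem norm_two_pi_div_symb_le (k : ℤ) : ‖(2 * Real.pi * Complex.I * k / symb k : ℂ)‖ ≤ 1 ∧
    ‖(2 * Real.pi * Complex.I * k / symb k : ℂ)‖ * |(k : ℝ)| ≤ 1 := by
  have h0 : ‖(2 * Real.pi * Complex.I * k / symb k : ℂ)‖ = 2 * Real.pi * |(k : ℝ)| / symb k := by
    simp [abs_of_pos Real.pi_pos, abs_of_pos (symb_pos k)]
  rw [h0, div_mul_eq_mul_div, div_le_one (symb_pos k), div_le_one (symb_pos k)]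
  by_cases hk : k = 0
  · subst hk; simp [symb_zero]
  · rw [symb_of_ne hk, mul_pow, ← sq_abs (k : ℝ)]
    have h3 : (1 : ℝ) ≤ |(k : ℝ)| := by exact_mod_cast Int.one_le_abs hk
    have h4 : 2 * Real.pi ≤ (2 * Real.pi) ^ 2 := by nlinarith [Real.pi_gt_three]
    have h5 : |(k : ℝ)| ≤ |(k : ℝ)| ^ 2 := by nlinarith
    constructor
    · gcongr
    · rw [mul_assoc, ← sq]; gcongr

theorem norm_velocityRHS_le {v : ℤ → ℂ} {S : ℝ} (hv : Summable fun k => bracket 2 k * ‖v k‖)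
    (hS : ∑' k, bracket 2 k * ‖v k‖ ≤ S) (k : ℤ) :
    ‖velocityRHS v k‖ ≤ (2 * Real.pi + 2 + 2 * Real.pi ^ 2) * S ^ 2 := by
  obtain ⟨hv1, hv0, hvd⟩ := summable_of_bracket_two hv
  have h1 : ∑' k, ‖v k‖ ≤ S := (hv0.tsum_le_tsum (fun k =>
    le_mul_of_one_le_left (norm_nonneg _) (one_le_bracket zero_le_two k)) hv).trans hS
  have h2 : ∑' k, ‖dSeq v k‖ ≤ 2 * Real.pi * S := by
    refine (hvd.tsum_le_tsum (norm_dSeq_le v) (hv.mul_left _)).trans ?_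
    rw [tsum_mul_left]
    gcongr
  have h3 := fun k => (le_tsum_norm hv0 k).trans h1
  have h4 := fun k => (le_tsum_norm hvd k).trans h2
  have hS0 : 0 ≤ S := (norm_nonneg _).trans (h3 0)
  have h5 : ‖convSeq v (dSeq v) k‖ ≤ S * (2 * Real.pi * S) :=
    (convSeq_bound hv0 h4 k).2.trans (by gcongr)
  have h6 : ‖convSeq (dSeq v) (dSeq v) k‖ ≤ (2 * Real.pi * S) * (2 * Real.pi * S) :=
    (convSeq_bound hvd h4 k).2.trans (by gcongr)
  have h7 : ‖2 * v 0 * v k + 1 / 2 * convSeq (dSeq v) (dSeq v) k‖ ≤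
      2 * S * S + 1 / 2 * ((2 * Real.pi * S) * (2 * Real.pi * S)) := by
    refine (norm_add_le _ _).trans (add_le_add ?_ ?_)
    · rw [norm_mul, norm_mul, Complex.norm_ofNat]
      gcongr
      · exact h3 0
      · exact h3 k
    · rw [norm_mul]
      have : ‖(1 / 2 : ℂ)‖ = 1 / 2 := by norm_num
      rw [this]
      gcongr
  rw [velocityRHS]
  refine (norm_sub_le _ _).trans ?_
  rw [norm_neg, norm_mul]
  have h8 := (norm_two_pi_div_symb_le k).1
  have h9 := mul_le_mul h8 h7 (norm_nonneg _) zero_le_one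
  linarith

/-- `u u_x = ½ (u²)_x` on the Fourier side. -/
theorem convSeq_dSeq_self {v : ℤ → ℂ} (hv : Summable fun k => bracket 2 k * ‖v k‖) (k : ℤ) :
    convSeq v (dSeq v) k = Real.pi * Complex.I * k * convSeq v v k := by
  obtain ⟨hv1, hv0, hvd⟩ := summable_of_bracket_two hv
  have sB := (convSeq_bound hv0 (le_tsum_norm hvd) k).1
  have sA := (convSeq_bound hv0 (le_tsum_norm hv0) k).1
  rw [← sub_eq_zero, convSeq, convSeq, ← tsum_mul_left, ← sB.tsum_sub (sA.mul_left _)]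
  refine tsum_eq_zero_of_reflect k fun l => ?_
  simp only [dSeq, sub_sub_cancel]
  push_cast
  ring

theorem convSeq_self_sub {v w : ℤ → ℂ} (hv : Summable fun k => ‖v k‖)
    (hw : Summable fun k => ‖w k‖) (k : ℤ) :
    convSeq v v k - convSeq w w k = convSeq (v + w) (v - w) k := by
  have h1 : convSeq (v + w) (v - w) k =
      convSeq v v k - convSeq v w k + (convSeq w v k - convSeq w w k) := by
    have s1 := (convSeq_bound hv (le_tsum_norm hv) k).1
    have s2 := (convSeq_bound hv (le_tsum_norm hw) k).1
    have s3 := (convSeq_bound hw (le_tsum_norm hv) k).1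
    have s4 := (convSeq_bound hw (le_tsum_norm hw) k).1
    unfold convSeq
    rw [← s1.tsum_sub s2, ← s3.tsum_sub s4, ← (s1.sub s2).tsum_add (s3.sub s4)]
    refine tsum_congr fun l => ?_
    simp only [Pi.add_apply, Pi.sub_apply]
    ring
  rw [h1, convSeq_comm w v]
  ring

theorem dSeq_add (v w : ℤ → ℂ) : dSeq (v + w) = dSeq v + dSeq w := by
  ext k; simp only [dSeq, Pi.add_apply]; ring

theorem dSeq_sub (v w : ℤ → ℂ) : dSeq (v - w) = dSeq v - dSeq w := by
  ext k; simp only [dSeq, Pi.sub_apply]; ring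

/-! ### Uniqueness -/

/-- The `L²` energy estimate for the difference of two solutions. -/
theorem abs_tsum_diff_flux_le {v w : ℤ → ℂ} {S : ℝ}
    (hvc : ∀ k, v (-k) = conj (v k)) (hwc : ∀ k, w (-k) = conj (w k))
    (hv : Summable fun k => bracket 2 k * ‖v k‖) (hw : Summable fun k => bracket 2 k * ‖w k‖)
    (hvS : ∑' k, bracket 2 k * ‖v k‖ ≤ S) (hwS : ∑' k, bracket 2 k * ‖w k‖ ≤ S) :
    |∑' k, 2 * (conj (v k - w k) * (velocityRHS v k - velocityRHS w k)).re| ≤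
      (6 * Real.pi + 16 * Real.pi ^ 2 + 8) * S * ∑' k, ‖v k - w k‖ ^ 2 := by
  obtain ⟨hv1, hv0, hvd⟩ := summable_of_bracket_two hv
  obtain ⟨hw1, hw0, hwd⟩ := summable_of_bracket_two hw
  set p := v + w with hp
  set d := v - w with hd
  have hbp : Summable fun k => bracket 2 k * ‖p k‖ := by
    refine Summable.of_nonneg_of_le (fun k => mul_nonneg (bracket_pos _ _).le (norm_nonneg _))
      (fun k => ?_) (hv.add hw)
    rw [← mul_add]
    exact mul_le_mul_of_nonneg_left (norm_add_le _ _) (bracket_pos _ _).le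
  have hbd : Summable fun k => bracket 2 k * ‖d k‖ := by
    refine Summable.of_nonneg_of_le (fun k => mul_nonneg (bracket_pos _ _).le (norm_nonneg _))
      (fun k => ?_) (hv.add hw)
    rw [← mul_add]
    exact mul_le_mul_of_nonneg_left (norm_sub_le _ _) (bracket_pos _ _).le
  have hP : ∑' k, bracket 2 k * ‖p k‖ ≤ 2 * S := by
    refine (hbp.tsum_le_tsum (fun k => ?_) (hv.add hw)).trans ?_
    · rw [← mul_add]
      exact mul_le_mul_of_nonneg_left (norm_add_le _ _) (bracket_pos _ _).le
    · rw [hv.tsum_add hw]; linarith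
  set P := ∑' k, bracket 2 k * ‖p k‖ with hPdef
  obtain ⟨hp1, hp0, hpd⟩ := summable_of_bracket_two hbp
  obtain ⟨hd1, hd0, hdd⟩ := summable_of_bracket_two hbd
  have hpc : ∀ k, p (-k) = conj (p k) := fun k => by simp [hp, hvc, hwc]
  have hb2p0 : ∀ k, 0 ≤ bracket 2 k * ‖p k‖ := fun k =>
    mul_nonneg (bracket_pos _ _).le (norm_nonneg _)
  have hP0 : 0 ≤ P := tsum_nonneg hb2p0
  have hP1 : ∑' k, bracket 1 k * ‖p k‖ ≤ P := hp1.tsum_le_tsum (fun k =>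
    mul_le_mul_of_nonneg_right (bracket_mono one_le_two k) (norm_nonneg _)) hbp
  have hp_le : ∀ k, ‖p k‖ ≤ bracket 2 k * ‖p k‖ := fun k =>
    le_mul_of_one_le_left (norm_nonneg _) (one_le_bracket zero_le_two k)
  have hPn : ∑' k, ‖p k‖ ≤ P := hp0.tsum_le_tsum hp_le hbp
  have sqs : ∀ x : ℤ → ℝ, (∀ k, 0 ≤ x k) → Summable x → Summable fun k => x k ^ 2 := by
    intro x hx hxs
    refine Summable.of_nonneg_of_le (fun k => sq_nonneg _) (fun k => ?_)
      (hxs.mul_left (∑' j, x j))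
    rw [sq]
    exact mul_le_mul_of_nonneg_right (hxs.le_tsum k fun j _ => hx j) (hx k)
  have hdsq := sqs _ (fun k => norm_nonneg (d k)) hd0
  have hd1sq := sqs _ (fun k => mul_nonneg (bracket_pos 1 k).le (norm_nonneg (d k))) hd1
  set E := ∑' k, ‖d k‖ ^ 2 with hEdef
  have hE0 : 0 ≤ E := tsum_nonneg fun k => sq_nonneg _
  have hdE : ∀ k l, ‖d k‖ * ‖d l‖ ≤ E := by
    intro k l
    have h1 := hdsq.le_tsum k fun j _ => sq_nonneg _
    have h2 := hdsq.le_tsum l fun j _ => sq_nonneg _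
    nlinarith [sq_nonneg (‖d k‖ - ‖d l‖)]
  -- the difference of the right-hand sides
  have hdiff : ∀ k, velocityRHS v k - velocityRHS w k =
      -(Real.pi * Complex.I * k * convSeq p d k) - 2 * Real.pi * Complex.I * k / symb k *
        (p 0 * d k + d 0 * p k + 1 / 2 * convSeq (dSeq p) (dSeq d) k) := by
    intro k
    have h1 := convSeq_self_sub hv0 hw0 k
    have h2 := convSeq_self_sub hvd hwd k
    rw [← dSeq_add, ← dSeq_sub] at h2
    rw [velocityRHS, velocityRHS, convSeq_dSeq_self hv, convSeq_dSeq_self hw, ← h1, ← h2]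
    simp only [hp, hd, Pi.add_apply, Pi.sub_apply]
    ring
  -- the transport term
  obtain ⟨hXs, hXb⟩ := abs_re_tsum_transport_le hpc hd1sq hp1
  set X : ℤ × ℤ → ℂ := fun q => conj (d q.1) * (Complex.I * q.2) * p (q.1 - q.2) * d q.2
  -- the terms of order zero
  set Y : ℤ × ℤ → ℂ := fun q => conj (d q.1) * (Real.pi * Complex.I * ((q.1 - q.2 : ℤ) : ℂ)
    + 2 * Real.pi * Complex.I * q.1 / symb q.1 * (1 / 2 * (2 * Real.pi * Complex.I *
      ((q.1 - q.2 : ℤ) : ℂ)) * (2 * Real.pi * Complex.I * q.2))) * p (q.1 - q.2) * d q.2 with hY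
  have hYb : ∀ q, ‖Y q‖ ≤ (Real.pi + 4 * Real.pi ^ 2) *
      (‖d q.1‖ * (bracket 2 (q.1 - q.2) * ‖p (q.1 - q.2)‖) * ‖d q.2‖) := by
    intro q
    have hj := abs_le_bracket_one (q.1 - q.2)
    have hj2 : |((q.1 - q.2 : ℤ) : ℝ)| ≤ bracket 2 (q.1 - q.2) :=
      hj.trans (bracket_mono one_le_two _)
    have hj3 : |((q.1 - q.2 : ℤ) : ℝ)| * |((q.1 - q.2 : ℤ) : ℝ)| ≤ bracket 2 (q.1 - q.2) := by
      rw [show (2 : ℝ) = 2 * 1 by norm_num, bracket_two_mul, sq]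
      exact mul_le_mul hj hj (abs_nonneg _) (bracket_pos _ _).le
    have hl : |(q.2 : ℝ)| ≤ |(q.1 : ℝ)| + |((q.1 - q.2 : ℤ) : ℝ)| := by
      have h1 : (q.2 : ℝ) = q.1 - ((q.1 - q.2 : ℤ) : ℝ) := by push_cast; ring
      rw [h1]
      exact abs_sub _ _
    obtain ⟨hs1, hs2⟩ := norm_two_pi_div_symb_le q.1
    have hcoef : ‖(Real.pi * Complex.I * ((q.1 - q.2 : ℤ) : ℂ)
        + 2 * Real.pi * Complex.I * q.1 / symb q.1 * (1 / 2 * (2 * Real.pi * Complex.I *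
      ((q.1 - q.2 : ℤ) : ℂ)) * (2 * Real.pi * Complex.I * q.2)) : ℂ)‖ ≤
        (Real.pi + 4 * Real.pi ^ 2) * bracket 2 (q.1 - q.2) := by
      refine (norm_add_le _ _).trans ?_
      have n1 : ‖(Real.pi * Complex.I * ((q.1 - q.2 : ℤ) : ℂ) : ℂ)‖ =
          Real.pi * |((q.1 - q.2 : ℤ) : ℝ)| := by
        rw [norm_mul, norm_mul, Complex.norm_I, Complex.norm_intCast, Complex.norm_real,
          Real.norm_eq_abs, abs_of_pos Real.pi_pos, mul_one]
      have n2 : ‖(1 / 2 * (2 * Real.pi * Complex.I *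
          ((q.1 - q.2 : ℤ) : ℂ)) * (2 * Real.pi * Complex.I * q.2) : ℂ)‖ =
          2 * Real.pi ^ 2 * |((q.1 - q.2 : ℤ) : ℝ)| * |(q.2 : ℝ)| := by
        simp only [norm_mul, Complex.norm_I, Complex.norm_intCast, Complex.norm_real,
          Real.norm_eq_abs, abs_of_pos Real.pi_pos, Complex.norm_ofNat, norm_div, norm_one]
        ring
      rw [n1, norm_mul, n2]
      set s := ‖(2 * Real.pi * Complex.I * q.1 / symb q.1 : ℂ)‖
      set j := |((q.1 - q.2 : ℤ) : ℝ)|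
      have hs0 : 0 ≤ s := norm_nonneg _
      have hj0 : 0 ≤ j := abs_nonneg _
      have h3 : s * |(q.2 : ℝ)| ≤ 1 + j := by nlinarith
      have h4 : s * (2 * Real.pi ^ 2 * j * |(q.2 : ℝ)|) ≤ 2 * Real.pi ^ 2 * (j * (1 + j)) := by
        calc _ = 2 * Real.pi ^ 2 * (j * (s * |(q.2 : ℝ)|)) := by ring
          _ ≤ _ := by gcongr
      have h5 : j * (1 + j) ≤ 2 * bracket 2 (q.1 - q.2) := by linarith
      have h6 : 2 * Real.pi ^ 2 * (j * (1 + j)) ≤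
          2 * Real.pi ^ 2 * (2 * bracket 2 (q.1 - q.2)) := by gcongr
      have h7 : Real.pi * j ≤ Real.pi * bracket 2 (q.1 - q.2) := by
        have := Real.pi_pos; gcongr
      linarith
    simp only [hY]
    rw [norm_mul, norm_mul, norm_mul, RCLike.norm_conj]
    calc _ ≤ ‖d q.1‖ * ((Real.pi + 4 * Real.pi ^ 2) * bracket 2 (q.1 - q.2)) *
          ‖p (q.1 - q.2)‖ * ‖d q.2‖ := by gcongr
      _ = _ := by ring
  obtain ⟨hy, hyb⟩ := young_trilinear (a := fun k => ‖d k‖) (fun k => norm_nonneg _) hb2p0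
    (fun k => norm_nonneg (d k)) hdsq hbp hdsq
  have hYs : Summable Y := Summable.of_norm_bounded (hy.mul_left _) hYb
  have hYn : ‖∑' q, Y q‖ ≤ (Real.pi + 4 * Real.pi ^ 2) * (P * (E + E) / 2) := by
    refine (tsum_of_norm_bounded (hy.mul_left _).hasSum hYb).trans ?_
    rw [tsum_mul_left]
    gcongr
  -- the terms with the mean
  set Z : ℤ → ℂ := fun k => conj (d k) * (2 * Real.pi * Complex.I * k / symb k *
    (p 0 * d k + d 0 * p k)) with hZ
  have hZb : ∀ k, ‖Z k‖ ≤ P * ‖d k‖ ^ 2 + E * ‖p k‖ := by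
    intro k
    have h1 := (norm_two_pi_div_symb_le k).1
    have h2 : ‖p 0‖ ≤ P := (le_tsum_norm hp0 0).trans hPn
    simp only [hZ]
    rw [norm_mul, norm_mul, RCLike.norm_conj]
    have h3 : ‖p 0 * d k + d 0 * p k‖ ≤ P * ‖d k‖ + ‖d 0‖ * ‖p k‖ := by
      refine (norm_add_le _ _).trans ?_
      rw [norm_mul, norm_mul]
      gcongr
    calc _ ≤ ‖d k‖ * (1 * (P * ‖d k‖ + ‖d 0‖ * ‖p k‖)) := by gcongr
      _ = P * ‖d k‖ ^ 2 + (‖d k‖ * ‖d 0‖) * ‖p k‖ := by ring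
      _ ≤ _ := by gcongr; exact hdE k 0
  have hZmaj := (hdsq.mul_left P).add (hp0.mul_left E)
  have hZs : Summable Z := Summable.of_norm_bounded hZmaj hZb
  have hZn : ‖∑' k, Z k‖ ≤ P * E + E * P := by
    refine (tsum_of_norm_bounded hZmaj.hasSum hZb).trans ?_
    rw [(hdsq.mul_left P).tsum_add (hp0.mul_left E), tsum_mul_left, tsum_mul_left]
    gcongr
  have hXYs : Summable fun q => Real.pi * X q + Y q := (hXs.mul_left _).add hYs
  have hpt : ∀ k, conj (d k) * (velocityRHS v k - velocityRHS w k) =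
      -(∑' l, (Real.pi * X (k, l) + Y (k, l))) - Z k := by
    intro k
    have s1 := (convSeq_bound hp0 (le_tsum_norm hd0) k).1
    have s2 := (convSeq_bound hpd (le_tsum_norm hdd) k).1
    rw [hdiff]
    have h1 : ∑' l, (Real.pi * X (k, l) + Y (k, l)) = conj (d k) * (Real.pi * Complex.I * k *
        convSeq p d k) + conj (d k) * (2 * Real.pi * Complex.I * k / symb k) * (1 / 2) *
          convSeq (dSeq p) (dSeq d) k := by
      unfold convSeq
      rw [← tsum_mul_left, ← tsum_mul_left, ← tsum_mul_left,
        ← ((s1.mul_left _).mul_left _).tsum_add (s2.mul_left _)]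
      refine tsum_congr fun l => ?_
      simp only [X, hY, dSeq]
      push_cast
      ring
    rw [h1]
    simp only [hZ]
    ring
  have hsumall : Summable fun k => conj (d k) * (velocityRHS v k - velocityRHS w k) := by
    refine (hXYs.prod.neg.sub hZs).congr fun k => ?_
    rw [hpt]
  have htot : ∑' k, conj (d k) * (velocityRHS v k - velocityRHS w k) =
      -(Real.pi * (∑' q, X q) + ∑' q, Y q) - ∑' k, Z k := by
    simp_rw [hpt]
    rw [hXYs.prod.neg.tsum_sub hZs, tsum_neg, ← hXYs.tsum_prod,
      (hXs.mul_left _).tsum_add hYs, tsum_mul_left]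
  have hre : ∑' k, 2 * (conj (v k - w k) * (velocityRHS v k - velocityRHS w k)).re =
      2 * (-(Real.pi * (∑' q, X q).re + (∑' q, Y q).re) - (∑' k, Z k).re) := by
    rw [tsum_mul_left]
    congr 1
    have h1 := congrArg Complex.re htot
    rw [Complex.re_tsum hsumall] at h1
    simpa [hd] using h1
  rw [hre, abs_mul, abs_two]
  have hYre := (Complex.abs_re_le_norm (∑' q, Y q)).trans hYn
  have hZre := (Complex.abs_re_le_norm (∑' k, Z k)).trans hZn
  have hXre : |(∑' q, X q).re| ≤ P * E / 2 := hXb.trans (by gcongr)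
  have hfin : |(-(Real.pi * (∑' q, X q).re + (∑' q, Y q).re) - (∑' k, Z k).re)| ≤
      Real.pi * (P * E / 2) + (Real.pi + 4 * Real.pi ^ 2) * (P * (E + E) / 2) +
        (P * E + E * P) := by
    refine (abs_sub _ _).trans (add_le_add ?_ hZre)
    rw [abs_neg]
    refine (abs_add_le _ _).trans (add_le_add ?_ hYre)
    rw [abs_mul, abs_of_pos Real.pi_pos]
    have := Real.pi_pos
    gcongr
  have hEeq : ∑' k, ‖v k - w k‖ ^ 2 = E := rfl
  rw [hEeq]
  have hPS : P * E ≤ 2 * S * E := mul_le_mul_of_nonneg_right hP hE0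
  calc _ ≤ 2 * (Real.pi * (P * E / 2) + (Real.pi + 4 * Real.pi ^ 2) * (P * (E + E) / 2) +
        (P * E + E * P)) := by gcongr
    _ = (3 * Real.pi + 8 * Real.pi ^ 2 + 4) * (P * E) := by ring
    _ ≤ (3 * Real.pi + 8 * Real.pi ^ 2 + 4) * (2 * S * E) := by gcongr
    _ = _ := by ring

theorem IsVelocitySolution.unique {T S : ℝ} {v w : ℝ → ℤ → ℂ} (hT : 0 < T)
    (hv : IsVelocitySolution T v) (hw : IsVelocitySolution T w) (h0 : v 0 = w 0)
    (hvS : ∀ t ∈ Set.Ioo (-T) T, (Summable fun k => bracket 2 k * ‖v t k‖) ∧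
      ∑' k, bracket 2 k * ‖v t k‖ ≤ S)
    (hwS : ∀ t ∈ Set.Ioo (-T) T, (Summable fun k => bracket 2 k * ‖w t k‖) ∧
      ∑' k, bracket 2 k * ‖w t k‖ ≤ S) {t : ℝ} (ht : t ∈ Set.Ioo (-T) T) :
    v t = w t := by
  set C := (2 * Real.pi + 2 + 2 * Real.pi ^ 2) * S ^ 2 with hC
  have h0T : (0 : ℝ) ∈ Set.Ioo (-T) T := ⟨by linarith, hT⟩
  have hS0 : 0 ≤ S := le_trans (tsum_nonneg fun k =>
    mul_nonneg (bracket_pos _ _).le (norm_nonneg _)) (hvS 0 h0T).2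
  have hle : ∀ u : ℝ → ℤ → ℂ, (∀ t ∈ Set.Ioo (-T) T, (Summable fun k => bracket 2 k * ‖u t k‖) ∧
      ∑' k, bracket 2 k * ‖u t k‖ ≤ S) → ∀ τ ∈ Set.Ioo (-T) T, ∀ k,
      ‖u τ k‖ ≤ S * bracket (-2) k := by
    intro u hu τ hτ k
    have h1 := ((hu τ hτ).1.le_tsum k fun j _ =>
      mul_nonneg (bracket_pos 2 j).le (norm_nonneg _)).trans (hu τ hτ).2
    have h2 := bracket_neg_exp_mul 2 k
    have h3 := bracket_pos (-2) k
    calc ‖u τ k‖ = (bracket 2 k * ‖u τ k‖) * bracket (-2) k := by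
          linear_combination -(‖u τ k‖) * h2
      _ ≤ _ := by gcongr
  have hdle : ∀ τ ∈ Set.Ioo (-T) T, ∀ k, ‖v τ k - w τ k‖ ≤ 2 * S * bracket (-2) k := by
    intro τ hτ k
    refine (norm_sub_le _ _).trans ?_
    linarith [hle v hvS τ hτ k, hle w hwS τ hτ k]
  have hdsum : ∀ τ ∈ Set.Ioo (-T) T, Summable fun k => ‖v τ k - w τ k‖ ^ 2 := by
    intro τ hτ
    refine Summable.of_nonneg_of_le (fun k => sq_nonneg _) (fun k => ?_)
      ((summable_bracket (s := -4) (by norm_num)).mul_left ((2 * S) ^ 2))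
    have h1 := pow_le_pow_left₀ (norm_nonneg _) (hdle τ hτ k) 2
    refine h1.trans (le_of_eq ?_)
    rw [mul_pow, ← bracket_two_mul]; norm_num
  have hd : ∀ τ ∈ Set.Ioo (-T) T, HasDerivAt (fun τ => ∑' k, ‖v τ k - w τ k‖ ^ 2)
      (∑' k, 2 * (conj (v τ k - w τ k) * (velocityRHS (v τ) k - velocityRHS (w τ) k)).re) τ := by
    intro τ hτ
    refine hasDerivAt_tsum_of_isPreconnected (𝕜 := ℝ) (F := ℝ) (y₀ := τ)
      (g := fun k τ => ‖v τ k - w τ k‖ ^ 2)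
      (g' := fun k τ => 2 * (conj (v τ k - w τ k) *
        (velocityRHS (v τ) k - velocityRHS (w τ) k)).re)
      (u := fun k => (8 * S * C) * bracket (-2) k)
      ((summable_bracket (by norm_num)).mul_left _) isOpen_Ioo isPreconnected_Ioo
      (fun k x hx => hasDerivAt_norm_sq ((hv.hasDerivAt x hx k).sub (hw.hasDerivAt x hx k)))
      (fun k x hx => ?_) hτ (hdsum τ hτ) hτ
    rw [Real.norm_eq_abs, abs_mul, abs_two]
    have h1 : ‖velocityRHS (v x) k - velocityRHS (w x) k‖ ≤ 2 * C := by
      refine (norm_sub_le _ _).trans ?_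
      linarith [norm_velocityRHS_le (hvS x hx).1 (hvS x hx).2 k,
        norm_velocityRHS_le (hwS x hx).1 (hwS x hx).2 k]
    have h2 := Complex.abs_re_le_norm
      (conj (v x k - w x k) * (velocityRHS (v x) k - velocityRHS (w x) k))
    rw [norm_mul, RCLike.norm_conj] at h2
    have h3 := bracket_pos (-2) k
    calc _ ≤ 2 * ((2 * S * bracket (-2) k) * (2 * C)) := by
          gcongr
          exact h2.trans (mul_le_mul (hdle x hx k) h1 (norm_nonneg _) (by positivity))
      _ = _ := by ring
  have h1 := abs_le_mul_exp_of_abs_deriv_le hd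
    (C := (6 * Real.pi + 16 * Real.pi ^ 2 + 8) * S) (fun τ hτ => by
      rw [abs_of_nonneg (tsum_nonneg fun k => sq_nonneg ‖v τ k - w τ k‖)]
      exact abs_tsum_diff_flux_le (hv.conj_symm τ hτ) (hw.conj_symm τ hτ)
        (hvS τ hτ).1 (hwS τ hτ).1 (hvS τ hτ).2 (hwS τ hτ).2) ht
  have h2 : ∑' k, ‖v 0 k - w 0 k‖ ^ 2 = 0 := by simp [h0]
  rw [h2, abs_zero, zero_mul, abs_of_nonneg (tsum_nonneg fun k => sq_nonneg _)] at h1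
  ext k
  have h3 := ((hdsum t ht).le_tsum k fun j _ => sq_nonneg _).trans h1
  have h4 : ‖v t k - w t k‖ = 0 := by
    have := le_antisymm h3 (sq_nonneg _)
    exact pow_eq_zero_iff two_ne_zero |>.1 this
  exact sub_eq_zero.1 (norm_eq_zero.1 h4)

/-! ### Products of functions on the circle -/

/-- An `L²` function with absolutely summable Fourier coefficients is the sum of its Fourier
series, which is continuous. -/
theorem exists_continuous_of_summable_coef {f : L2Circle} (hf : Summable fun k => ‖coef f k‖) :
    ∃ F : C(UnitAddCircle, ℂ), (∀ x, HasSum (fun k => coef f k * fourier k x) (F x)) ∧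
      ∀ᵐ x ∂haarAddCircle, ((f x : ℝ) : ℂ) = F x := by
  have h1 : Summable fun k => coef f k • (fourier k : C(UnitAddCircle, ℂ)) := by
    refine Summable.of_norm ?_
    simpa only [norm_smul, fourier_norm, mul_one] using hf
  refine ⟨∑' k, coef f k • (fourier k : C(UnitAddCircle, ℂ)), fun x => ?_, ?_⟩
  · have h2 := (ContinuousMap.evalCLM ℂ x).hasSum h1.hasSum
    simpa [Function.comp_def] using h2
  · have h2 := (ContinuousMap.toLp (E := ℂ) 2 (haarAddCircle : Measure UnitAddCircle) ℂ).hasSum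
      h1.hasSum
    have h3 : HasSum (fun k => coef f k • fourierLp 2 k) (cplx f) := by
      have h4 := hasSum_fourier_series_L2 (cplx f)
      simpa only [← fourierBasis_repr, ← coef_eq_repr] using h4
    have h5 : ContinuousMap.toLp (E := ℂ) 2 (haarAddCircle : Measure UnitAddCircle) ℂ
        (∑' k, coef f k • (fourier k : C(UnitAddCircle, ℂ))) = cplx f := by
      refine h2.unique ?_
      refine h3.congr_fun fun k => ?_
      simp
    have h6 := ContinuousMap.coeFn_toLp (𝕜 := ℂ) (p := 2) (haarAddCircle : Measure UnitAddCircle)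
      (∑' k, coef f k • (fourier k : C(UnitAddCircle, ℂ)))
    rw [h5] at h6
    filter_upwards [h6, cplx_ae f] with x hx hy
    rw [← hy, hx]

/-- The Fourier coefficients of a product are the convolution of the Fourier coefficients. -/
theorem exists_mul_coef {f g : L2Circle} (hf : Summable fun k => ‖coef f k‖) :
    ∃ p : L2Circle, (∀ᵐ x ∂haarAddCircle, p x = f x * g x) ∧
      ∀ k, coef p k = convSeq (coef f) (coef g) k := by
  obtain ⟨F, hF, hfF⟩ := exists_continuous_of_summable_coef hf
  have hfb : ∀ᵐ x ∂haarAddCircle, ‖f x‖ ≤ ‖F‖ := by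
    filter_upwards [hfF] with x hx
    have := F.norm_coe_le_norm x
    rwa [← hx, Complex.norm_real] at this
  have hfm : MemLp f ∞ haarAddCircle := MemLp.of_bound (Lp.aestronglyMeasurable f) ‖F‖ hfb
  have hm : MemLp (fun x => f x * g x) 2 haarAddCircle := (Lp.memLp g).mul' hfm
  refine ⟨hm.toLp, MemLp.coeFn_toLp hm, fun k => ?_⟩
  have h1 : coef hm.toLp k = ∫ x, fourier (-k) x * (F x * ((g x : ℝ) : ℂ)) ∂haarAddCircle := by
    rw [coef, fourierCoeff]
    refine integral_congr_ae ?_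
    filter_upwards [MemLp.coeFn_toLp hm, hfF] with x hx hy
    rw [hx, ← hy, smul_eq_mul]
    push_cast
    ring
  have hgi := coef_integrable g
  have hfn : ∀ (n : ℤ) (x : UnitAddCircle), ‖fourier n x‖ = 1 := fun n x => by
    rw [fourier_apply]; exact Circle.norm_coe _
  have h2 : HasSum (fun j => ∫ x, fourier (-k) x * (coef f j * fourier j x * ((g x : ℝ) : ℂ))
      ∂haarAddCircle) (∫ x, ∑' j, fourier (-k) x * (coef f j * fourier j x * ((g x : ℝ) : ℂ))
      ∂haarAddCircle) := by
    refine hasSum_integral_of_summable_integral_norm (fun j => ?_) ?_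
    · have h3 : Integrable (fun x => (fourier (-k) x * (coef f j * fourier j x)) *
          ((g x : ℝ) : ℂ)) (haarAddCircle : Measure UnitAddCircle) := by
        refine hgi.bdd_mul (c := ‖coef f j‖) (by fun_prop) (Filter.Eventually.of_forall fun x => ?_)
        rw [norm_mul, norm_mul, hfn, hfn, one_mul, mul_one]
      refine h3.congr (Filter.Eventually.of_forall fun x => ?_)
      simp only; ring
    · refine (hf.mul_right (∫ x, ‖((g x : ℝ) : ℂ)‖ ∂haarAddCircle)).congr fun j => ?_
      rw [← integral_const_mul]
      refine integral_congr_ae (Filter.Eventually.of_forall fun x => ?_)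
      simp only [norm_mul, hfn, one_mul, mul_one]
  have h3 : ∀ j, ∫ x, fourier (-k) x * (coef f j * fourier j x * ((g x : ℝ) : ℂ)) ∂haarAddCircle =
      coef g (k - j) * coef f j := by
    intro j
    have h4 : coef g (k - j) =
        ∫ x, fourier (-(k - j)) x • ((g x : ℝ) : ℂ) ∂haarAddCircle := rfl
    rw [mul_comm (coef g (k - j)), h4, ← integral_const_mul]
    refine integral_congr_ae (Filter.Eventually.of_forall fun x => ?_)
    simp only [smul_eq_mul]
    rw [show -(k - j) = -k + j by ring, fourier_add]
    ring
  rw [h1, convSeq_comm, convSeq]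
  simp_rw [← h3]
  rw [h2.tsum_eq]
  refine integral_congr_ae (Filter.Eventually.of_forall fun x => ?_)
  simp only
  rw [tsum_mul_left, tsum_mul_right, (hF x).tsum_eq]

/-! ### Sobolev spaces: norms, products and Fourier multipliers -/

namespace Sobolev

variable {s t : ℝ}

theorem norm_weighted_apply (f : Sobolev s) (k : ℤ) :
    ‖weighted f k‖ = bracket s k * ‖coef (toL2 f) k‖ := by
  have h3 : (weighted f) k = (bracket s k : ℂ) * coef (toL2 f) k := rfl
  rw [h3, norm_mul, Complex.norm_real, Real.norm_eq_abs, abs_of_pos (bracket_pos s k)]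

theorem summable_sq (f : Sobolev s) :
    Summable fun k => (bracket s k * ‖coef (toL2 f) k‖) ^ 2 := by
  have h := (memℓp_gen_iff (by norm_num)).1 (memlp f)
  refine h.congr fun k => ?_
  rw [norm_mul, Complex.norm_real, Real.norm_eq_abs, abs_of_pos (bracket_pos s k)]
  simp

theorem norm_sq_eq (f : Sobolev s) :
    ‖f‖ ^ 2 = ∑' k, (bracket s k * ‖coef (toL2 f) k‖) ^ 2 := by
  have h1 : ‖f‖ = ‖weighted f‖ := rfl
  have h2 := lp.norm_rpow_eq_tsum (p := 2) (by norm_num) (weighted f)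
  rw [h1]
  simp only [ENNReal.toReal_ofNat, Real.rpow_ofNat] at h2
  rw [h2]
  exact tsum_congr fun k => by rw [norm_weighted_apply]

theorem bracket_mul_norm_coef_le (f : Sobolev s) (k : ℤ) :
    bracket s k * ‖coef (toL2 f) k‖ ≤ ‖f‖ := by
  rw [← norm_weighted_apply]
  exact lp.norm_apply_le_norm (by norm_num) (weighted f) k

/-- The `k`-th Fourier coefficient, as a continuous functional on `H^s`. -/
noncomputable def coefL (s : ℝ) (k : ℤ) : Sobolev s →L[ℝ] ℂ :=
  LinearMap.mkContinuous
    { toFun := fun f => coef (toL2 f) k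
      map_add' := fun f g => by rw [map_add, coef_add]
      map_smul' := fun c f => by
        rw [map_smul, coef_smul, RingHom.id_apply, Complex.real_smul] }
    (bracket (-s) k) (fun f => by
      have h1 := bracket_mul_norm_coef_le f k
      have h2 := bracket_neg_exp_mul s k
      have h3 := bracket_pos (-s) k
      calc ‖coef (toL2 f) k‖ = bracket (-s) k * (bracket s k * ‖coef (toL2 f) k‖) := by
            rw [← mul_assoc, h2, one_mul]
        _ ≤ _ := by gcongr)

theorem coefL_apply (k : ℤ) (f : Sobolev s) : coefL s k f = coef (toL2 f) k := rfl

theorem norm_le_of_coef_le {f : Sobolev s} {g : Sobolev t} {C : ℝ} (hC : 0 ≤ C)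
    (h : ∀ k, bracket t k * ‖coef (toL2 g) k‖ ≤ C * (bracket s k * ‖coef (toL2 f) k‖)) :
    ‖g‖ ≤ C * ‖f‖ := by
  refine (sq_le_sq₀ (norm_nonneg _) (by positivity)).1 ?_
  rw [mul_pow, norm_sq_eq, norm_sq_eq, ← tsum_mul_left]
  refine (summable_sq g).tsum_le_tsum (fun k => ?_) ((summable_sq f).mul_left _)
  rw [← mul_pow]
  have := mul_nonneg (bracket_pos t k).le (norm_nonneg (coef (toL2 g) k))
  exact pow_le_pow_left₀ this (h k) 2

theorem continuous_incl (h : t ≤ s) : Continuous (incl h : Sobolev s →ₗ[ℝ] Sobolev t) := by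
  refine AddMonoidHomClass.continuous_of_bound _ 1 fun f => norm_le_of_coef_le zero_le_one ?_
  intro k
  rw [toL2_incl, one_mul]
  exact mul_le_mul_of_nonneg_right (bracket_mono h k) (norm_nonneg _)

theorem continuous_dx (hs : 1 ≤ s) : Continuous (dx hs : Sobolev s →ₗ[ℝ] Sobolev (s - 1)) := by
  refine AddMonoidHomClass.continuous_of_bound _ 1 fun f => norm_le_of_coef_le zero_le_one ?_
  intro k
  rw [coef_dx, one_mul, norm_mul, ← mul_assoc]
  refine mul_le_mul_of_nonneg_right ?_ (norm_nonneg _)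
  have h1 : ‖(2 * Real.pi * Complex.I * k : ℂ)‖ = |2 * Real.pi * k| := by simp [abs_mul]
  rw [h1]
  exact bracket_sub_one s k

theorem continuous_mean : Continuous (mean : Sobolev s → ℝ) := by
  have h1 : (mean : Sobolev s → ℝ) = fun f => (coefL s 0 f).re := by
    ext f
    rw [coefL_apply, coef_zero_eq_mean, Complex.ofReal_re]
  rw [h1]
  exact Complex.continuous_re.comp (coefL s 0).continuous

theorem summable_coef (hs : 1 / 2 < s) (f : Sobolev s) : Summable fun k => ‖coef (toL2 f) k‖ :=
  (summable_of_weighted hs (fun _ => norm_nonneg _) (summable_sq f)).1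

/-- `∑ ⟨k⟩² |û(k)|` is controlled by the `H^s` norm for `s > 5/2`. -/
theorem summable_bracket_two_coef (hs : 5 / 2 < s) (f : Sobolev s) :
    (Summable fun k => bracket 2 k * ‖coef (toL2 f) k‖) ∧
      ∑' k, bracket 2 k * ‖coef (toL2 f) k‖ ≤
        √(∑' k, bracket (-(2 * (s - 2))) k) * ‖f‖ := by
  have h1 : ∀ k, bracket (s - 2) k * (bracket 2 k * ‖coef (toL2 f) k‖) =
      bracket s k * ‖coef (toL2 f) k‖ := by
    intro k
    rw [← mul_assoc, ← bracket_add]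
    congr 2; ring
  obtain ⟨h2, h3⟩ := summable_of_weighted (s := s - 2) (by linarith)
    (a := fun k => bracket 2 k * ‖coef (toL2 f) k‖)
    (fun k => mul_nonneg (bracket_pos _ _).le (norm_nonneg _))
    (by simpa only [h1] using summable_sq f)
  refine ⟨h2, ?_⟩
  simp only [h1] at h3
  rw [← norm_sq_eq] at h3
  have h4 := Real.le_sqrt_of_sq_le h3
  rwa [Real.sqrt_mul (tsum_nonneg fun k => (bracket_pos _ _).le), Real.sqrt_sq (norm_nonneg _)]
    at h4

/-- `H^r`, `r > 1/2`, is an algebra: the estimate on the Fourier side. -/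
theorem convSeq_weighted_bound {r : ℝ} (hr : 1 / 2 < r) (f g : Sobolev r) :
    (Summable fun k => (bracket r k * ‖convSeq (coef (toL2 f)) (coef (toL2 g)) k‖) ^ 2) ∧
      ∑' k, (bracket r k * ‖convSeq (coef (toL2 f)) (coef (toL2 g)) k‖) ^ 2 ≤
        (2 * 2 ^ r) ^ 2 * (∑' k, bracket (-(2 * r)) k) * (‖f‖ ^ 2 * ‖g‖ ^ 2) := by
  set a := coef (toL2 f)
  set c := coef (toL2 g)
  have hr0 : 0 ≤ r := by linarith
  have ha0 : ∀ k, 0 ≤ bracket r k * ‖a k‖ := fun k =>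
    mul_nonneg (bracket_pos _ _).le (norm_nonneg _)
  have hc0 : ∀ k, 0 ≤ bracket r k * ‖c k‖ := fun k =>
    mul_nonneg (bracket_pos _ _).le (norm_nonneg _)
  obtain ⟨has, haS⟩ := summable_of_weighted hr (fun k => norm_nonneg (a k)) (summable_sq f)
  obtain ⟨hcs, hcS⟩ := summable_of_weighted hr (fun k => norm_nonneg (c k)) (summable_sq g)
  rw [← norm_sq_eq] at haS hcS
  obtain ⟨y1, y2, y3⟩ := young_sq (fun k => norm_nonneg (a k)) hc0 has (summable_sq g)
  obtain ⟨z1, z2, z3⟩ := young_sq (fun k => norm_nonneg (c k)) ha0 hcs (summable_sq f)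
  rw [← norm_sq_eq] at y3 z3
  set Y : ℤ → ℝ := fun k => ∑' l, ‖a (k - l)‖ * (bracket r l * ‖c l‖)
  set W : ℤ → ℝ := fun k => ∑' l, ‖c (k - l)‖ * (bracket r l * ‖a l‖)
  have key : ∀ k, bracket r k * ‖convSeq a c k‖ ≤ 2 ^ r * (W k + Y k) := by
    intro k
    have hw : HasSum (fun l => ‖c l‖ * (bracket r (k - l) * ‖a (k - l)‖)) (W k) := by
      have h1 := (Equiv.subLeft k).hasSum_iff.2 (z1 k).hasSum
      simpa [Function.comp_def] using h1
    have h1 : ∀ l, ‖(bracket r k : ℂ) * (a (k - l) * c l)‖ ≤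
        2 ^ r * (‖c l‖ * (bracket r (k - l) * ‖a (k - l)‖) +
          ‖a (k - l)‖ * (bracket r l * ‖c l‖)) := by
      intro l
      rw [norm_mul, norm_mul, Complex.norm_real, Real.norm_eq_abs, abs_of_pos (bracket_pos r k)]
      calc _ ≤ (2 ^ r * (bracket r (k - l) + bracket r l)) * (‖a (k - l)‖ * ‖c l‖) := by
            gcongr; exact bracket_le_add hr0 k l
        _ = _ := by ring
    have h2 := tsum_of_norm_bounded ((hw.add (y1 k).hasSum).mul_left (2 ^ r)) h1
    rwa [tsum_mul_left, norm_mul, Complex.norm_real, Real.norm_eq_abs,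
      abs_of_pos (bracket_pos r k)] at h2
  have hb0 : ∀ k, 0 ≤ bracket r k * ‖convSeq a c k‖ := fun k =>
    mul_nonneg (bracket_pos _ _).le (norm_nonneg _)
  have key2 : ∀ k, (bracket r k * ‖convSeq a c k‖) ^ 2 ≤
      (2 ^ r) ^ 2 * 2 * (W k ^ 2 + Y k ^ 2) := by
    intro k
    refine (pow_le_pow_left₀ (hb0 k) (key k) 2).trans ?_
    rw [mul_pow, mul_assoc]
    gcongr
    nlinarith [sq_nonneg (W k - Y k)]
  have hmaj := (z2.add y2).mul_left ((2 ^ r) ^ 2 * 2)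
  have hs := Summable.of_nonneg_of_le (fun k => sq_nonneg _) key2 hmaj
  refine ⟨hs, (hs.tsum_le_tsum key2 hmaj).trans ?_⟩
  rw [tsum_mul_left, z2.tsum_add y2]
  set Z := ∑' k, bracket (-(2 * r)) k
  calc _ ≤ (2 ^ r) ^ 2 * 2 * ((Z * ‖g‖ ^ 2) * ‖f‖ ^ 2 + (Z * ‖f‖ ^ 2) * ‖g‖ ^ 2) := by
        gcongr
        · exact z3.trans (by gcongr)
        · exact y3.trans (by gcongr)
    _ = _ := by ring

theorem memlp_of_summable_sq {r : ℝ} {c : ℤ → ℂ}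
    (h : Summable fun k => (bracket r k * ‖c k‖) ^ 2) :
    Memℓp (fun k => (bracket r k : ℂ) * c k) 2 := by
  rw [memℓp_gen_iff (by norm_num)]
  refine h.congr fun k => ?_
  rw [norm_mul, Complex.norm_real, Real.norm_eq_abs, abs_of_pos (bracket_pos r k)]
  simp

theorem exists_mul {r : ℝ} (hr : 1 / 2 < r) (f g : Sobolev r) :
    ∃ p : Sobolev r, ∀ k, coef (toL2 p) k = convSeq (coef (toL2 f)) (coef (toL2 g)) k := by
  obtain ⟨q, -, hq⟩ := exists_mul_coef (f := toL2 f) (g := toL2 g) (summable_coef hr f)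
  refine exists_of_coef (by linarith) _
    (memlp_of_summable_sq (convSeq_weighted_bound hr f g).1) fun k => ?_
  rw [← hq, ← hq, coef_conj]

/-- The product of two elements of `H^r`, `r > 1/2`. -/
noncomputable def mulFun {r : ℝ} (hr : 1 / 2 < r) (f g : Sobolev r) : Sobolev r :=
  (exists_mul hr f g).choose

theorem coef_mulFun {r : ℝ} (hr : 1 / 2 < r) (f g : Sobolev r) (k : ℤ) :
    coef (toL2 (mulFun hr f g)) k = convSeq (coef (toL2 f)) (coef (toL2 g)) k :=
  (exists_mul hr f g).choose_spec k

theorem mulFun_ae {r : ℝ} (hr : 1 / 2 < r) (f g : Sobolev r) :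
    ∀ᵐ x ∂haarAddCircle, mulFun hr f g x = f x * g x := by
  obtain ⟨q, hq1, hq⟩ := exists_mul_coef (f := toL2 f) (g := toL2 g) (summable_coef hr f)
  have h1 : toL2 (mulFun hr f g) = q := coef_ext fun k => by rw [coef_mulFun, hq]
  rw [h1]
  exact hq1

theorem norm_mulFun_le {r : ℝ} (hr : 1 / 2 < r) (f g : Sobolev r) :
    ‖mulFun hr f g‖ ≤ (2 * 2 ^ r * √(∑' k, bracket (-(2 * r)) k)) * ‖f‖ * ‖g‖ := by
  refine (sq_le_sq₀ (norm_nonneg _) (by positivity)).1 ?_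
  rw [norm_sq_eq]
  simp only [coef_mulFun]
  refine (convSeq_weighted_bound hr f g).2.trans (le_of_eq ?_)
  have h := Real.sq_sqrt (show 0 ≤ ∑' k : ℤ, bracket (-(2 * r)) k from
    tsum_nonneg fun k => (bracket_pos (-(2 * r)) k).le)
  linear_combination -((2 * 2 ^ r) ^ 2 * ‖f‖ ^ 2 * ‖g‖ ^ 2) * h

/-- Two elements of `H^s` agree as soon as they agree almost everywhere. -/
theorem ext_ae {f g : Sobolev s} (h : ∀ᵐ x ∂haarAddCircle, f x = g x) : f = g :=
  toL2_injective (Lp.ext h)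

theorem add_ae (f g : Sobolev s) : ∀ᵐ x ∂haarAddCircle, (f + g) x = f x + g x := by
  rw [map_add]; exact Lp.coeFn_add _ _

theorem smul_ae (c : ℝ) (f : Sobolev s) : ∀ᵐ x ∂haarAddCircle, (c • f) x = c * f x := by
  rw [map_smul]; exact Lp.coeFn_smul _ _

theorem neg_ae (f : Sobolev s) : ∀ᵐ x ∂haarAddCircle, (-f) x = -f x := by
  rw [map_neg]; exact Lp.coeFn_neg _

/-- Multiplication `H^r × H^r → H^r`, `r > 1/2`, as a continuous bilinear map. -/
noncomputable def mulL {r : ℝ} (hr : 1 / 2 < r) : Sobolev r →L[ℝ] Sobolev r →L[ℝ] Sobolev r :=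
  LinearMap.mkContinuous₂
    (LinearMap.mk₂ ℝ (mulFun hr)
      (fun f g h => ext_ae (by
        filter_upwards [mulFun_ae hr (f + g) h, mulFun_ae hr f h, mulFun_ae hr g h, add_ae f g,
          add_ae (mulFun hr f h) (mulFun hr g h)] with x h1 h2 h3 h4 h5
        rw [h1, h4, h5, h2, h3, add_mul]))
      (fun c f h => ext_ae (by
        filter_upwards [mulFun_ae hr (c • f) h, mulFun_ae hr f h, smul_ae c f,
          smul_ae c (mulFun hr f h)] with x h1 h2 h3 h4
        rw [h1, h3, h4, h2, mul_assoc]))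
      (fun h f g => ext_ae (by
        filter_upwards [mulFun_ae hr h (f + g), mulFun_ae hr h f, mulFun_ae hr h g, add_ae f g,
          add_ae (mulFun hr h f) (mulFun hr h g)] with x h1 h2 h3 h4 h5
        rw [h1, h4, h5, h2, h3, mul_add]))
      (fun c h f => ext_ae (by
        filter_upwards [mulFun_ae hr h (c • f), mulFun_ae hr h f, smul_ae c f,
          smul_ae c (mulFun hr h f)] with x h1 h2 h3 h4
        rw [h1, h3, h4, h2]; ring)))
    (2 * 2 ^ r * √(∑' k, bracket (-(2 * r)) k)) (norm_mulFun_le hr)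

theorem mulL_apply {r : ℝ} (hr : 1 / 2 < r) (f g : Sobolev r) : mulL hr f g = mulFun hr f g := rfl

theorem exists_nonlocal {r : ℝ} (hr : 0 ≤ r) (h : Sobolev r) : ∃ g : Sobolev r,
    ∀ k, coef (toL2 g) k = 2 * Real.pi * Complex.I * k / symb k * coef (toL2 h) k := by
  refine exists_of_coef hr _ ?_ fun k => ?_
  · refine memlp_of_le 1 (memlp h) fun k => ?_
    rw [one_mul, mul_left_comm, norm_mul]
    exact mul_le_of_le_one_left (norm_nonneg _) (norm_two_pi_div_symb_le k).1
  · rw [coef_conj, symb_neg]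
    simp [Complex.conj_ofNat, neg_div]

/-- The underlying function of `Sobolev.nonlocal`. -/
noncomputable def nonlocalFun {r : ℝ} (hr : 0 ≤ r) (h : Sobolev r) : Sobolev r :=
  (exists_nonlocal hr h).choose

theorem coef_nonlocalFun {r : ℝ} (hr : 0 ≤ r) (h : Sobolev r) (k : ℤ) :
    coef (toL2 (nonlocalFun hr h)) k = 2 * Real.pi * Complex.I * k / symb k * coef (toL2 h) k :=
  (exists_nonlocal hr h).choose_spec k

/-- The operator `A⁻¹ ∂ₓ` on `H^r`, as a Fourier multiplier. -/
noncomputable def nonlocal {r : ℝ} (hr : 0 ≤ r) : Sobolev r →L[ℝ] Sobolev r :=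
  LinearMap.mkContinuous
    { toFun := nonlocalFun hr
      map_add' := fun f g => ext_coef fun k => by
        rw [map_add, coef_add, coef_nonlocalFun, coef_nonlocalFun, coef_nonlocalFun, map_add,
          coef_add, mul_add]
      map_smul' := fun c f => ext_coef fun k => by
        rw [RingHom.id_apply, map_smul, coef_smul, coef_nonlocalFun, coef_nonlocalFun, map_smul,
          coef_smul]
        ring }
    1 (fun f => norm_le_of_coef_le zero_le_one fun k => by
      have h1 : coef (toL2 (nonlocalFun hr f)) k = _ := coef_nonlocalFun hr f k
      rw [one_mul]
      change bracket r k * ‖coef (toL2 (nonlocalFun hr f)) k‖ ≤ _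
      rw [h1, norm_mul]
      exact mul_le_mul_of_nonneg_left (mul_le_of_le_one_left (norm_nonneg _)
        (norm_two_pi_div_symb_le k).1) (bracket_pos r k).le)

theorem coef_nonlocal {r : ℝ} (hr : 0 ≤ r) (h : Sobolev r) (k : ℤ) :
    coef (toL2 (nonlocal hr h)) k = 2 * Real.pi * Complex.I * k / symb k * coef (toL2 h) k :=
  coef_nonlocalFun hr h k

theorem toL2_muAInv_dx {hs : 2 ≤ s} (h1 : s - 2 ≤ s - 1 - 1) (h2 : 1 ≤ s - 1) (h3 : 0 ≤ s - 1)
    (h : Sobolev (s - 1)) : toL2 (muAInv hs (incl h1 (dx h2 h))) = toL2 (nonlocal h3 h) := by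
  refine coef_ext fun k => ?_
  have e1 := coef_muA hs (muAInv hs (incl h1 (dx h2 h))) k
  rw [muA_muAInv, toL2_incl, coef_dx] at e1
  have e2 : (if k = 0 then 1 else (2 * Real.pi * k) ^ 2 : ℂ) = symb k := by
    unfold symb; split_ifs <;> push_cast <;> rfl
  have e3 : (symb k : ℂ) ≠ 0 := by exact_mod_cast (symb_pos k).ne'
  rw [e2] at e1
  rw [coef_nonlocal, div_mul_eq_mul_div, eq_div_iff e3, e1]
  ring

/-- The right-hand side `-u u_x - A⁻¹ ∂ₓ (2 μ(u) u + ½ u_x²)` of the evolution equation, as a map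
from `H^s` to `H^{s-1}`. -/
noncomputable def rhs (hs : 5 / 2 < s) (u : Sobolev s) : Sobolev (s - 1) :=
  -mulL (by linarith) (incl (sub_le_self s zero_le_one) u) (dx (by linarith) u) -
    nonlocal (by linarith) ((2 * mean u) • incl (sub_le_self s zero_le_one) u +
      (1 / 2 : ℝ) • mulL (by linarith) (dx (by linarith) u) (dx (by linarith) u))

theorem continuous_rhs (hs : 5 / 2 < s) : Continuous (rhs hs) := by
  have h1 := continuous_incl (s := s) (sub_le_self s zero_le_one)
  have h2 := continuous_dx (s := s) (by linarith)
  have h3 := continuous_mean (s := s)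
  unfold rhs
  fun_prop

theorem coef_rhs (hs : 5 / 2 < s) (u : Sobolev s) (k : ℤ) :
    coef (toL2 (rhs hs u)) k = velocityRHS (coef (toL2 u)) k := by
  have h1 : coef (toL2 (dx (by linarith : 1 ≤ s) u)) = dSeq (coef (toL2 u)) := by
    ext k; rw [coef_dx, dSeq]
  rw [rhs, map_sub, coef_sub, map_neg, coef_neg, mulL_apply, mulL_apply, coef_mulFun,
    coef_nonlocal, map_add, coef_add, map_smul, coef_smul, map_smul, coef_smul, coef_mulFun, h1,
    toL2_incl, velocityRHS, coef_zero_eq_mean]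
  push_cast
  ring

/-- The equation in `IsGlobalSolution` says that `u_t` is `rhs u`. -/
theorem equation_iff (hs : 5 / 2 < s) (h2 : 2 ≤ s) (u : Sobolev s) (D : Sobolev (s - 1)) :
    (∃ h : Sobolev (s - 1),
      (∀ᵐ x ∂haarAddCircle,
        h x = 2 * mean u * u x + 1 / 2 * (dx (one_le_two.trans h2) u x) ^ 2) ∧
      (∀ᵐ x ∂haarAddCircle, D x + u x * dx (one_le_two.trans h2) u x
        + muAInv h2 (incl (by linarith) (dx (by linarith) h)) x = 0)) ↔ D = rhs hs u := by
  set ui : Sobolev (s - 1) := incl (sub_le_self s zero_le_one) u with hui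
  set ux := dx (one_le_two.trans h2) u with hux
  have hi : toL2 ui = toL2 u := toL2_incl _ _
  set h' : Sobolev (s - 1) := (2 * mean u) • ui +
      (1 / 2 : ℝ) • mulL (by linarith) ux ux with hh'
  have hh'ae : ∀ᵐ x ∂haarAddCircle, h' x = 2 * mean u * u x + 1 / 2 * (ux x) ^ 2 := by
    filter_upwards [add_ae ((2 * mean u) • ui)
      ((1 / 2 : ℝ) • mulFun (by linarith : 1 / 2 < s - 1) ux ux), smul_ae (2 * mean u) ui,
      smul_ae (1 / 2) (mulFun (by linarith : 1 / 2 < s - 1) ux ux),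
      mulFun_ae (by linarith : 1 / 2 < s - 1) ux ux] with x e1 e2 e3 e4
    rw [hh', mulL_apply, e1, e2, e3, e4, hi]
    ring
  have hrhs : ∀ᵐ x ∂haarAddCircle, rhs hs u x + u x * ux x
      + nonlocal (by linarith) h' x = 0 := by
    have e0 : rhs hs u = -mulFun (by linarith) ui ux + -nonlocal (by linarith) h' := by
      rw [← sub_eq_add_neg]; rfl
    filter_upwards [add_ae (-mulFun (by linarith : 1 / 2 < s - 1) ui ux)
      (-nonlocal (by linarith) h'), neg_ae (mulFun (by linarith : 1 / 2 < s - 1) ui ux),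
      neg_ae (nonlocal (by linarith) h'), mulFun_ae (by linarith : 1 / 2 < s - 1) ui ux]
      with x e1 e2 e3 e4
    rw [e0, e1, e2, e3, e4, hi]
    ring
  constructor
  · rintro ⟨h, hh, heq⟩
    have e : h = h' := ext_ae (by filter_upwards [hh, hh'ae] with x e1 e2; rw [e1, e2])
    subst e
    rw [toL2_muAInv_dx (by linarith) (by linarith) (by linarith)] at heq
    refine ext_ae ?_
    filter_upwards [heq, hrhs] with x e1 e2
    linarith
  · rintro rfl
    refine ⟨h', hh'ae, ?_⟩
    rw [toL2_muAInv_dx (by linarith) (by linarith) (by linarith)]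
    exact hrhs

/-- Evaluation of a square-summable sequence at an index. -/
noncomputable def lpEval (k : ℤ) : lp (fun _ : ℤ => ℂ) 2 →L[ℝ] ℂ :=
  LinearMap.mkContinuous
    { toFun := fun a => a k
      map_add' := fun _ _ => rfl
      map_smul' := fun _ _ => rfl }
    1 (fun a => by rw [one_mul]; exact lp.norm_apply_le_norm (by norm_num) a k)

/-- A curve in `H^r` whose Fourier coefficients have the derivative `coef (D t) k`, where `D` is a
continuous curve in `H^r`, has the derivative `D t` in `H^r`. -/
theorem hasDerivAt_of_coef {r : ℝ} {u D : ℝ → Sobolev r} (hD : Continuous D)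
    (h : ∀ t k, HasDerivAt (fun τ => coef (toL2 (u τ)) k) (coef (toL2 (D t)) k) t) (t : ℝ) :
    HasDerivAt u (D t) t := by
  have hwc : Continuous fun τ => weighted (D τ) := by
    have h1 : Continuous (weighted : Sobolev r →ₗ[ℝ] lp (fun _ : ℤ => ℂ) 2) :=
      AddMonoidHomClass.continuous_of_bound _ 1 fun f => by rw [one_mul]; rfl
    exact h1.comp hD
  have h1 : ∀ τ, weighted (u τ) = weighted (u 0) + ∫ x in (0 : ℝ)..τ, weighted (D x) := by
    intro τ
    ext k
    have e1 : lpEval k (∫ x in (0 : ℝ)..τ, weighted (D x)) =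
        ∫ x in (0 : ℝ)..τ, lpEval k (weighted (D x)) :=
      ((lpEval k).intervalIntegral_comp_comm (hwc.intervalIntegrable 0 τ)).symm
    have e2 : ∫ x in (0 : ℝ)..τ, lpEval k (weighted (D x)) =
        (bracket r k : ℂ) * coef (toL2 (u τ)) k - (bracket r k : ℂ) * coef (toL2 (u 0)) k := by
      refine intervalIntegral.integral_eq_sub_of_hasDerivAt
        (f := fun τ => (bracket r k : ℂ) * coef (toL2 (u τ)) k)
        (fun x _ => (h x k).const_mul (bracket r k : ℂ)) ?_
      exact ((lpEval k).continuous.comp hwc).intervalIntegrable 0 τ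
    change (bracket r k : ℂ) * coef (toL2 (u τ)) k = (bracket r k : ℂ) * coef (toL2 (u 0)) k +
      lpEval k (∫ x in (0 : ℝ)..τ, weighted (D x))
    rw [e1, e2]
    ring
  have h2 : HasDerivAt (fun τ => weighted (u τ)) (weighted (D t)) t := by
    rw [funext h1]
    exact (intervalIntegral.integral_hasDerivAt_right (hwc.intervalIntegrable 0 t)
      hwc.aestronglyMeasurable.stronglyMeasurableAtFilter hwc.continuousAt).const_add _
  rw [hasDerivAt_iff_isLittleO] at h2 ⊢
  refine Asymptotics.IsLittleO.congr' ?_ (Filter.EventuallyEq.refl _ _) (Filter.EventuallyEq.refl _ _)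
  rw [← Asymptotics.isLittleO_norm_left] at h2 ⊢
  refine h2.congr_left fun x => ?_
  rw [← map_sub, ← map_smul, ← map_sub]
  rfl

end Sobolev

open Sobolev

/-- On the Fourier side, a global solution solves the velocity equation. -/
theorem IsGlobalSolution.isVelocitySolution {s : ℝ} {h2 : 2 ≤ s} (hs : 5 / 2 < s)
    {u₀ : Sobolev s} {u : ℝ → Sobolev s} (hu : IsGlobalSolution h2 u₀ u) (T : ℝ) :
    IsVelocitySolution T fun t => coef (toL2 (u t)) where
  conj_symm t _ k := coef_conj _ k
  hasDerivAt t _ k := by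
    have h1 := (equation_iff hs h2 (u t) _).1 (hu.equation t)
    have h3 := (hu.contDiff.differentiable one_ne_zero t).hasDerivAt
    rw [h1] at h3
    have h4 := (coefL (s - 1) k).hasFDerivAt.comp_hasDerivAt t h3
    rw [coefL_apply, coef_rhs] at h4
    refine h4.congr_of_eventuallyEq (Filter.Eventually.of_forall fun τ => ?_)
    simp only [Function.comp_apply, coefL_apply, toL2_incl]

/-- A continuous curve in `H^s` whose Fourier coefficients solve the velocity equation is a global
solution. -/
theorem isGlobalSolution_of_coef {s : ℝ} (h2 : 2 ≤ s) (hs : 5 / 2 < s)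
    {u : ℝ → Sobolev s} (hc : Continuous u)
    (h : ∀ t k, HasDerivAt (fun τ => coef (toL2 (u τ)) k)
      (velocityRHS (coef (toL2 (u t))) k) t) : IsGlobalSolution h2 (u 0) u := by
  have hD : Continuous fun t => rhs hs (u t) := (continuous_rhs hs).comp hc
  have h1 : ∀ t, HasDerivAt
      (fun t => (incl (sub_le_self s zero_le_one) (u t) : Sobolev (s - 1))) (rhs hs (u t)) t :=
    hasDerivAt_of_coef hD fun t k => by
      simp only [toL2_incl, coef_rhs]
      exact h t k
  have h3 : deriv (fun t => (incl (sub_le_self s zero_le_one) (u t) : Sobolev (s - 1))) =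
      fun t => rhs hs (u t) := funext fun t => (h1 t).deriv
  refine ⟨hc, ?_, rfl, fun t => ?_⟩
  · rw [contDiff_one_iff_deriv]
    exact ⟨fun t => (h1 t).differentiableAt, by rw [h3]; exact hD⟩
  · exact (equation_iff hs h2 (u t) _).2 (h1 t).deriv

theorem IsGlobalSolution.unique {s : ℝ} {h2 : 2 ≤ s} (hs : 5 / 2 < s)
    {u₀ : Sobolev s} {u w : ℝ → Sobolev s} (hu : IsGlobalSolution h2 u₀ u)
    (hw : IsGlobalSolution h2 u₀ w) : u = w := by
  ext1 t
  set T := |t| + 1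
  have hT : 0 < T := by positivity
  have ht : t ∈ Set.Ioo (-T) T := abs_lt.1 (by linarith : |t| < T)
  have hbd : ∀ z : ℝ → Sobolev s, Continuous z → ∃ S, ∀ t ∈ Set.Ioo (-T) T,
      (Summable fun k => bracket 2 k * ‖coef (toL2 (z t)) k‖) ∧
      ∑' k, bracket 2 k * ‖coef (toL2 (z t)) k‖ ≤ S := by
    intro z hz
    obtain ⟨M, hM⟩ := isCompact_Icc.exists_bound_of_continuousOn
      (hz.continuousOn : ContinuousOn z (Set.Icc (-T) T))
    refine ⟨√(∑' k, bracket (-(2 * (s - 2))) k) * M, fun t ht => ?_⟩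
    obtain ⟨e1, e2⟩ := summable_bracket_two_coef hs (z t)
    exact ⟨e1, e2.trans (mul_le_mul_of_nonneg_left (hM t ⟨ht.1.le, ht.2.le⟩)
      (Real.sqrt_nonneg _))⟩
  obtain ⟨S1, hS1⟩ := hbd u hu.continuous
  obtain ⟨S2, hS2⟩ := hbd w hw.continuous
  have h := IsVelocitySolution.unique hT (hu.isVelocitySolution hs T)
    (hw.isVelocitySolution hs T) (by simp only [hu.initial, hw.initial])
    (S := max S1 S2)
    (fun t ht => ⟨(hS1 t ht).1, (hS1 t ht).2.trans (le_max_left _ _)⟩)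
    (fun t ht => ⟨(hS2 t ht).1, (hS2 t ht).2.trans (le_max_right _ _)⟩) ht
  exact ext_coef fun k => congrFun h k

/-! ### The velocity field in Lagrangian coordinates -/

/-- The position `∫₀^ξ e^ℓ` of the particle `ξ` relative to the particle `0`, for a flow with
logarithmic derivative `ℓ`. -/
noncomputable def lagP (ℓ : ℝ → ℝ) (ξ : ℝ) : ℝ := ∫ z in (0 : ℝ)..ξ, Real.exp (ℓ z)

/-- The momentum per unit of Lagrangian length: `m dx = f e^{-ℓ} dξ`, where `f` is the initial
momentum. -/
noncomputable def lagq (f ℓ : ℝ → ℝ) (z : ℝ) : ℝ := f z * Real.exp (-ℓ z)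

/-- The cumulated momentum. -/
noncomputable def lagN (f ℓ : ℝ → ℝ) (ξ : ℝ) : ℝ := ∫ z in (0 : ℝ)..ξ, lagq f ℓ z

/-- The cumulated first moment of the momentum. -/
noncomputable def lagQ (f ℓ : ℝ → ℝ) (ξ : ℝ) : ℝ := ∫ z in (0 : ℝ)..ξ, lagP ℓ z * lagq f ℓ z

/-- The derivative `u_x` of the velocity at the particle `ξ`: the integral of
`g'(η(ξ) - η(z))` against the momentum, where `g(y) = ½y² - ½|y| + 13/12` for `|y| ≤ 1` is the
Green function of `A`. -/
noncomputable def lagV (f ℓ : ℝ → ℝ) (ξ : ℝ) : ℝ :=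
  lagP ℓ ξ * lagN f ℓ 1 - lagQ f ℓ 1 - lagN f ℓ ξ + lagN f ℓ 1 / 2

/-- The velocity of the particle `ξ` relative to the particle `0`. -/
noncomputable def lagG (f ℓ : ℝ → ℝ) (ξ : ℝ) : ℝ :=
  1 / 2 * lagP ℓ ξ ^ 2 * lagN f ℓ 1 - lagP ℓ ξ * lagQ f ℓ 1 - lagP ℓ ξ * lagN f ℓ ξ
    + lagQ f ℓ ξ + 1 / 2 * lagP ℓ ξ * lagN f ℓ 1

/-- The velocity of the particle `0`. -/
noncomputable def lagU (f ℓ : ℝ → ℝ) : ℝ :=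
  1 / 2 * (∫ z in (0 : ℝ)..1, lagP ℓ z ^ 2 * lagq f ℓ z) + 13 / 12 * lagN f ℓ 1
    - 1 / 2 * lagQ f ℓ 1

section Static

variable {f ℓ : ℝ → ℝ}

theorem hasDerivAt_primitive {h : ℝ → ℝ} (hh : Continuous h) (ξ : ℝ) :
    HasDerivAt (fun x => ∫ z in (0 : ℝ)..x, h z) (h ξ) ξ :=
  intervalIntegral.integral_hasDerivAt_right (hh.intervalIntegrable 0 ξ)
    hh.aestronglyMeasurable.stronglyMeasurableAtFilter hh.continuousAt

theorem hasDerivAt_lagP (hℓ : Continuous ℓ) (ξ : ℝ) :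
    HasDerivAt (lagP ℓ) (Real.exp (ℓ ξ)) ξ :=
  hasDerivAt_primitive (Real.continuous_exp.comp hℓ) ξ

theorem continuous_lagP (hℓ : Continuous ℓ) : Continuous (lagP ℓ) :=
  continuous_iff_continuousAt.2 fun ξ => (hasDerivAt_lagP hℓ ξ).continuousAt

theorem continuous_lagq (hf : Continuous f) (hℓ : Continuous ℓ) : Continuous (lagq f ℓ) := by
  unfold lagq; fun_prop

theorem hasDerivAt_lagN (hf : Continuous f) (hℓ : Continuous ℓ) (ξ : ℝ) :
    HasDerivAt (lagN f ℓ) (lagq f ℓ ξ) ξ :=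
  hasDerivAt_primitive (continuous_lagq hf hℓ) ξ

theorem continuous_lagN (hf : Continuous f) (hℓ : Continuous ℓ) : Continuous (lagN f ℓ) :=
  continuous_iff_continuousAt.2 fun ξ => (hasDerivAt_lagN hf hℓ ξ).continuousAt

theorem hasDerivAt_lagQ (hf : Continuous f) (hℓ : Continuous ℓ) (ξ : ℝ) :
    HasDerivAt (lagQ f ℓ) (lagP ℓ ξ * lagq f ℓ ξ) ξ :=
  hasDerivAt_primitive ((continuous_lagP hℓ).mul (continuous_lagq hf hℓ)) ξ

theorem continuous_lagQ (hf : Continuous f) (hℓ : Continuous ℓ) : Continuous (lagQ f ℓ) :=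
  continuous_iff_continuousAt.2 fun ξ => (hasDerivAt_lagQ hf hℓ ξ).continuousAt

theorem continuous_lagV (hf : Continuous f) (hℓ : Continuous ℓ) : Continuous (lagV f ℓ) := by
  have := continuous_lagP hℓ
  have := continuous_lagN hf hℓ
  unfold lagV; fun_prop

theorem continuous_lagG (hf : Continuous f) (hℓ : Continuous ℓ) : Continuous (lagG f ℓ) := by
  have := continuous_lagP hℓ
  have := continuous_lagN hf hℓ
  have := continuous_lagQ hf hℓ
  unfold lagG; fun_prop

theorem lagP_zero : lagP ℓ 0 = 0 := by simp [lagP]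
theorem lagN_zero : lagN f ℓ 0 = 0 := by simp [lagN]
theorem lagQ_zero : lagQ f ℓ 0 = 0 := by simp [lagQ]
theorem lagG_zero : lagG f ℓ 0 = 0 := by simp [lagG, lagP_zero, lagN_zero, lagQ_zero]

/-- `∂_ξ u(η(ξ)) = u_x(η(ξ)) η'(ξ)`. -/
theorem hasDerivAt_lagG (hf : Continuous f) (hℓ : Continuous ℓ) (ξ : ℝ) :
    HasDerivAt (lagG f ℓ) (Real.exp (ℓ ξ) * lagV f ℓ ξ) ξ := by
  have h1 := hasDerivAt_lagP hℓ ξ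
  have h2 := hasDerivAt_lagN hf hℓ ξ
  have h3 := hasDerivAt_lagQ hf hℓ ξ
  have h4 := (((((h1.pow 2).const_mul (1 / 2)).mul_const (lagN f ℓ 1)).sub
    (h1.mul_const (lagQ f ℓ 1))).sub (h1.mul h2)).add h3 |>.add
      ((h1.const_mul (1 / 2)).mul_const (lagN f ℓ 1))
  refine h4.congr_deriv ?_
  simp only [lagV]
  push_cast
  ring

theorem integral_exp_mul_lagV (hf : Continuous f) (hℓ : Continuous ℓ) (ξ : ℝ) :
    ∫ z in (0 : ℝ)..ξ, Real.exp (ℓ z) * lagV f ℓ z = lagG f ℓ ξ := by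
  have h := intervalIntegral.integral_eq_sub_of_hasDerivAt (a := 0) (b := ξ)
    (fun x _ => hasDerivAt_lagG hf hℓ x)
    (((Real.continuous_exp.comp hℓ).mul (continuous_lagV hf hℓ)).intervalIntegrable 0 ξ)
  rwa [lagG_zero, sub_zero] at h

/-- The total momentum is conserved: the integral of an antisymmetric kernel vanishes. -/
theorem integral_lagq_mul_lagV (hf : Continuous f) (hℓ : Continuous ℓ) :
    ∫ z in (0 : ℝ)..1, lagq f ℓ z * lagV f ℓ z = 0 := by
  have h := intervalIntegral.integral_eq_sub_of_hasDerivAt (a := 0) (b := 1)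
    (f := fun ξ => lagN f ℓ 1 * lagQ f ℓ ξ - lagQ f ℓ 1 * lagN f ℓ ξ - 1 / 2 * lagN f ℓ ξ ^ 2
      + lagN f ℓ 1 / 2 * lagN f ℓ ξ) (f' := fun ξ => lagq f ℓ ξ * lagV f ℓ ξ)
    (fun ξ _ => by
      have h2 := hasDerivAt_lagN hf hℓ ξ
      have h3 := hasDerivAt_lagQ hf hℓ ξ
      refine ((((h3.const_mul _).sub (h2.const_mul _)).sub ((h2.pow 2).const_mul (1 / 2))).add
        (h2.const_mul _)).congr_deriv ?_
      simp only [lagV]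
      push_cast
      ring)
    (((continuous_lagq hf hℓ).mul (continuous_lagV hf hℓ)).intervalIntegrable 0 1)
  rw [h, lagN_zero, lagQ_zero]
  ring

theorem abs_integral_le_of_abs_le {h : ℝ → ℝ} {C ξ : ℝ} (hC : 0 ≤ C)
    (hξ : ξ ∈ Set.Icc (0 : ℝ) 1) (h1 : ∀ z ∈ Set.Icc (0 : ℝ) 1, |h z| ≤ C) :
    |∫ z in (0 : ℝ)..ξ, h z| ≤ C := by
  have h2 := intervalIntegral.norm_integral_le_of_norm_le_const (a := 0) (b := ξ) (f := h) (C := C)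
    (fun z hz => by
      rw [Set.uIoc_of_le hξ.1] at hz
      exact h1 z ⟨hz.1.le, hz.2.trans hξ.2⟩)
  rw [sub_zero, abs_of_nonneg hξ.1] at h2
  exact h2.trans (mul_le_of_le_one_right hC hξ.2)

theorem abs_exp_sub_exp_le {R a b : ℝ} (ha : a ≤ R) (hb : b ≤ R) :
    |Real.exp a - Real.exp b| ≤ Real.exp R * |a - b| := by
  have key : ∀ x y : ℝ, x ≤ R → Real.exp x - Real.exp y ≤ Real.exp R * |x - y| := by
    intro x y hx
    have h1 : Real.exp y = Real.exp x * Real.exp (y - x) := by rw [← Real.exp_add]; ring_nf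
    have h2 := Real.add_one_le_exp (y - x)
    have h3 := Real.exp_pos x
    calc _ ≤ Real.exp x * (x - y) := by rw [h1]; nlinarith
      _ ≤ Real.exp x * |x - y| := by gcongr; exact le_abs_self _
      _ ≤ _ := by gcongr
  rw [abs_le]
  constructor
  · have := key b a hb
    rw [abs_sub_comm] at this
    linarith
  · exact key a b ha

theorem lag_bounds {R C : ℝ} (hC : 0 ≤ C) (hfC : ∀ x, |f x| ≤ C)
    (hR : ∀ x, |ℓ x| ≤ R) {ξ : ℝ} (hξ : ξ ∈ Set.Icc (0 : ℝ) 1) :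
    |lagP ℓ ξ| ≤ Real.exp R ∧ |lagq f ℓ ξ| ≤ C * Real.exp R ∧ |lagN f ℓ ξ| ≤ C * Real.exp R ∧
      |lagQ f ℓ ξ| ≤ Real.exp R * (C * Real.exp R) ∧
      |lagV f ℓ ξ| ≤ C * (2 * Real.exp R ^ 2 + 2 * Real.exp R) := by
  have hP : ∀ z ∈ Set.Icc (0 : ℝ) 1, |lagP ℓ z| ≤ Real.exp R := fun z hz =>
    abs_integral_le_of_abs_le (Real.exp_pos R).le hz fun y _ => by
      rw [abs_of_pos (Real.exp_pos _)]
      exact Real.exp_le_exp.2 (abs_le.1 (hR y)).2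
  have hq : ∀ z ∈ Set.Icc (0 : ℝ) 1, |lagq f ℓ z| ≤ C * Real.exp R := fun z _ => by
    rw [lagq, abs_mul, abs_of_pos (Real.exp_pos _)]
    gcongr
    · exact hfC z
    · linarith [(abs_le.1 (hR z)).1]
  have hCR : 0 ≤ C * Real.exp R := by positivity
  have hN : ∀ z ∈ Set.Icc (0 : ℝ) 1, |lagN f ℓ z| ≤ C * Real.exp R := fun z hz =>
    abs_integral_le_of_abs_le hCR hz hq
  have hQ : ∀ z ∈ Set.Icc (0 : ℝ) 1, |lagQ f ℓ z| ≤ Real.exp R * (C * Real.exp R) := fun z hz =>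
    abs_integral_le_of_abs_le (by positivity) hz fun y hy => by
      rw [abs_mul]
      exact mul_le_mul (hP y hy) (hq y hy) (abs_nonneg _) (Real.exp_pos R).le
  refine ⟨hP ξ hξ, hq ξ hξ, hN ξ hξ, hQ ξ hξ, ?_⟩
  have h1 : (1 : ℝ) ∈ Set.Icc (0 : ℝ) 1 := ⟨zero_le_one, le_rfl⟩
  have e1 : |lagP ℓ ξ * lagN f ℓ 1| ≤ Real.exp R * (C * Real.exp R) := by
    rw [abs_mul]
    exact mul_le_mul (hP ξ hξ) (hN 1 h1) (abs_nonneg _) (Real.exp_pos R).le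
  have e2 := hQ 1 h1
  have e3 := hN 1 h1
  have e4 := hN ξ hξ
  rw [abs_le] at e1 e2 e3 e4
  unfold lagV
  rw [abs_le]
  constructor <;> linarith [e1.1, e1.2, e2.1, e2.2, e3.1, e3.2, e4.1, e4.2]

/-- The field `lagV` is Lipschitz in `ℓ` on bounded sets, in the uniform norm. -/
theorem abs_lagV_sub_le {ℓ' : ℝ → ℝ} (hf : Continuous f) (hℓ : Continuous ℓ) (hℓ' : Continuous ℓ')
    {R C δ : ℝ} (hC : 0 ≤ C) (hfC : ∀ x, |f x| ≤ C)
    (hR : ∀ x, |ℓ x| ≤ R) (hR' : ∀ x, |ℓ' x| ≤ R) (hδ : ∀ x, |ℓ x - ℓ' x| ≤ δ)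
    {ξ : ℝ} (hξ : ξ ∈ Set.Icc (0 : ℝ) 1) :
    |lagV f ℓ ξ - lagV f ℓ' ξ| ≤ C * (4 * Real.exp R ^ 2 + 2 * Real.exp R) * δ := by
  have hδ0 : 0 ≤ δ := (abs_nonneg _).trans (hδ 0)
  have hE := Real.exp_pos R
  have h1 : (1 : ℝ) ∈ Set.Icc (0 : ℝ) 1 := ⟨zero_le_one, le_rfl⟩
  have hP : ∀ z ∈ Set.Icc (0 : ℝ) 1, |lagP ℓ z - lagP ℓ' z| ≤ Real.exp R * δ := fun z hz => by
    rw [lagP, lagP, ← intervalIntegral.integral_sub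
      (Continuous.intervalIntegrable (by fun_prop) 0 z)
      (Continuous.intervalIntegrable (by fun_prop) 0 z)]
    refine abs_integral_le_of_abs_le (by positivity) hz fun y _ => ?_
    refine (abs_exp_sub_exp_le (abs_le.1 (hR y)).2 (abs_le.1 (hR' y)).2).trans ?_
    gcongr; exact hδ y
  have hq : ∀ z, |lagq f ℓ z - lagq f ℓ' z| ≤ C * Real.exp R * δ := fun z => by
    rw [lagq, lagq, ← mul_sub, abs_mul, mul_assoc]
    refine mul_le_mul (hfC z) ?_ (abs_nonneg _) hC
    refine (abs_exp_sub_exp_le (R := R) (by linarith [(abs_le.1 (hR z)).1])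
      (by linarith [(abs_le.1 (hR' z)).1])).trans ?_
    gcongr
    rw [neg_sub_neg, abs_sub_comm]
    exact hδ z
  have hN : ∀ z ∈ Set.Icc (0 : ℝ) 1, |lagN f ℓ z - lagN f ℓ' z| ≤ C * Real.exp R * δ :=
    fun z hz => by
    rw [lagN, lagN, ← intervalIntegral.integral_sub
      ((continuous_lagq hf hℓ).intervalIntegrable 0 z)
      ((continuous_lagq hf hℓ').intervalIntegrable 0 z)]
    exact abs_integral_le_of_abs_le (by positivity) hz fun y _ => hq y
  have hprod : ∀ a a' b b' A B α β : ℝ, |a'| ≤ A → |b| ≤ B → |a - a'| ≤ α → |b - b'| ≤ β →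
      |a * b - a' * b'| ≤ α * B + A * β := by
    intro a a' b b' A B α β ha hb hα hβ
    have e : a * b - a' * b' = (a - a') * b + a' * (b - b') := by ring
    rw [e]
    refine (abs_add_le _ _).trans ?_
    rw [abs_mul, abs_mul]
    exact add_le_add (mul_le_mul hα hb (abs_nonneg _) ((abs_nonneg _).trans hα))
      (mul_le_mul ha hβ (abs_nonneg _) ((abs_nonneg _).trans ha))
  have hQ : |lagQ f ℓ 1 - lagQ f ℓ' 1| ≤
      Real.exp R * δ * (C * Real.exp R) + Real.exp R * (C * Real.exp R * δ) := by
    have c1 := continuous_lagP hℓ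
    have c2 := continuous_lagP hℓ'
    have c3 := continuous_lagq hf hℓ
    have c4 := continuous_lagq hf hℓ'
    rw [lagQ, lagQ, ← intervalIntegral.integral_sub
      (Continuous.intervalIntegrable (by fun_prop) 0 1)
      (Continuous.intervalIntegrable (by fun_prop) 0 1)]
    exact abs_integral_le_of_abs_le (by positivity) h1 fun y hy =>
      hprod _ _ _ _ _ _ _ _ (lag_bounds hC hfC hR' hy).1 (lag_bounds hC hfC hR hy).2.1
        (hP y hy) (hq y)
  have hPN : |lagP ℓ ξ * lagN f ℓ 1 - lagP ℓ' ξ * lagN f ℓ' 1| ≤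
      Real.exp R * δ * (C * Real.exp R) + Real.exp R * (C * Real.exp R * δ) :=
    hprod _ _ _ _ _ _ _ _ (lag_bounds hC hfC hR' hξ).1 (lag_bounds hC hfC hR h1).2.2.1
        (hP ξ hξ) (hN 1 h1)
  have e3 := hN 1 h1
  have e4 := hN ξ hξ
  rw [abs_le] at hQ hPN e3 e4
  unfold lagV
  rw [abs_le]
  constructor <;> nlinarith [hQ.1, hQ.2, hPN.1, hPN.2, e3.1, e3.2, e4.1, e4.2]

/-- With a flow of degree one and a momentum of one sign, `u_x` is bounded by the total momentum. -/
theorem abs_lagV_le (hf : Continuous f) (hℓ : Continuous ℓ)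
    (hsign : (∀ x, 0 ≤ f x) ∨ ∀ x, f x ≤ 0) (hM : lagP ℓ 1 = 1)
    {ξ : ℝ} (hξ : ξ ∈ Set.Icc (0 : ℝ) 1) : |lagV f ℓ ξ| ≤ 4 * |lagN f ℓ 1| := by
  have hmono : ∀ z ∈ Set.Icc (0 : ℝ) 1, 0 ≤ lagP ℓ z ∧ lagP ℓ z ≤ 1 := by
    intro z hz
    have hm : Monotone (lagP ℓ) := monotone_of_deriv_nonneg
      (fun x => (hasDerivAt_lagP hℓ x).differentiableAt)
      fun x => by rw [(hasDerivAt_lagP hℓ x).deriv]; exact (Real.exp_pos _).le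
    exact ⟨by rw [← lagP_zero (ℓ := ℓ)]; exact hm hz.1, by rw [← hM]; exact hm hz.2⟩
  have hqc := continuous_lagq hf hℓ
  have habs : ∫ z in (0 : ℝ)..1, |lagq f ℓ z| = |lagN f ℓ 1| := by
    rcases hsign with h | h
    · have h0 : ∀ z, 0 ≤ lagq f ℓ z := fun z => mul_nonneg (h z) (Real.exp_pos _).le
      simp_rw [fun z => abs_of_nonneg (h0 z)]
      rw [abs_of_nonneg]
      · rfl
      · exact intervalIntegral.integral_nonneg zero_le_one fun z _ => h0 z
    · have h0 : ∀ z, lagq f ℓ z ≤ 0 := fun z =>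
        mul_nonpos_of_nonpos_of_nonneg (h z) (Real.exp_pos _).le
      simp_rw [fun z => abs_of_nonpos (h0 z)]
      rw [intervalIntegral.integral_neg, abs_of_nonpos]
      · rfl
      · have : 0 ≤ ∫ z in (0 : ℝ)..1, -lagq f ℓ z :=
          intervalIntegral.integral_nonneg zero_le_one fun z _ => neg_nonneg.2 (h0 z)
        rw [intervalIntegral.integral_neg] at this
        exact neg_nonneg.1 this
  have hint : ∀ h : ℝ → ℝ, Continuous h → (∀ z ∈ Set.Icc (0 : ℝ) 1, |h z| ≤ |lagq f ℓ z|) →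
      ∀ x ∈ Set.Icc (0 : ℝ) 1, |∫ z in (0 : ℝ)..x, h z| ≤ |lagN f ℓ 1| := by
    intro h hc hle x hx
    rw [← habs]
    calc _ ≤ ∫ z in (0 : ℝ)..x, |h z| := intervalIntegral.abs_integral_le_integral_abs hx.1
      _ ≤ ∫ z in (0 : ℝ)..x, |lagq f ℓ z| := by
          refine intervalIntegral.integral_mono_on hx.1 (hc.abs.intervalIntegrable _ _)
            (hqc.abs.intervalIntegrable _ _) fun z hz => hle z ⟨hz.1, hz.2.trans hx.2⟩
      _ ≤ _ := by
          refine intervalIntegral.integral_mono_interval le_rfl hx.1 hx.2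
            (Filter.Eventually.of_forall fun z => abs_nonneg _) (hqc.abs.intervalIntegrable _ _)
  have h1 : (1 : ℝ) ∈ Set.Icc (0 : ℝ) 1 := ⟨zero_le_one, le_rfl⟩
  have e4 : |lagN f ℓ ξ| ≤ |lagN f ℓ 1| := hint _ hqc (fun z _ => le_rfl) ξ hξ
  have e2 : |lagQ f ℓ 1| ≤ |lagN f ℓ 1| :=
    hint _ ((continuous_lagP hℓ).mul hqc) (fun z hz => by
      rw [Pi.mul_apply, abs_mul, abs_of_nonneg (hmono z hz).1]
      exact mul_le_of_le_one_left (abs_nonneg _) (hmono z hz).2) 1 h1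
  have e1 : |lagP ℓ ξ * lagN f ℓ 1| ≤ |lagN f ℓ 1| := by
    rw [abs_mul, abs_of_nonneg (hmono ξ hξ).1]
    exact mul_le_of_le_one_left (abs_nonneg _) (hmono ξ hξ).2
  have e3 : |lagN f ℓ 1| ≤ |lagN f ℓ 1| := le_rfl
  set n := |lagN f ℓ 1|
  rw [abs_le] at e1 e2 e4 e3
  unfold lagV
  rw [abs_le]
  constructor <;> linarith [e1.1, e1.2, e2.1, e2.2, e3.1, e3.2, e4.1, e4.2]

end Static

/-! ### The Lagrangian flow -/

/-- A solution for `|t| < T` of the equation `∂_t ℓ = u_x ∘ η` for the logarithmic derivative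
`ℓ = log η_ξ` of the flow, starting from the identity. -/
structure IsLagFlow (f : ℝ → ℝ) (T R : ℝ) (ℓ : ℝ → ℝ → ℝ) : Prop where
  continuous : ∀ t, Continuous (ℓ t)
  bound : ∀ t ∈ Set.Ioo (-T) T, ∀ ξ, |ℓ t ξ| ≤ R
  hasDerivAt : ∀ t ∈ Set.Ioo (-T) T, ∀ ξ ∈ Set.Icc (0 : ℝ) 1,
    HasDerivAt (fun τ => ℓ τ ξ) (lagV f (ℓ t) ξ) t
  initial : ∀ ξ, ℓ 0 ξ = 0

theorem hasDerivAt_integral_param {E : Type*} [NormedAddCommGroup E] [NormedSpace ℝ E]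
    {H H' : ℝ → ℝ → E} {T B : ℝ} (hH : ∀ t ∈ Set.Ioo (-T) T, Continuous (H t))
    (hH' : ∀ t ∈ Set.Ioo (-T) T, Continuous (H' t))
    (hB : ∀ t ∈ Set.Ioo (-T) T, ∀ ξ ∈ Set.Icc (0 : ℝ) 1, ‖H' t ξ‖ ≤ B)
    (hd : ∀ t ∈ Set.Ioo (-T) T, ∀ ξ ∈ Set.Icc (0 : ℝ) 1,
      HasDerivAt (fun τ => H τ ξ) (H' t ξ) t)
    {t : ℝ} (ht : t ∈ Set.Ioo (-T) T) {ξ : ℝ} (hξ : ξ ∈ Set.Icc (0 : ℝ) 1) :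
    HasDerivAt (fun τ => ∫ z in (0 : ℝ)..ξ, H τ z) (∫ z in (0 : ℝ)..ξ, H' t z) t := by
  have hnhds : Set.Ioo (-T) T ∈ nhds t := isOpen_Ioo.mem_nhds ht
  have hsub : ∀ z ∈ Set.uIoc 0 ξ, z ∈ Set.Icc (0 : ℝ) 1 := fun z hz => by
    rw [Set.uIoc_of_le hξ.1] at hz
    exact ⟨hz.1.le, hz.2.trans hξ.2⟩
  refine (intervalIntegral.hasDerivAt_integral_of_dominated_loc_of_deriv_le (μ := volume)
    (bound := fun _ => B) hnhds ?_ ((hH t ht).intervalIntegrable 0 ξ)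
    (hH' t ht).aestronglyMeasurable ?_ intervalIntegrable_const ?_).2
  · filter_upwards [hnhds] with τ hτ using (hH τ hτ).aestronglyMeasurable
  · exact Filter.Eventually.of_forall fun z hz τ hτ => hB τ hτ z (hsub z hz)
  · exact Filter.Eventually.of_forall fun z hz τ hτ => hd τ hτ z (hsub z hz)

namespace IsLagFlow

variable {f : ℝ → ℝ} {T R C : ℝ} {ℓ : ℝ → ℝ → ℝ}

theorem hasDerivAt_lagP (h : IsLagFlow f T R ℓ) (hf : Continuous f) (hC : 0 ≤ C)
    (hfC : ∀ x, |f x| ≤ C) {t : ℝ} (ht : t ∈ Set.Ioo (-T) T) {ξ : ℝ}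
    (hξ : ξ ∈ Set.Icc (0 : ℝ) 1) :
    HasDerivAt (fun τ => lagP (ℓ τ) ξ) (lagG f (ℓ t) ξ) t := by
  rw [← integral_exp_mul_lagV hf (h.continuous t)]
  refine hasDerivAt_integral_param (H := fun τ z => Real.exp (ℓ τ z))
    (H' := fun τ z => Real.exp (ℓ τ z) * lagV f (ℓ τ) z)
    (B := Real.exp R * (C * (2 * Real.exp R ^ 2 + 2 * Real.exp R)))
    (fun τ _ => Real.continuous_exp.comp (h.continuous τ))
    (fun τ _ => (Real.continuous_exp.comp (h.continuous τ)).mul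
      (continuous_lagV hf (h.continuous τ))) (fun τ hτ z hz => ?_)
    (fun τ hτ z hz => (h.hasDerivAt τ hτ z hz).exp) ht hξ
  rw [norm_mul, Real.norm_eq_abs, Real.norm_eq_abs, abs_of_pos (Real.exp_pos _)]
  exact mul_le_mul (Real.exp_le_exp.2 (abs_le.1 (h.bound τ hτ z)).2)
    (lag_bounds hC hfC (h.bound τ hτ) hz).2.2.2.2 (abs_nonneg _) (Real.exp_pos _).le

theorem hasDerivAt_lagq (h : IsLagFlow f T R ℓ) {t : ℝ} (ht : t ∈ Set.Ioo (-T) T) {ξ : ℝ}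
    (hξ : ξ ∈ Set.Icc (0 : ℝ) 1) :
    HasDerivAt (fun τ => lagq f (ℓ τ) ξ) (-(lagq f (ℓ t) ξ * lagV f (ℓ t) ξ)) t := by
  refine ((h.hasDerivAt t ht ξ hξ).neg.exp.const_mul (f ξ)).congr_deriv ?_
  simp only [lagq, Pi.neg_apply]
  ring

theorem lagN_one (h : IsLagFlow f T R ℓ) (hf : Continuous f) (hC : 0 ≤ C)
    (hfC : ∀ x, |f x| ≤ C) {t : ℝ} (ht : t ∈ Set.Ioo (-T) T) :
    lagN f (ℓ t) 1 = ∫ z in (0 : ℝ)..1, f z := by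
  have h1 : (1 : ℝ) ∈ Set.Icc (0 : ℝ) 1 := ⟨zero_le_one, le_rfl⟩
  have hT : 0 < T := by linarith [ht.1, ht.2]
  have h0 : (0 : ℝ) ∈ Set.Ioo (-T) T := ⟨by linarith, hT⟩
  have hd : ∀ τ ∈ Set.Ioo (-T) T, HasDerivAt (fun τ => lagN f (ℓ τ) 1) 0 τ := by
    intro τ hτ
    have e : (0 : ℝ) = ∫ z in (0 : ℝ)..1, -(lagq f (ℓ τ) z * lagV f (ℓ τ) z) := by
      rw [intervalIntegral.integral_neg, integral_lagq_mul_lagV hf (h.continuous τ), neg_zero]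
    rw [e]
    refine hasDerivAt_integral_param (H := fun τ z => lagq f (ℓ τ) z)
      (H' := fun τ z => -(lagq f (ℓ τ) z * lagV f (ℓ τ) z))
      (B := (C * Real.exp R) * (C * (2 * Real.exp R ^ 2 + 2 * Real.exp R)))
      (fun τ _ => continuous_lagq hf (h.continuous τ))
      (fun τ _ => ((continuous_lagq hf (h.continuous τ)).mul
        (continuous_lagV hf (h.continuous τ))).neg) (fun τ hτ z hz => ?_)
      (fun τ hτ z hz => h.hasDerivAt_lagq hτ hz) hτ h1
    have hb := lag_bounds hC hfC (h.bound τ hτ) hz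
    rw [norm_neg, norm_mul]
    exact mul_le_mul hb.2.1 hb.2.2.2.2 (abs_nonneg _) (by positivity)
  have h2 := (convex_Ioo (-T) T).norm_image_sub_le_of_norm_hasDerivWithin_le (C := 0)
    (fun τ hτ => (hd τ hτ).hasDerivWithinAt) (fun τ _ => by simp) h0 ht
  rw [zero_mul, norm_le_zero_iff, sub_eq_zero] at h2
  rw [h2]
  simp [lagN, lagq, h.initial]

/-- The flow keeps degree one. -/
theorem lagP_one (h : IsLagFlow f T R ℓ) (hf : Continuous f) (hC : 0 ≤ C)
    (hfC : ∀ x, |f x| ≤ C) {t : ℝ} (ht : t ∈ Set.Ioo (-T) T) : lagP (ℓ t) 1 = 1 := by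
  have h1 : (1 : ℝ) ∈ Set.Icc (0 : ℝ) 1 := ⟨zero_le_one, le_rfl⟩
  have h2 := abs_le_mul_exp_of_abs_deriv_le (y := fun τ => lagP (ℓ τ) 1 - 1)
    (y' := fun τ => lagG f (ℓ τ) 1) (C := 2 * (Real.exp R * (C * Real.exp R)))
    (fun τ hτ => (h.hasDerivAt_lagP hf hC hfC hτ h1).sub_const 1)
    (fun τ hτ => by
      have hb := lag_bounds hC hfC (h.bound τ hτ) h1
      have e : lagG f (ℓ τ) 1 = (1 / 2 * (lagP (ℓ τ) 1 * lagN f (ℓ τ) 1) - lagQ f (ℓ τ) 1) *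
          (lagP (ℓ τ) 1 - 1) := by
        unfold lagG; ring
      rw [e, abs_mul]
      refine mul_le_mul_of_nonneg_right ?_ (abs_nonneg _)
      have e1 : |lagP (ℓ τ) 1 * lagN f (ℓ τ) 1| ≤ Real.exp R * (C * Real.exp R) := by
        rw [abs_mul]
        exact mul_le_mul hb.1 hb.2.2.1 (abs_nonneg _) (Real.exp_pos R).le
      have e2 := hb.2.2.2.1
      rw [abs_le] at e1 e2 ⊢
      constructor <;> linarith [e1.1, e1.2, e2.1, e2.2]) ht
  have h3 : lagP (ℓ 0) 1 - 1 = 0 := by simp [lagP, h.initial]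
  rw [h3, abs_zero, zero_mul] at h2
  exact sub_eq_zero.1 (abs_nonpos_iff.1 h2)

/-- A priori bound: for a momentum of one sign, `|log η_ξ|` grows at most linearly in time. -/
theorem abs_le (h : IsLagFlow f T R ℓ) (hf : Continuous f) (hC : 0 ≤ C)
    (hfC : ∀ x, |f x| ≤ C) (hsign : (∀ x, 0 ≤ f x) ∨ ∀ x, f x ≤ 0)
    {t : ℝ} (ht : t ∈ Set.Ioo (-T) T) {ξ : ℝ} (hξ : ξ ∈ Set.Icc (0 : ℝ) 1) :
    |ℓ t ξ| ≤ 4 * |∫ z in (0 : ℝ)..1, f z| * |t| := by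
  have hT : 0 < T := by linarith [ht.1, ht.2]
  have h0 : (0 : ℝ) ∈ Set.Ioo (-T) T := ⟨by linarith, hT⟩
  have h2 := (convex_Ioo (-T) T).norm_image_sub_le_of_norm_hasDerivWithin_le
    (C := 4 * |∫ z in (0 : ℝ)..1, f z|)
    (fun τ hτ => (h.hasDerivAt τ hτ ξ hξ).hasDerivWithinAt) (fun τ hτ => by
      rw [Real.norm_eq_abs, ← h.lagN_one hf hC hfC hτ]
      exact abs_lagV_le hf (h.continuous τ) hsign (h.lagP_one hf hC hfC hτ) hξ) h0 ht
  simpa [h.initial] using h2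

end IsLagFlow

/-- Truncation of a real number to `[-R, R]`. -/
noncomputable def clamp (R x : ℝ) : ℝ := max (-R) (min R x)

theorem abs_clamp_le {R : ℝ} (hR : 0 ≤ R) (x : ℝ) : |clamp R x| ≤ R := by
  rw [abs_le]
  exact ⟨le_max_left _ _, max_le (by linarith) (min_le_left _ _)⟩

theorem clamp_of_abs_le {R x : ℝ} (h : |x| ≤ R) : clamp R x = x := by
  rw [abs_le] at h
  rw [clamp, min_eq_right h.2, max_eq_right h.1]

theorem abs_clamp_sub_le (R x y : ℝ) : |clamp R x - clamp R y| ≤ |x - y| := by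
  refine (abs_max_sub_max_le_max _ _ _ _).trans (max_le (by simp) ?_)
  exact (abs_min_sub_min_le_max _ _ _ _).trans (max_le (by simp) le_rfl)

theorem continuous_clamp (R : ℝ) : Continuous (clamp R) := by unfold clamp; fun_prop

/-- A continuous function on `[0, 1]`, truncated to `[-R, R]` and extended by constants to `ℝ`. -/
noncomputable def clampExt (R : ℝ) (l : C(Set.Icc (0 : ℝ) 1, ℝ)) (ξ : ℝ) : ℝ :=
  clamp R (l (Set.projIcc 0 1 zero_le_one ξ))

theorem continuous_clampExt (R : ℝ) (l : C(Set.Icc (0 : ℝ) 1, ℝ)) : Continuous (clampExt R l) :=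
  (continuous_clamp R).comp (l.continuous.comp continuous_projIcc)

/-- The field `lagV` with truncated argument, on the Banach space of continuous functions on
`[0, 1]`. It is bounded and globally Lipschitz. -/
noncomputable def clampField (f : ℝ → ℝ) (hf : Continuous f) (R : ℝ)
    (l : C(Set.Icc (0 : ℝ) 1, ℝ)) : C(Set.Icc (0 : ℝ) 1, ℝ) where
  toFun ξ := lagV f (clampExt R l) ξ
  continuous_toFun := (continuous_lagV hf (continuous_clampExt R l)).comp continuous_subtype_val

/-- Global existence of the Lagrangian flow for a momentum of one sign. The a priori bound shows
that the solution of the truncated equation never meets the truncation. -/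
theorem exists_isLagFlow {f : ℝ → ℝ} {C T : ℝ} (hf : Continuous f) (hC : 0 ≤ C)
    (hfC : ∀ x, |f x| ≤ C) (hsign : (∀ x, 0 ≤ f x) ∨ ∀ x, f x ≤ 0) (hT : 0 < T) :
    ∃ R ℓ, IsLagFlow f T R ℓ := by
  set c := 4 * |∫ z in (0 : ℝ)..1, f z| with hc
  have hc0 : 0 ≤ c := by positivity
  set R := c * T + 1 with hRdef
  have hR : 0 ≤ R := by positivity
  set B := C * (2 * Real.exp R ^ 2 + 2 * Real.exp R) with hB
  set K := C * (4 * Real.exp R ^ 2 + 2 * Real.exp R) with hK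
  have hB0 : 0 ≤ B := by positivity
  have hK0 : 0 ≤ K := by positivity
  have hpl : IsPicardLindelof (fun _ => clampField f hf R) (tmin := -T) (tmax := T)
      ⟨0, by linarith, hT.le⟩ (0 : C(Set.Icc (0 : ℝ) 1, ℝ)) (⟨B * T, by positivity⟩) 0
      ⟨B, hB0⟩ ⟨K, hK0⟩ := by
    refine ⟨fun t _ => LipschitzWith.lipschitzOnWith ?_, fun x _ => continuousOn_const,
      fun t _ x _ => ?_, ?_⟩
    · refine LipschitzWith.of_dist_le_mul fun l l' => ?_
      rw [dist_eq_norm, dist_eq_norm]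
      refine (ContinuousMap.norm_le _ (by positivity)).2 fun ξ => ?_
      refine abs_lagV_sub_le hf (continuous_clampExt R l) (continuous_clampExt R l') hC hfC
        (fun x => abs_clamp_le hR _) (fun x => abs_clamp_le hR _) (fun x => ?_) ξ.2
      refine (abs_clamp_sub_le R _ _).trans ?_
      exact (l - l').norm_coe_le_norm _
    · refine (ContinuousMap.norm_le _ hB0).2 fun ξ => ?_
      exact (lag_bounds hC hfC (fun x => abs_clamp_le hR _) ξ.2).2.2.2.2
    · simp only [sub_zero, zero_sub, neg_neg, max_self, NNReal.coe_zero]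
      exact le_rfl
  obtain ⟨l, hl0, hl⟩ := hpl.exists_eq_forall_mem_Icc_hasDerivWithinAt₀
  have hlc : ContinuousOn l (Set.Icc (-T) T) := fun t ht => (hl t ht).continuousWithinAt
  set ℓ : ℝ → ℝ → ℝ := fun t ξ => l t (Set.projIcc 0 1 zero_le_one ξ) with hℓ
  have hℓl : ∀ t ξ, |ℓ t ξ| ≤ ‖l t‖ := fun t ξ => (l t).norm_coe_le_norm _
  -- as long as the truncation is inactive, `ℓ` is a Lagrangian flow
  have hflow : ∀ S, S ≤ T → (∀ t ∈ Set.Ioo (-S) S, ‖l t‖ ≤ R) → IsLagFlow f S R ℓ := by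
    intro S hS hb
    refine ⟨fun t => (l t).continuous.comp continuous_projIcc,
      fun t ht ξ => (hℓl t ξ).trans (hb t ht), fun t ht ξ hξ => ?_, fun ξ => ?_⟩
    · have ht' : t ∈ Set.Icc (-T) T := ⟨by linarith [ht.1], by linarith [ht.2]⟩
      have h1 : HasDerivAt l (clampField f hf R (l t)) t :=
        (hl t ht').hasDerivAt (Icc_mem_nhds (by linarith [ht.1]) (by linarith [ht.2]))
      have h2 := (ContinuousMap.evalCLM ℝ (⟨ξ, hξ⟩ : Set.Icc (0 : ℝ) 1)).hasFDerivAt.comp_hasDerivAt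
        t h1
      have h3 : clampExt R (l t) = ℓ t := by
        ext x
        exact clamp_of_abs_le ((hℓl t x).trans (hb t ht))
      have h4 : ContinuousMap.evalCLM ℝ (⟨ξ, hξ⟩ : Set.Icc (0 : ℝ) 1)
          (clampField f hf R (l t)) = lagV f (ℓ t) ξ := by
        rw [← h3]; rfl
      rw [h4] at h2
      refine h2.congr_of_eventuallyEq (Filter.Eventually.of_forall fun τ => ?_)
      simp only [hℓ, Function.comp_apply, Set.projIcc_of_mem zero_le_one hξ]
      rfl
    · simp only [hℓ]
      have : l 0 = 0 := hl0
      rw [this]; rfl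
  have hapr : ∀ S, S ≤ T → (∀ t ∈ Set.Ioo (-S) S, ‖l t‖ ≤ R) →
      ∀ t ∈ Set.Ioo (-S) S, ‖l t‖ ≤ c * |t| := by
    intro S hS hb t ht
    refine (ContinuousMap.norm_le _ (by positivity)).2 fun ξ => ?_
    have h1 := (hflow S hS hb).abs_le hf hC hfC hsign ht ξ.2
    simp only [hℓ, Set.projIcc_val] at h1
    exact h1
  refine ⟨R, ℓ, hflow T le_rfl ?_⟩
  by_contra hcon
  push Not at hcon
  obtain ⟨t₁, ht₁, hbig⟩ := hcon
  -- the first time at which the truncation is active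
  set μ : ℝ → ℝ := fun t => max ‖l t‖ ‖l (-t)‖ with hμ
  have hneg : Set.MapsTo (fun t : ℝ => -t) (Set.Icc 0 T) (Set.Icc (-T) T) := fun t ht =>
    ⟨by linarith [ht.2], by linarith [ht.1]⟩
  have hsub : Set.Icc 0 T ⊆ Set.Icc (-T) T := Set.Icc_subset_Icc_left (by linarith)
  have hμc : ContinuousOn μ (Set.Icc 0 T) :=
    ContinuousOn.sup (hlc.mono hsub).norm (hlc.comp continuousOn_neg hneg).norm
  set Z := {t ∈ Set.Icc 0 T | R ≤ μ t} with hZ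
  have hZc : IsCompact Z := by
    refine isCompact_Icc.of_isClosed_subset ?_ (fun t ht => ht.1)
    exact ContinuousOn.preimage_isClosed_of_isClosed hμc isClosed_Icc isClosed_Ici
  have hZne : Z.Nonempty := by
    refine ⟨|t₁|, ⟨abs_nonneg _, (abs_lt.2 ht₁).le⟩, ?_⟩
    rcases le_total 0 t₁ with h | h
    · rw [abs_of_nonneg h]; exact hbig.le.trans (le_max_left _ _)
    · rw [abs_of_nonpos h]
      refine hbig.le.trans ?_
      simp only [hμ, neg_neg]; exact le_max_right _ _
  obtain ⟨S, ⟨hS, hSR⟩, hSmin⟩ := hZc.exists_isLeast hZne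
  have hlt : ∀ t ∈ Set.Ioo (-S) S, ‖l t‖ ≤ R := by
    intro t ht
    by_contra hgt
    push Not at hgt
    have h1 : |t| ∈ Z := by
      refine ⟨⟨abs_nonneg _, (abs_lt.2 ht).le.trans hS.2⟩, ?_⟩
      rcases le_total 0 t with h | h
      · rw [abs_of_nonneg h]; exact hgt.le.trans (le_max_left _ _)
      · rw [abs_of_nonpos h]
        refine hgt.le.trans ?_
        simp only [hμ, neg_neg]; exact le_max_right _ _
    exact absurd (hSmin h1) (not_le.2 (abs_lt.2 ht))
  have hbd := hapr S hS.2 hlt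
  have hS0 : 0 < S := by
    rcases hS.1.eq_or_lt with h | h
    · exfalso
      have h2 : l 0 = 0 := hl0
      rw [← h] at hSR
      simp only [hμ, neg_zero, h2, norm_zero, max_self] at hSR
      have : 0 ≤ c * T := by positivity
      linarith
    · exact h
  have hμS : μ S ≤ c * S := by
    have h1 : Filter.Tendsto μ (nhdsWithin S (Set.Ico 0 S)) (nhds (μ S)) :=
      (hμc S hS).mono (fun t ht => ⟨ht.1, ht.2.le.trans hS.2⟩)
    have hne : (nhdsWithin S (Set.Ico 0 S)).NeBot := by
      rw [← mem_closure_iff_nhdsWithin_neBot, closure_Ico hS0.ne]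
      exact ⟨hS.1, le_rfl⟩
    refine le_of_tendsto h1 ?_
    filter_upwards [self_mem_nhdsWithin] with t ht
    have h2 := hbd t ⟨by linarith [ht.1], ht.2⟩
    have h3 := hbd (-t) ⟨by linarith [ht.2], by linarith [ht.1]⟩
    rw [abs_neg] at h3
    rw [abs_of_nonneg ht.1] at h2 h3
    refine (max_le h2 h3).trans ?_
    have := ht.2
    gcongr
  have : c * S ≤ c * T := by gcongr; exact hS.2
  linarith

/-! ### From the Lagrangian flow to the momentum equation -/

/-- The character `x ↦ e^{2πikx}`. -/
noncomputable def chr (k : ℤ) (x : ℝ) : ℂ := Complex.exp (2 * Real.pi * Complex.I * k * x)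

theorem chr_add_left (k l : ℤ) (x : ℝ) : chr (k + l) x = chr k x * chr l x := by
  rw [chr, chr, chr, ← Complex.exp_add]; push_cast; ring_nf

theorem chr_add_right (k : ℤ) (x y : ℝ) : chr k (x + y) = chr k x * chr k y := by
  rw [chr, chr, chr, ← Complex.exp_add]; push_cast; ring_nf

theorem chr_zero (x : ℝ) : chr 0 x = 1 := by simp [chr]

theorem chr_zero_right (k : ℤ) : chr k 0 = 1 := by simp [chr]

theorem chr_one (k : ℤ) : chr k 1 = 1 := by
  rw [chr, Complex.exp_eq_one_iff]
  exact ⟨k, by push_cast; ring⟩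

theorem norm_chr (k : ℤ) (x : ℝ) : ‖chr k x‖ = 1 := by
  have h : (2 * Real.pi * Complex.I * k * x : ℂ) = ((2 * Real.pi * k * x : ℝ) : ℂ) * Complex.I := by
    push_cast; ring
  rw [chr, h, Complex.norm_exp_ofReal_mul_I]

theorem conj_chr (k : ℤ) (x : ℝ) : conj (chr k x) = chr (-k) x := by
  rw [chr, chr, ← Complex.exp_conj]
  congr 1
  simp [Complex.conj_ofNat]

theorem continuous_chr (k : ℤ) : Continuous (chr k) := by unfold chr; fun_prop

theorem hasDerivAt_chr {φ : ℝ → ℝ} {φ' x : ℝ} (k : ℤ) (h : HasDerivAt φ φ' x) :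
    HasDerivAt (fun y => chr k (φ y)) (2 * Real.pi * Complex.I * k * φ' * chr k (φ x)) x := by
  refine ((h.ofReal_comp.const_mul (2 * Real.pi * Complex.I * k : ℂ)).cexp).congr_deriv ?_
  rw [chr]; ring

theorem summable_inv_symb : Summable fun j : ℤ => 1 / symb j := by
  refine Summable.of_nonneg_of_le (fun j => one_div_nonneg.2 (symb_pos j).le) (fun j => ?_)
    ((summable_bracket (s := -2) (by norm_num)).mul_left 2)
  rw [div_le_iff₀ (symb_pos j)]
  have h1 := bracket_le_two_symb j
  have h2 := bracket_neg_exp_mul 2 j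
  have h3 := bracket_pos (-2) j
  nlinarith

/-- The Fourier series of the Green function of `A = μ - ∂ₓ²`. -/
theorem hasSum_green {y : ℝ} (hy : |y| ≤ 1) :
    HasSum (fun j : ℤ => (1 / symb j : ℂ) * chr j y)
      ((1 / 2 * y ^ 2 - 1 / 2 * |y| + 13 / 12 : ℝ) : ℂ) := by
  have key : ∀ x ∈ Set.Icc (0 : ℝ) 1, HasSum (fun j : ℤ => (1 / symb j : ℂ) * chr j x)
      ((1 / 2 * x ^ 2 - 1 / 2 * x + 13 / 12 : ℝ) : ℂ) := by
    intro x hx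
    have h1 := (hasSum_one_div_pow_mul_fourier_mul_bernoulliFun le_rfl hx).mul_left
      (1 / (2 * Real.pi : ℂ) ^ 2)
    have h2 := h1.add (hasSum_ite_eq (0 : ℤ) (1 : ℂ))
    have hpi : (Real.pi : ℂ) ≠ 0 := by exact_mod_cast Real.pi_ne_zero
    convert! h2 using 1
    · ext j
      by_cases hj : j = 0
      · subst hj; simp [symb_zero, chr_zero]
      · have hj' : (j : ℂ) ≠ 0 := by exact_mod_cast hj
        rw [if_neg hj, symb_of_ne hj, fourier_coe_apply, chr]
        push_cast
        rw [div_one]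
        field_simp
        ring
    · rw [bernoulliFun_two]
      have e : (2 * Real.pi * Complex.I : ℂ) ^ 2 = -(2 * Real.pi) ^ 2 := by
        rw [mul_pow, Complex.I_sq]; ring
      push_cast
      rw [e]
      simp only [Nat.factorial]
      push_cast
      field_simp
      ring
  rcases le_total 0 y with h | h
  · rw [abs_of_nonneg h] at hy ⊢
    exact key y ⟨h, hy⟩
  · rw [abs_of_nonpos h] at hy ⊢
    have h1 := key (-y) ⟨by linarith, hy⟩
    have h2 := (Equiv.neg ℤ).hasSum_iff.2 h1
    rw [neg_sq] at h2
    refine h2.congr_fun fun j => ?_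
    simp only [Function.comp_apply, Equiv.neg_apply, symb_neg, chr]
    push_cast
    ring_nf

theorem hasSum_intervalIntegral {F : ℤ → ℝ → ℂ} {g : ℝ → ℂ} {b : ℤ → ℝ} (hF : ∀ j, Continuous (F j))
    (hb : Summable b) (hFb : ∀ j, ∀ z ∈ Set.Icc (0 : ℝ) 1, ‖F j z‖ ≤ b j)
    (hs : ∀ z ∈ Set.Ioo (0 : ℝ) 1, HasSum (fun j => F j z) (g z)) :
    HasSum (fun j => ∫ z in (0 : ℝ)..1, F j z) (∫ z in (0 : ℝ)..1, g z) := by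
  refine intervalIntegral.hasSum_integral_of_dominated_convergence (fun j _ => b j)
    (fun j => (hF j).aestronglyMeasurable) (fun j => Filter.Eventually.of_forall fun z hz => ?_)
    (Filter.Eventually.of_forall fun _ _ => hb) intervalIntegrable_const ?_
  · rw [Set.uIoc_of_le zero_le_one] at hz
    exact hFb j z ⟨hz.1.le, hz.2⟩
  · filter_upwards [compl_mem_ae_iff.2 (measure_singleton (1 : ℝ))] with z hz1 hz
    rw [Set.uIoc_of_le zero_le_one] at hz
    exact hs z ⟨hz.1, lt_of_le_of_ne hz.2 hz1⟩

/-- The Fourier coefficients of the momentum, in Lagrangian coordinates. -/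
noncomputable def lagM (f ℓ : ℝ → ℝ) (c : ℝ) (k : ℤ) : ℂ :=
  ∫ z in (0 : ℝ)..1, (lagq f ℓ z : ℂ) * chr (-k) (c + lagP ℓ z)

section Static

variable {f ℓ : ℝ → ℝ} {c R C : ℝ}

theorem lagM_neg (k : ℤ) : lagM f ℓ c (-k) = conj (lagM f ℓ c k) := by
  rw [lagM, lagM, intervalIntegral.integral_of_le zero_le_one,
    intervalIntegral.integral_of_le zero_le_one, ← integral_conj]
  refine integral_congr_ae (Filter.Eventually.of_forall fun z => ?_)
  simp only
  rw [map_mul, Complex.conj_ofReal, conj_chr]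

/-- Bessel's inequality: the functions `e^{2πikη}` are orthonormal for the weight `η_ξ`. -/
theorem sum_norm_lagM_sq_le (hf : Continuous f) (hℓ : Continuous ℓ) (hM : lagP ℓ 1 = 1)
    (S : Finset ℤ) : ∑ k ∈ S, ‖lagM f ℓ c k‖ ^ 2 ≤
      ∫ z in (0 : ℝ)..1, lagq f ℓ z ^ 2 * Real.exp (-ℓ z) := by
  have hPc := continuous_lagP hℓ
  have hqc := continuous_lagq hf hℓ
  set e : ℤ → ℝ → ℂ := fun k z => chr k (c + lagP ℓ z) with he
  have hec : ∀ k, Continuous (e k) := fun k => (continuous_chr k).comp (continuous_const.add hPc)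
  have horth : ∀ n : ℤ, ∫ z in (0 : ℝ)..1, e n z * (Real.exp (ℓ z) : ℂ) = if n = 0 then 1 else 0 := by
    intro n
    have hr : Continuous fun z => (Real.exp (ℓ z) : ℂ) :=
      Complex.continuous_ofReal.comp (Real.continuous_exp.comp hℓ)
    split_ifs with hn
    · subst hn
      have h1 : ∀ z, e 0 z * (Real.exp (ℓ z) : ℂ) = ((Real.exp (ℓ z) : ℝ) : ℂ) := fun z => by
        simp [he, chr_zero]
      simp_rw [h1]
      rw [intervalIntegral.integral_ofReal]
      change ((lagP ℓ 1 : ℝ) : ℂ) = 1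
      rw [hM, Complex.ofReal_one]
    · have hn' : (2 * Real.pi * Complex.I * n : ℂ) ≠ 0 := by
        have : (n : ℂ) ≠ 0 := by exact_mod_cast hn
        simp [this, Complex.I_ne_zero, Real.pi_ne_zero]
      have h1 := intervalIntegral.integral_eq_sub_of_hasDerivAt (a := 0) (b := 1)
        (f := fun z => e n z) (f' := fun z => 2 * Real.pi * Complex.I * n *
          (Real.exp (ℓ z) : ℂ) * e n z)
        (fun z _ => hasDerivAt_chr n ((hasDerivAt_lagP hℓ z).const_add c))
        (Continuous.intervalIntegrable (by fun_prop) 0 1)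
      have h2 : e n 1 - e n 0 = 0 := by
        simp only [he, hM, lagP_zero, chr_zero_right, chr_add_right, chr_one, mul_one, sub_self]
      rw [h2] at h1
      have h3 : ∀ z, 2 * Real.pi * Complex.I * n * (Real.exp (ℓ z) : ℂ) * e n z =
          (2 * Real.pi * Complex.I * n) * (e n z * (Real.exp (ℓ z) : ℂ)) := fun z => by ring
      simp_rw [h3] at h1
      rw [intervalIntegral.integral_const_mul] at h1
      exact (mul_eq_zero.1 h1).resolve_left hn'
  set m := lagM f ℓ c with hm
  set g : ℝ → ℂ := fun z => ∑ k ∈ S, m k * e k z with hg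
  have hgc : Continuous g := by
    simp only [hg]
    exact continuous_finsetSum _ fun k _ => continuous_const.mul (hec k)
  -- the projection onto the span of the characters
  have hpos : 0 ≤ ∫ z in (0 : ℝ)..1,
      ‖(lagq f ℓ z * Real.exp (-ℓ z) : ℝ) - g z‖ ^ 2 * Real.exp (ℓ z) :=
    intervalIntegral.integral_nonneg zero_le_one fun z _ => by positivity
  have hexp : ∀ z, ((‖((lagq f ℓ z * Real.exp (-ℓ z) : ℝ) : ℂ) - g z‖ ^ 2 * Real.exp (ℓ z) : ℝ) : ℂ)
      = ((lagq f ℓ z ^ 2 * Real.exp (-ℓ z) : ℝ) : ℂ)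
        - (∑ k ∈ S, conj (m k) * ((lagq f ℓ z : ℂ) * e (-k) z))
        - (∑ k ∈ S, m k * ((lagq f ℓ z : ℂ) * e k z))
        + ∑ k ∈ S, ∑ l ∈ S, m k * conj (m l) * (e (k - l) z * (Real.exp (ℓ z) : ℂ)) := by
    intro z
    have e1 : (Real.exp (-ℓ z) : ℂ) * (Real.exp (ℓ z) : ℂ) = 1 := by
      rw [← Complex.ofReal_mul, ← Real.exp_add, neg_add_cancel, Real.exp_zero, Complex.ofReal_one]
    have e2 : ∑ k ∈ S, ∑ l ∈ S, m k * conj (m l) * (e (k - l) z * (Real.exp (ℓ z) : ℂ)) =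
        g z * conj (g z) * (Real.exp (ℓ z) : ℂ) := by
      simp only [hg]
      rw [map_sum, Finset.sum_mul_sum, Finset.sum_mul]
      refine Finset.sum_congr rfl fun k _ => ?_
      rw [Finset.sum_mul]
      refine Finset.sum_congr rfl fun l _ => ?_
      simp only [he, sub_eq_add_neg, chr_add_left, map_mul, conj_chr]
      ring
    have e3 : ∑ k ∈ S, conj (m k) * ((lagq f ℓ z : ℂ) * e (-k) z) =
        (lagq f ℓ z : ℂ) * conj (g z) := by
      simp only [hg]
      rw [map_sum, Finset.mul_sum]
      refine Finset.sum_congr rfl fun k _ => ?_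
      simp only [he, map_mul, conj_chr]
      ring
    have e4 : ∑ k ∈ S, m k * ((lagq f ℓ z : ℂ) * e k z) = (lagq f ℓ z : ℂ) * g z := by
      simp only [hg]
      rw [Finset.mul_sum]
      exact Finset.sum_congr rfl fun k _ => by ring
    rw [e2, e3, e4, Complex.ofReal_mul, ← Complex.normSq_eq_norm_sq, Complex.normSq_eq_conj_mul_self,
      map_sub, Complex.conj_ofReal]
    simp only [Complex.ofReal_mul, Complex.ofReal_pow]
    linear_combination ((lagq f ℓ z : ℂ) ^ 2 * (Real.exp (-ℓ z) : ℂ) - (lagq f ℓ z : ℂ) * g z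
      - (lagq f ℓ z : ℂ) * conj (g z)) * e1
  have hint : ((∫ z in (0 : ℝ)..1, ‖((lagq f ℓ z * Real.exp (-ℓ z) : ℝ) : ℂ) - g z‖ ^ 2 *
      Real.exp (ℓ z) : ℝ) : ℂ) = ((∫ z in (0 : ℝ)..1, lagq f ℓ z ^ 2 * Real.exp (-ℓ z) : ℝ) : ℂ)
        - ((∑ k ∈ S, ‖m k‖ ^ 2 : ℝ) : ℂ) := by
    have hqe : ∀ k, Continuous fun z => (lagq f ℓ z : ℂ) * e k z := fun k =>
      (Complex.continuous_ofReal.comp hqc).mul (hec k)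
    have hre : ∀ k, Continuous fun z => e k z * (Real.exp (ℓ z) : ℂ) := fun k =>
      (hec k).mul (Complex.continuous_ofReal.comp (Real.continuous_exp.comp hℓ))
    have i1 : IntervalIntegrable (fun z => ((lagq f ℓ z ^ 2 * Real.exp (-ℓ z) : ℝ) : ℂ))
        volume 0 1 := Continuous.intervalIntegrable (by fun_prop) 0 1
    have i2 : IntervalIntegrable (fun z => ∑ k ∈ S, conj (m k) * ((lagq f ℓ z : ℂ) * e (-k) z))
        volume 0 1 := (continuous_finsetSum _ fun k _ =>
          continuous_const.mul (hqe (-k))).intervalIntegrable 0 1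
    have i3 : IntervalIntegrable (fun z => ∑ k ∈ S, m k * ((lagq f ℓ z : ℂ) * e k z))
        volume 0 1 := (continuous_finsetSum _ fun k _ =>
          continuous_const.mul (hqe k)).intervalIntegrable 0 1
    have i4 : IntervalIntegrable (fun z => ∑ k ∈ S, ∑ l ∈ S, m k * conj (m l) *
        (e (k - l) z * (Real.exp (ℓ z) : ℂ))) volume 0 1 :=
      (continuous_finsetSum _ fun k _ => continuous_finsetSum _ fun l _ =>
        continuous_const.mul (hre (k - l))).intervalIntegrable 0 1
    have j1 : ∀ k ∈ S, IntervalIntegrable (fun z => conj (m k) * ((lagq f ℓ z : ℂ) * e (-k) z))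
        volume 0 1 := fun k _ => (continuous_const.mul (hqe (-k))).intervalIntegrable 0 1
    have j2 : ∀ k ∈ S, IntervalIntegrable (fun z => m k * ((lagq f ℓ z : ℂ) * e k z))
        volume 0 1 := fun k _ => (continuous_const.mul (hqe k)).intervalIntegrable 0 1
    have j4 : ∀ k, ∀ l ∈ S, IntervalIntegrable (fun z => m k * conj (m l) *
        (e (k - l) z * (Real.exp (ℓ z) : ℂ))) volume 0 1 := fun k l _ =>
      (continuous_const.mul (hre (k - l))).intervalIntegrable 0 1
    have j3 : ∀ k ∈ S, IntervalIntegrable (fun z => ∑ l ∈ S, m k * conj (m l) *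
        (e (k - l) z * (Real.exp (ℓ z) : ℂ))) volume 0 1 := fun k _ =>
      (continuous_finsetSum _ fun l _ =>
        continuous_const.mul (hre (k - l))).intervalIntegrable 0 1
    rw [← intervalIntegral.integral_ofReal]
    simp_rw [hexp]
    rw [intervalIntegral.integral_add ((i1.sub i2).sub i3) i4,
      intervalIntegral.integral_sub (i1.sub i2) i3, intervalIntegral.integral_sub i1 i2,
      intervalIntegral.integral_ofReal,
      intervalIntegral.integral_finsetSum j1, intervalIntegral.integral_finsetSum j2,
      intervalIntegral.integral_finsetSum j3]
    have s1 : ∑ k ∈ S, ∫ z in (0 : ℝ)..1, conj (m k) * ((lagq f ℓ z : ℂ) * e (-k) z) =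
        ((∑ k ∈ S, ‖m k‖ ^ 2 : ℝ) : ℂ) := by
      rw [Complex.ofReal_sum]
      refine Finset.sum_congr rfl fun k _ => ?_
      rw [intervalIntegral.integral_const_mul, ← Complex.normSq_eq_norm_sq,
        Complex.normSq_eq_conj_mul_self]
      rfl
    have s2 : ∑ k ∈ S, ∫ z in (0 : ℝ)..1, m k * ((lagq f ℓ z : ℂ) * e k z) =
        ((∑ k ∈ S, ‖m k‖ ^ 2 : ℝ) : ℂ) := by
      rw [Complex.ofReal_sum]
      refine Finset.sum_congr rfl fun k _ => ?_
      rw [intervalIntegral.integral_const_mul, ← Complex.normSq_eq_norm_sq,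
        Complex.normSq_eq_conj_mul_self, mul_comm (conj (m k)), hm, ← lagM_neg]
      congr 1
      rw [lagM, neg_neg]
    have s3 : ∑ k ∈ S, ∫ z in (0 : ℝ)..1, ∑ l ∈ S, m k * conj (m l) *
        (e (k - l) z * (Real.exp (ℓ z) : ℂ)) = ((∑ k ∈ S, ‖m k‖ ^ 2 : ℝ) : ℂ) := by
      rw [Complex.ofReal_sum]
      refine Finset.sum_congr rfl fun k hk => ?_
      rw [intervalIntegral.integral_finsetSum (j4 k)]
      simp_rw [intervalIntegral.integral_const_mul, horth, sub_eq_zero]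
      rw [← Complex.normSq_eq_norm_sq, Complex.normSq_eq_conj_mul_self]
      simp [hk, mul_comm]
    rw [s1, s2, s3]
    ring
  have hint' : (∫ z in (0 : ℝ)..1, ‖((lagq f ℓ z * Real.exp (-ℓ z) : ℝ) : ℂ) - g z‖ ^ 2 *
      Real.exp (ℓ z)) = (∫ z in (0 : ℝ)..1, lagq f ℓ z ^ 2 * Real.exp (-ℓ z)) -
        ∑ k ∈ S, ‖m k‖ ^ 2 := by exact_mod_cast hint
  rw [hint'] at hpos
  linarith

theorem lagM_summable_sq (hf : Continuous f) (hℓ : Continuous ℓ) (hM : lagP ℓ 1 = 1)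
    (hC : 0 ≤ C) (hfC : ∀ x, |f x| ≤ C) (hR : ∀ x, |ℓ x| ≤ R) :
    (Summable fun k => ‖lagM f ℓ c k‖ ^ 2) ∧
      ∑' k, ‖lagM f ℓ c k‖ ^ 2 ≤ (C * Real.exp R) ^ 2 * Real.exp R := by
  have hb : ∀ S : Finset ℤ, ∑ k ∈ S, ‖lagM f ℓ c k‖ ^ 2 ≤
      (C * Real.exp R) ^ 2 * Real.exp R := by
    intro S
    refine (sum_norm_lagM_sq_le hf hℓ hM S).trans ((le_abs_self _).trans ?_)
    refine abs_integral_le_of_abs_le (by positivity) ⟨zero_le_one, le_rfl⟩ fun z hz => ?_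
    rw [abs_mul, abs_pow, abs_of_pos (Real.exp_pos _)]
    have h1 := (lag_bounds hC hfC hR hz).2.1
    gcongr
    linarith [(abs_le.1 (hR z)).1]
  have hs := summable_of_sum_le (fun k => sq_nonneg _) hb
  exact ⟨hs, hs.tsum_le_of_sum_le hb⟩

theorem monotone_lagP (hℓ : Continuous ℓ) : Monotone (lagP ℓ) :=
  monotone_of_deriv_nonneg (fun x => (hasDerivAt_lagP hℓ x).differentiableAt)
    fun x => by rw [(hasDerivAt_lagP hℓ x).deriv]; exact (Real.exp_pos _).le

/-- The velocity at a particle is the integral of the Green function against the momentum. -/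
theorem lagG_add_lagU (hf : Continuous f) (hℓ : Continuous ℓ) {ξ : ℝ}
    (hξ : ξ ∈ Set.Icc (0 : ℝ) 1) :
    ∫ z in (0 : ℝ)..1, lagq f ℓ z * (1 / 2 * (lagP ℓ ξ - lagP ℓ z) ^ 2 -
      1 / 2 * |lagP ℓ ξ - lagP ℓ z| + 13 / 12) = lagG f ℓ ξ + lagU f ℓ := by
  have hPc := continuous_lagP hℓ
  have hqc := continuous_lagq hf hℓ
  set x := lagP ℓ ξ with hx
  have hR2 : ∀ z, HasDerivAt (fun y => ∫ z in (0 : ℝ)..y, lagP ℓ z ^ 2 * lagq f ℓ z)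
      (lagP ℓ z ^ 2 * lagq f ℓ z) z := fun z => hasDerivAt_primitive (by fun_prop) z
  set R2 : ℝ → ℝ := fun y => ∫ z in (0 : ℝ)..y, lagP ℓ z ^ 2 * lagq f ℓ z with hR2def
  have hR20 : R2 0 = 0 := by simp [hR2def]
  have hsplit : ∀ (σ a b : ℝ), (∀ z ∈ Set.uIcc a b, |x - lagP ℓ z| = σ * (x - lagP ℓ z)) →
      ∫ z in a..b, lagq f ℓ z * (1 / 2 * (x - lagP ℓ z) ^ 2 -
        1 / 2 * |x - lagP ℓ z| + 13 / 12) =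
      (1 / 2 * x ^ 2 - σ / 2 * x + 13 / 12) * (lagN f ℓ b - lagN f ℓ a)
        + (σ / 2 - x) * (lagQ f ℓ b - lagQ f ℓ a) + 1 / 2 * (R2 b - R2 a) := by
    intro σ a b hσ
    have h1 : ∫ z in a..b, lagq f ℓ z * (1 / 2 * (x - lagP ℓ z) ^ 2 -
        1 / 2 * |x - lagP ℓ z| + 13 / 12) = ∫ z in a..b, lagq f ℓ z *
          (1 / 2 * (x - lagP ℓ z) ^ 2 - 1 / 2 * (σ * (x - lagP ℓ z)) + 13 / 12) :=
      intervalIntegral.integral_congr fun z hz => by rw [hσ z hz]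
    rw [h1, intervalIntegral.integral_eq_sub_of_hasDerivAt
      (f := fun z => (1 / 2 * x ^ 2 - σ / 2 * x + 13 / 12) * lagN f ℓ z
        + (σ / 2 - x) * lagQ f ℓ z + 1 / 2 * R2 z) (fun z _ => ?_)
      (Continuous.intervalIntegrable (by fun_prop) a b)]
    · ring
    · refine ((((hasDerivAt_lagN hf hℓ z).const_mul _).add
        ((hasDerivAt_lagQ hf hℓ z).const_mul _)).add ((hR2 z).const_mul _)).congr_deriv ?_
      ring
  have hcont : Continuous fun z => lagq f ℓ z * (1 / 2 * (x - lagP ℓ z) ^ 2 -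
      1 / 2 * |x - lagP ℓ z| + 13 / 12) := by fun_prop
  have hmono := monotone_lagP hℓ
  rw [← intervalIntegral.integral_add_adjacent_intervals (hcont.intervalIntegrable 0 ξ)
    (hcont.intervalIntegrable ξ 1), hsplit 1 0 ξ fun z hz => ?_, hsplit (-1) ξ 1 fun z hz => ?_,
    lagN_zero, lagQ_zero, hR20]
  · simp only [lagG, lagU]
    ring
  · rw [Set.uIcc_of_le hξ.2] at hz
    rw [abs_of_nonpos (sub_nonpos.2 (hmono hz.1))]
    ring
  · rw [Set.uIcc_of_le hξ.1] at hz
    rw [abs_of_nonneg (sub_nonneg.2 (hmono hz.2)), one_mul]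

theorem chr_sub_right (k : ℤ) (x y : ℝ) : chr k (x - y) = chr k x * chr (-k) y := by
  rw [chr, chr, chr, ← Complex.exp_add]; push_cast; ring_nf

/-- The Fourier series of the velocity, evaluated along the flow. -/
theorem hasSum_vel_lagM (hf : Continuous f) (hℓ : Continuous ℓ) (hM : lagP ℓ 1 = 1)
    (hC : 0 ≤ C) (hfC : ∀ x, |f x| ≤ C) (hR : ∀ x, |ℓ x| ≤ R) {ξ : ℝ}
    (hξ : ξ ∈ Set.Icc (0 : ℝ) 1) :
    HasSum (fun j => vel (lagM f ℓ c) j * chr j (c + lagP ℓ ξ))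
      ((lagG f ℓ ξ + lagU f ℓ : ℝ) : ℂ) := by
  have hPc := continuous_lagP hℓ
  have hqc := continuous_lagq hf hℓ
  have hmono := monotone_lagP hℓ
  have hP01 : ∀ z ∈ Set.Icc (0 : ℝ) 1, 0 ≤ lagP ℓ z ∧ lagP ℓ z ≤ 1 := fun z hz =>
    ⟨by rw [← lagP_zero (ℓ := ℓ)]; exact hmono hz.1, by rw [← hM]; exact hmono hz.2⟩
  have hb0 : 0 ≤ C * Real.exp R := by positivity
  have h1 := hasSum_intervalIntegral
    (F := fun j z => (lagq f ℓ z : ℂ) * ((1 / symb j : ℂ) * chr j (lagP ℓ ξ - lagP ℓ z)))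
    (g := fun z => ((lagq f ℓ z * (1 / 2 * (lagP ℓ ξ - lagP ℓ z) ^ 2 -
      1 / 2 * |lagP ℓ ξ - lagP ℓ z| + 13 / 12) : ℝ) : ℂ))
    (b := fun j => C * Real.exp R * (1 / symb j))
    (fun j => (Complex.continuous_ofReal.comp hqc).mul (continuous_const.mul
      ((continuous_chr j).comp (continuous_const.sub hPc))))
    (summable_inv_symb.mul_left _) (fun j z hz => ?_) (fun z hz => ?_)
  · rw [intervalIntegral.integral_ofReal, lagG_add_lagU hf hℓ hξ] at h1
    refine h1.congr_fun fun j => ?_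
    rw [vel, lagM, div_eq_mul_inv, mul_assoc, mul_comm, ← intervalIntegral.integral_const_mul]
    refine intervalIntegral.integral_congr fun z _ => ?_
    have e : lagP ℓ ξ - lagP ℓ z = (c + lagP ℓ ξ) - (c + lagP ℓ z) := by ring
    rw [e, chr_sub_right, one_div]
    ring
  · rw [norm_mul, norm_mul, norm_chr, mul_one, Complex.norm_real, norm_div, norm_one,
      Complex.norm_real, Real.norm_of_nonneg (symb_pos j).le]
    exact mul_le_mul_of_nonneg_right (lag_bounds hC hfC hR hz).2.1
      (one_div_nonneg.2 (symb_pos j).le)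
  · rw [Complex.ofReal_mul]
    refine (hasSum_green ?_).mul_left _
    have a1 := hP01 ξ hξ
    have a2 := hP01 z ⟨hz.1.le, hz.2.le⟩
    rw [abs_le]
    constructor <;> linarith [a1.1, a1.2, a2.1, a2.2]

theorem summable_bracket_one_vel {m : ℤ → ℂ} (hm : Summable fun k => ‖m k‖ ^ 2) :
    Summable fun k => bracket 1 k * ‖vel m k‖ := by
  have h1 : Summable fun k => bracket (-1) k * ‖m k‖ := by
    refine summable_mul_of_sq ?_ hm
    refine (summable_bracket (s := -2) (by norm_num)).congr fun k => ?_
    rw [sq, ← bracket_add]; norm_num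
  refine Summable.of_nonneg_of_le (fun k => mul_nonneg (bracket_pos _ _).le (norm_nonneg _))
    (fun k => ?_) (h1.mul_left 2)
  have h2 := mul_le_mul_of_nonneg_left (norm_vel_le m k) (bracket_pos 1 k).le
  refine h2.trans_eq ?_
  have h3 : bracket (-1) k = bracket 1 k * bracket (-2) k := by rw [← bracket_add]; norm_num
  rw [h3]; ring

/-- The Fourier series of `u_x`, evaluated along the flow. -/
theorem hasSum_deriv_vel_lagM (hf : Continuous f) (hℓ : Continuous ℓ) (hM : lagP ℓ 1 = 1)
    (hC : 0 ≤ C) (hfC : ∀ x, |f x| ≤ C) (hR : ∀ x, |ℓ x| ≤ R) {ξ : ℝ}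
    (hξ : ξ ∈ Set.Ioo (0 : ℝ) 1) :
    HasSum (fun j => vel (lagM f ℓ c) j * (2 * Real.pi * Complex.I * j) * chr j (c + lagP ℓ ξ))
      ((lagV f ℓ ξ : ℝ) : ℂ) := by
  have hsum := summable_bracket_one_vel
    (lagM_summable_sq (c := c) hf hℓ hM hC hfC hR).1
  set v := vel (lagM f ℓ c) with hv
  have hterm : ∀ (j : ℤ) (x : ℝ), ‖v j * (2 * Real.pi * Complex.I * j) * chr j x‖ ≤
      2 * Real.pi * (bracket 1 j * ‖v j‖) := by
    intro j x
    rw [norm_mul, norm_mul, norm_chr, norm_mul, norm_mul, norm_mul, Complex.norm_I,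
      Complex.norm_real, Real.norm_of_nonneg Real.pi_pos.le, Complex.norm_ofNat, mul_one, mul_one,
      Complex.norm_intCast]
    have := abs_le_bracket_one j
    have h0 := norm_nonneg (v j)
    have h1 := Real.pi_pos
    calc _ = 2 * Real.pi * (|(j : ℝ)| * ‖v j‖) := by ring
      _ ≤ _ := by gcongr
  have hd := hasDerivAt_tsum (g := fun j y => v j * chr j (c + lagP ℓ y))
    (g' := fun j y => v j * (2 * Real.pi * Complex.I * j * (Real.exp (ℓ y) : ℂ) *
      chr j (c + lagP ℓ y)))
    (u := fun j => Real.exp R * (2 * Real.pi * (bracket 1 j * ‖v j‖)))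
    ((hsum.mul_left _).mul_left _)
    (fun j y => (hasDerivAt_chr j ((hasDerivAt_lagP hℓ y).const_add c)).const_mul _)
    (fun j y => by
      have e : v j * (2 * Real.pi * Complex.I * j * (Real.exp (ℓ y) : ℂ) * chr j (c + lagP ℓ y)) =
        (Real.exp (ℓ y) : ℂ) * (v j * (2 * Real.pi * Complex.I * j) * chr j (c + lagP ℓ y)) := by
        ring
      rw [e, norm_mul, Complex.norm_real, Real.norm_of_nonneg (Real.exp_pos _).le]
      exact mul_le_mul (Real.exp_le_exp.2 (abs_le.1 (hR y)).2) (hterm j _) (norm_nonneg _)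
        (Real.exp_pos _).le)
    (y₀ := ξ) (hasSum_vel_lagM hf hℓ hM hC hfC hR ⟨hξ.1.le, hξ.2.le⟩).summable ξ
  have hd2 := ((hasDerivAt_lagG hf hℓ ξ).add_const (lagU f ℓ)).ofReal_comp
  have heq : (fun y => ∑' j, v j * chr j (c + lagP ℓ y)) =ᶠ[nhds ξ]
      fun y => ((lagG f ℓ y + lagU f ℓ : ℝ) : ℂ) := by
    filter_upwards [isOpen_Ioo.mem_nhds hξ] with y hy
    exact (hasSum_vel_lagM hf hℓ hM hC hfC hR ⟨hy.1.le, hy.2.le⟩).tsum_eq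
  have hu := (hd2.congr_of_eventuallyEq heq).unique hd
  have hs : Summable fun j => v j * (2 * Real.pi * Complex.I * j) * chr j (c + lagP ℓ ξ) :=
    Summable.of_norm_bounded (hsum.mul_left _) fun j => hterm j _
  have he : (Real.exp (ℓ ξ) : ℂ) ≠ 0 := by exact_mod_cast (Real.exp_pos _).ne'
  have hfin : (lagV f ℓ ξ : ℂ) =
      ∑' j, v j * (2 * Real.pi * Complex.I * j) * chr j (c + lagP ℓ ξ) := by
    apply mul_left_cancel₀ he
    rw [← tsum_mul_left, ← Complex.ofReal_mul, hu]
    exact tsum_congr fun j => by ring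
  rw [hfin]
  exact hs.hasSum

/-- The evolution of the momentum along the flow, written in Fourier coefficients. -/
theorem neg_integral_eq_momentumRHS (hf : Continuous f) (hℓ : Continuous ℓ) (hM : lagP ℓ 1 = 1)
    (hC : 0 ≤ C) (hfC : ∀ x, |f x| ≤ C) (hR : ∀ x, |ℓ x| ≤ R) (k : ℤ) :
    -∫ z in (0 : ℝ)..1, (lagq f ℓ z : ℂ) * chr (-k) (c + lagP ℓ z) *
      ((lagV f ℓ z : ℂ) + 2 * Real.pi * Complex.I * k * ((lagG f ℓ z + lagU f ℓ : ℝ) : ℂ)) =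
      momentumRHS (lagM f ℓ c) k := by
  have hPc := continuous_lagP hℓ
  have hqc := continuous_lagq hf hℓ
  have hsum := summable_bracket_one_vel
    (lagM_summable_sq (c := c) hf hℓ hM hC hfC hR).1
  set m := lagM f ℓ c with hm
  have h1 := hasSum_intervalIntegral
    (F := fun j z => 2 * Real.pi * Complex.I * (j + k) * vel m j *
      ((lagq f ℓ z : ℂ) * chr (-(k - j)) (c + lagP ℓ z)))
    (g := fun z => (lagq f ℓ z : ℂ) * chr (-k) (c + lagP ℓ z) *
      ((lagV f ℓ z : ℂ) + 2 * Real.pi * Complex.I * k * ((lagG f ℓ z + lagU f ℓ : ℝ) : ℂ)))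
    (b := fun j => 2 * Real.pi * (1 + |(k : ℝ)|) * (C * Real.exp R) * (bracket 1 j * ‖vel m j‖))
    (fun j => continuous_const.mul ((Complex.continuous_ofReal.comp hqc).mul
      ((continuous_chr _).comp (continuous_const.add hPc))))
    (hsum.mul_left _) (fun j z hz => ?_) (fun z hz => ?_)
  · rw [← h1.tsum_eq, momentumRHS, ← (Equiv.subLeft k).tsum_eq]
    congr 1
    refine tsum_congr fun l => ?_
    rw [intervalIntegral.integral_const_mul, Equiv.subLeft_apply, sub_sub_cancel, hm, lagM]
    push_cast
    ring
  · simp only [norm_mul, norm_chr, Complex.norm_I, Complex.norm_real, Complex.norm_ofNat, mul_one]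
    rw [Real.norm_of_nonneg Real.pi_pos.le, ← Int.cast_add, Complex.norm_intCast]
    have hq := (lag_bounds hC hfC hR hz).2.1
    have h2 : |((j + k : ℤ) : ℝ)| ≤ (1 + |(k : ℝ)|) * bracket 1 j := by
      push_cast
      have a1 := abs_le_bracket_one j
      have a2 := one_le_bracket (s := 1) zero_le_one j
      have a3 := abs_nonneg (k : ℝ)
      calc _ ≤ |(j : ℝ)| + |(k : ℝ)| := abs_add_le _ _
        _ ≤ _ := by nlinarith
    have h0 := norm_nonneg (vel m j)
    have hpi := Real.pi_pos
    have hB := bracket_pos 1 j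
    calc _ ≤ 2 * Real.pi * ((1 + |(k : ℝ)|) * bracket 1 j) * ‖vel m j‖ * (C * Real.exp R) := by
          refine mul_le_mul ?_ hq (norm_nonneg _) (by positivity)
          gcongr
      _ = _ := by ring
  · have a1 := hasSum_deriv_vel_lagM (c := c) hf hℓ hM hC hfC hR hz
    have a2 := (hasSum_vel_lagM (c := c) hf hℓ hM hC hfC hR ⟨hz.1.le, hz.2.le⟩).mul_left
      (2 * Real.pi * Complex.I * k : ℂ)
    refine ((a1.add a2).mul_left ((lagq f ℓ z : ℂ) * chr (-k) (c + lagP ℓ z))).congr_fun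
      fun j => ?_
    have e : -(k - j) = -k + j := by ring
    rw [e, chr_add_left]
    ring

end Static

section Static

variable {f ℓ : ℝ → ℝ} {R C : ℝ}

theorem lagU_eq (hf : Continuous f) (hℓ : Continuous ℓ) :
    lagU f ℓ = ∫ z in (0 : ℝ)..1,
      lagq f ℓ z * (1 / 2 * lagP ℓ z ^ 2 + 13 / 12 - 1 / 2 * lagP ℓ z) := by
  have hPc := continuous_lagP hℓ
  have hqc := continuous_lagq hf hℓ
  rw [lagU, lagN, lagQ, ← intervalIntegral.integral_const_mul, ← intervalIntegral.integral_const_mul,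
    ← intervalIntegral.integral_const_mul, ← intervalIntegral.integral_add
      (Continuous.intervalIntegrable (by fun_prop) 0 1)
      (Continuous.intervalIntegrable (by fun_prop) 0 1), ← intervalIntegral.integral_sub
      (Continuous.intervalIntegrable (by fun_prop) 0 1)
      (Continuous.intervalIntegrable (by fun_prop) 0 1)]
  refine intervalIntegral.integral_congr fun z _ => ?_
  ring

theorem abs_lagU_integrand_le (hC : 0 ≤ C) (hfC : ∀ x, |f x| ≤ C) (hR : ∀ x, |ℓ x| ≤ R) {z : ℝ}
    (hz : z ∈ Set.Icc (0 : ℝ) 1) :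
    |lagq f ℓ z * (1 / 2 * lagP ℓ z ^ 2 + 13 / 12 - 1 / 2 * lagP ℓ z)| ≤
      C * Real.exp R * (Real.exp R ^ 2 + 13 / 12 + Real.exp R) := by
  have hb := lag_bounds hC hfC hR hz
  have h1 := Real.exp_pos R
  have h2 : lagP ℓ z ^ 2 ≤ Real.exp R ^ 2 := sq_le_sq' (abs_le.1 hb.1).1 (abs_le.1 hb.1).2
  have h3 := sq_nonneg (lagP ℓ z)
  rw [abs_mul]
  refine mul_le_mul hb.2.1 ?_ (abs_nonneg _) (by positivity)
  have h4 := abs_le.1 hb.1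
  rw [abs_le]
  constructor <;> nlinarith [h4.1, h4.2]

theorem abs_lagU_le (hf : Continuous f) (hℓ : Continuous ℓ) (hC : 0 ≤ C) (hfC : ∀ x, |f x| ≤ C)
    (hR : ∀ x, |ℓ x| ≤ R) :
    |lagU f ℓ| ≤ C * Real.exp R * (Real.exp R ^ 2 + 13 / 12 + Real.exp R) := by
  rw [lagU_eq hf hℓ]
  exact abs_integral_le_of_abs_le (by positivity) ⟨zero_le_one, le_rfl⟩ fun z hz =>
    abs_lagU_integrand_le hC hfC hR hz

theorem abs_lagG_le (hf : Continuous f) (hℓ : Continuous ℓ) (hC : 0 ≤ C) (hfC : ∀ x, |f x| ≤ C)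
    (hR : ∀ x, |ℓ x| ≤ R) {ξ : ℝ} (hξ : ξ ∈ Set.Icc (0 : ℝ) 1) :
    |lagG f ℓ ξ| ≤ Real.exp R * (C * (2 * Real.exp R ^ 2 + 2 * Real.exp R)) := by
  rw [← integral_exp_mul_lagV hf hℓ]
  refine abs_integral_le_of_abs_le (by positivity) hξ fun z hz => ?_
  rw [abs_mul, abs_of_pos (Real.exp_pos _)]
  exact mul_le_mul (Real.exp_le_exp.2 (abs_le.1 (hR z)).2)
    (lag_bounds hC hfC hR hz).2.2.2.2 (abs_nonneg _) (Real.exp_pos _).le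

end Static

namespace IsLagFlow

variable {f : ℝ → ℝ} {T R C : ℝ} {ℓ : ℝ → ℝ → ℝ}

theorem continuousAt_lagU (h : IsLagFlow f T R ℓ) (hf : Continuous f) (hC : 0 ≤ C)
    (hfC : ∀ x, |f x| ≤ C) {t : ℝ} (ht : t ∈ Set.Ioo (-T) T) :
    ContinuousAt (fun τ => lagU f (ℓ τ)) t := by
  have hnhds : Set.Ioo (-T) T ∈ nhds t := isOpen_Ioo.mem_nhds ht
  have hsub : ∀ z ∈ Set.uIoc (0 : ℝ) 1, z ∈ Set.Icc (0 : ℝ) 1 := fun z hz => by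
    rw [Set.uIoc_of_le zero_le_one] at hz
    exact ⟨hz.1.le, hz.2⟩
  simp_rw [fun τ => lagU_eq hf (h.continuous τ)]
  refine intervalIntegral.continuousAt_of_dominated_interval
    (bound := fun _ => C * Real.exp R * (Real.exp R ^ 2 + 13 / 12 + Real.exp R)) ?_ ?_
    intervalIntegrable_const ?_
  · refine Filter.Eventually.of_forall fun τ => Continuous.aestronglyMeasurable ?_
    have hPc := continuous_lagP (h.continuous τ)
    have hqc := continuous_lagq hf (h.continuous τ)
    fun_prop
  · filter_upwards [hnhds] with τ hτ
    exact Filter.Eventually.of_forall fun z hz =>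
      abs_lagU_integrand_le hC hfC (h.bound τ hτ) (hsub z hz)
  · refine Filter.Eventually.of_forall fun z hz => ?_
    have h1 := (h.hasDerivAt_lagP hf hC hfC ht (hsub z hz)).continuousAt
    have h2 := (h.hasDerivAt_lagq ht (hsub z hz)).continuousAt
    exact h2.mul ((((h1.pow 2).const_mul _).add continuousAt_const).sub (h1.const_mul _))

/-- The trajectory of the particle `0`. -/
theorem hasDerivAt_integral_lagU (h : IsLagFlow f T R ℓ) (hf : Continuous f) (hC : 0 ≤ C)
    (hfC : ∀ x, |f x| ≤ C) {t : ℝ} (ht : t ∈ Set.Ioo (-T) T) :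
    HasDerivAt (fun τ => ∫ r in (0 : ℝ)..τ, lagU f (ℓ r)) (lagU f (ℓ t)) t := by
  have hT : 0 < T := by linarith [ht.1, ht.2]
  have h0 : (0 : ℝ) ∈ Set.Ioo (-T) T := ⟨by linarith, hT⟩
  have hc : ContinuousOn (fun τ => lagU f (ℓ τ)) (Set.Ioo (-T) T) := fun τ hτ =>
    (h.continuousAt_lagU hf hC hfC hτ).continuousWithinAt
  refine intervalIntegral.integral_hasDerivAt_right
    ((hc.mono (Set.ordConnected_Ioo.uIcc_subset h0 ht)).intervalIntegrable)
    (hc.stronglyMeasurableAtFilter isOpen_Ioo t ht) (h.continuousAt_lagU hf hC hfC ht)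

theorem hasDerivAt_lagM (h : IsLagFlow f T R ℓ) (hf : Continuous f) (hC : 0 ≤ C)
    (hfC : ∀ x, |f x| ≤ C) {t : ℝ} (ht : t ∈ Set.Ioo (-T) T) (k : ℤ) :
    HasDerivAt (fun τ => lagM f (ℓ τ) (∫ r in (0 : ℝ)..τ, lagU f (ℓ r)) k)
      (momentumRHS (lagM f (ℓ t) (∫ r in (0 : ℝ)..t, lagU f (ℓ r))) k) t := by
  set c : ℝ → ℝ := fun τ => ∫ r in (0 : ℝ)..τ, lagU f (ℓ r) with hc
  have hcd : ∀ τ ∈ Set.Ioo (-T) T, HasDerivAt c (lagU f (ℓ τ)) τ := fun τ hτ =>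
    h.hasDerivAt_integral_lagU hf hC hfC hτ
  rw [← neg_integral_eq_momentumRHS hf (h.continuous t) (h.lagP_one hf hC hfC ht) hC hfC
    (h.bound t ht) k, ← intervalIntegral.integral_neg]
  have hPc := fun τ => continuous_lagP (h.continuous τ)
  have hqc := fun τ => continuous_lagq hf (h.continuous τ)
  have hVc := fun τ => continuous_lagV hf (h.continuous τ)
  have hGc := fun τ => continuous_lagG hf (h.continuous τ)
  have hchr : ∀ τ, Continuous fun z => chr (-k) (c τ + lagP (ℓ τ) z) := fun τ =>
    (continuous_chr _).comp (continuous_const.add (hPc τ))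
  set V₀ := C * (2 * Real.exp R ^ 2 + 2 * Real.exp R) with hV₀
  set U₀ := C * Real.exp R * (Real.exp R ^ 2 + 13 / 12 + Real.exp R) with hU₀
  refine hasDerivAt_integral_param
    (H := fun τ z => (lagq f (ℓ τ) z : ℂ) * chr (-k) (c τ + lagP (ℓ τ) z))
    (H' := fun τ z => -((lagq f (ℓ τ) z : ℂ) * chr (-k) (c τ + lagP (ℓ τ) z) *
      ((lagV f (ℓ τ) z : ℂ) +
        2 * Real.pi * Complex.I * k * ((lagG f (ℓ τ) z + lagU f (ℓ τ) : ℝ) : ℂ))))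
    (B := C * Real.exp R * (V₀ + 2 * Real.pi * |(k : ℝ)| * (Real.exp R * V₀ + U₀)))
    (fun τ _ => (Complex.continuous_ofReal.comp (hqc τ)).mul (hchr τ))
    (fun τ _ => (((Complex.continuous_ofReal.comp (hqc τ)).mul (hchr τ)).mul
      ((Complex.continuous_ofReal.comp (hVc τ)).add (continuous_const.mul
        (Complex.continuous_ofReal.comp ((hGc τ).add continuous_const))))).neg)
    (fun τ hτ z hz => ?_) (fun τ hτ z hz => ?_) ht ⟨zero_le_one, le_rfl⟩
  · have hb := lag_bounds hC hfC (h.bound τ hτ) hz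
    have hG := abs_lagG_le hf (h.continuous τ) hC hfC (h.bound τ hτ) hz
    have hU := abs_lagU_le hf (h.continuous τ) hC hfC (h.bound τ hτ)
    rw [norm_neg, norm_mul, norm_mul, norm_chr, mul_one, Complex.norm_real]
    refine mul_le_mul hb.2.1 ((norm_add_le _ _).trans ?_) (norm_nonneg _) (by positivity)
    simp only [norm_mul, Complex.norm_real, Complex.norm_I, Complex.norm_ofNat,
      Complex.norm_intCast, mul_one]
    rw [Real.norm_of_nonneg Real.pi_pos.le]
    have hpi := Real.pi_pos
    have hGU : ‖lagG f (ℓ τ) z + lagU f (ℓ τ)‖ ≤ Real.exp R * V₀ + U₀ :=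
      (norm_add_le _ _).trans (add_le_add hG hU)
    have hV : ‖lagV f (ℓ τ) z‖ ≤ V₀ := hb.2.2.2.2
    gcongr
  · have h1 := (h.hasDerivAt_lagq hτ hz).ofReal_comp
    have h2 := hasDerivAt_chr (-k) ((hcd τ hτ).add (h.hasDerivAt_lagP hf hC hfC hτ hz))
    refine (h1.mul h2).congr_deriv ?_
    simp only [Pi.add_apply]
    push_cast
    ring

end IsLagFlow

/-- Global existence for the momentum equation with bounded continuous initial momentum of one
sign. -/
theorem exists_isMomentumSolution {f : ℝ → ℝ} {C T : ℝ} (hf : Continuous f) (hC : 0 ≤ C)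
    (hfC : ∀ x, |f x| ≤ C) (hsign : (∀ x, 0 ≤ f x) ∨ ∀ x, f x ≤ 0) (hT : 0 < T) :
    ∃ m, IsMomentumSolution T m ∧ BddWeighted T 0 m ∧
      ∀ k, m 0 k = ∫ z in (0 : ℝ)..1, (f z : ℂ) * chr (-k) z := by
  obtain ⟨R, ℓ, h⟩ := exists_isLagFlow hf hC hfC hsign hT
  refine ⟨fun τ => lagM f (ℓ τ) (∫ r in (0 : ℝ)..τ, lagU f (ℓ r)),
    ⟨fun t _ k => lagM_neg k, fun t ht k => h.hasDerivAt_lagM hf hC hfC ht k⟩,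
    ⟨(C * Real.exp R) ^ 2 * Real.exp R, fun t ht => ?_⟩, fun k => ?_⟩
  · simp only [bracket_zero, one_mul]
    exact lagM_summable_sq hf (h.continuous t) (h.lagP_one hf hC hfC ht) hC hfC (h.bound t ht)
  · have h0 : ℓ 0 = fun _ => 0 := funext h.initial
    simp [lagM, lagq, lagP, h0]

/-! ### Continuity in time and gluing -/

/-- Convergence of the coefficients together with convergence of the norms is convergence in norm. -/
theorem tendsto_tsum_weighted_sub {w : ℤ → ℝ} {a : ℝ → ℤ → ℂ} {t₀ : ℝ}
    (hc : ∀ k, ContinuousAt (fun t => a t k) t₀)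
    (hs : ∀ᶠ t in nhds t₀, Summable fun k => (w k * ‖a t k‖) ^ 2)
    (hE : ContinuousAt (fun t => ∑' k, (w k * ‖a t k‖) ^ 2) t₀) :
    Filter.Tendsto (fun t => ∑' k, (w k * ‖a t k - a t₀ k‖) ^ 2) (nhds t₀) (nhds 0) := by
  have hs0 : Summable fun k => (w k * ‖a t₀ k‖) ^ 2 := hs.self_of_nhds
  set E : ℝ → ℝ := fun t => ∑' k, (w k * ‖a t k‖) ^ 2 with hEdef
  rw [tendsto_order]
  refine ⟨fun r hr => Filter.Eventually.of_forall fun t =>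
    hr.trans_le (tsum_nonneg fun k => sq_nonneg _), fun ε hε => ?_⟩
  obtain ⟨S, hS⟩ := ((tendsto_order.1 hs0.hasSum).1 (E t₀ - ε / 4)
    (by simp only [hEdef]; linarith)).exists
  -- an upper bound that is continuous in time, and small at `t₀`
  set Rm : ℝ → ℝ := fun t => 2 * E t + 2 * E t₀ - ∑ k ∈ S, (2 * (w k * ‖a t k‖) ^ 2 +
    2 * (w k * ‖a t₀ k‖) ^ 2 - (w k * ‖a t k - a t₀ k‖) ^ 2) with hRm
  have hRc : ContinuousAt Rm t₀ := by
    refine ((hE.const_mul 2).add continuousAt_const).sub (tendsto_finsetSum _ fun k _ => ?_)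
    have h1 := (((hc k).norm.const_mul (w k)).pow 2).const_mul 2
    have h2 := ((((hc k).sub continuousAt_const).norm.const_mul (w k)).pow 2 :
      ContinuousAt (fun t => (w k * ‖a t k - a t₀ k‖) ^ 2) t₀)
    exact (h1.add continuousAt_const).sub h2
  have hR0 : Rm t₀ < ε := by
    have e : Rm t₀ = 4 * (E t₀ - ∑ k ∈ S, (w k * ‖a t₀ k‖) ^ 2) := by
      simp only [hRm]
      rw [mul_sub, Finset.mul_sum]
      have : ∀ k, 2 * (w k * ‖a t₀ k‖) ^ 2 + 2 * (w k * ‖a t₀ k‖) ^ 2 -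
          (w k * ‖a t₀ k - a t₀ k‖) ^ 2 = 4 * (w k * ‖a t₀ k‖) ^ 2 := fun k => by
        rw [sub_self, norm_zero]; ring
      simp_rw [this]
      ring
    rw [e]; linarith
  filter_upwards [hs, (tendsto_order.1 hRc.tendsto).2 ε hR0] with t ht hRt
  refine lt_of_le_of_lt ?_ hRt
  have hle : ∀ k, (w k * ‖a t k - a t₀ k‖) ^ 2 ≤
      2 * (w k * ‖a t k‖) ^ 2 + 2 * (w k * ‖a t₀ k‖) ^ 2 := fun k => by
    have h1 := norm_sub_le (a t k) (a t₀ k)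
    have h2 : ‖a t k - a t₀ k‖ ^ 2 ≤ 2 * ‖a t k‖ ^ 2 + 2 * ‖a t₀ k‖ ^ 2 := by
      nlinarith [norm_nonneg (a t k - a t₀ k), sq_nonneg (‖a t k‖ - ‖a t₀ k‖)]
    nlinarith [mul_le_mul_of_nonneg_left h2 (sq_nonneg (w k))]
  have hmaj := (ht.mul_left 2).add (hs0.mul_left 2)
  have hds := Summable.of_nonneg_of_le (fun k => sq_nonneg _) hle hmaj
  have h3 := (hmaj.sub hds).sum_le_tsum S fun k _ => sub_nonneg.2 (hle k)
  rw [hmaj.tsum_sub hds, (ht.mul_left 2).tsum_add (hs0.mul_left 2), tsum_mul_left,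
    tsum_mul_left] at h3
  simp only [hRm, hEdef]
  linarith

theorem vel_sub (m n : ℤ → ℂ) (k : ℤ) : vel m k - vel n k = vel (m - n) k := by
  simp only [vel, Pi.sub_apply, sub_div]

theorem bracket_mul_norm_vel_le (s : ℝ) (m : ℤ → ℂ) (k : ℤ) :
    bracket s k * ‖vel m k‖ ≤ 2 * (bracket (s - 2) k * ‖m k‖) := by
  refine (mul_le_mul_of_nonneg_left (norm_vel_le m k) (bracket_pos s k).le).trans_eq ?_
  rw [sub_eq_add_neg, bracket_add]
  ring

theorem Sobolev.coef_eq_vel {s : ℝ} (hs : 2 ≤ s) (u : Sobolev s) :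
    coef (Sobolev.toL2 u) = vel (coef (Sobolev.toL2 (Sobolev.muA hs u))) := by
  ext k
  have e2 : (if k = 0 then 1 else (2 * Real.pi * k) ^ 2 : ℂ) = symb k := by
    unfold symb; split_ifs <;> push_cast <;> rfl
  have e3 : (symb k : ℂ) ≠ 0 := by exact_mod_cast (symb_pos k).ne'
  rw [vel, Sobolev.coef_muA, e2, mul_div_cancel_left₀ _ e3]

/-- An `L²` function of one sign with absolutely summable Fourier coefficients has a continuous
representative of one sign. -/
theorem exists_continuous_of_sign {g : L2Circle} (hg : Summable fun k => ‖coef g k‖)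
    (hsign : (∀ᵐ x ∂haarAddCircle, 0 ≤ g x) ∨ ∀ᵐ x ∂haarAddCircle, g x ≤ 0) :
    ∃ (f : ℝ → ℝ) (C : ℝ), Continuous f ∧ 0 ≤ C ∧ (∀ x, |f x| ≤ C) ∧
      ((∀ x, 0 ≤ f x) ∨ ∀ x, f x ≤ 0) ∧
      ∀ k, ∫ z in (0 : ℝ)..1, (f z : ℂ) * chr (-k) z = coef g k := by
  obtain ⟨F, -, hF⟩ := exists_continuous_of_summable_coef hg
  set G : UnitAddCircle → ℝ := fun x => (F x).re with hG
  have hGc : Continuous G := Complex.continuous_re.comp F.continuous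
  have hGg : ∀ᵐ x ∂haarAddCircle, G x = g x := by
    filter_upwards [hF] with x hx
    change (F x).re = g x
    rw [← hx, Complex.ofReal_re]
  refine ⟨fun z => G z, ‖F‖, hGc.comp (AddCircle.continuous_mk' 1), norm_nonneg _,
    fun x => (Complex.abs_re_le_norm _).trans (F.norm_coe_le_norm _), ?_, fun k => ?_⟩
  · rcases hsign with h | h
    · left
      have h1 : G = fun x => |G x| :=
        (Continuous.ae_eq_iff_eq haarAddCircle hGc hGc.abs).1 (by
          filter_upwards [hGg, h] with x h1 h2
          rw [h1, abs_of_nonneg h2])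
      intro x
      rw [h1]
      exact abs_nonneg _
    · right
      have h1 : G = fun x => -|G x| :=
        (Continuous.ae_eq_iff_eq haarAddCircle hGc hGc.abs.neg).1 (by
          filter_upwards [hGg, h] with x h1 h2
          change G x = -|G x|
          rw [h1, abs_of_nonpos h2, neg_neg])
      intro x
      rw [h1]
      exact neg_nonpos.2 (abs_nonneg _)
  · have h1 : coef g k = fourierCoeff (fun x => ((G x : ℝ) : ℂ)) k := by
      refine congrFun (fourierCoeff_congr_ae ?_) k
      filter_upwards [hGg] with x hx
      rw [hx]
    rw [h1, fourierCoeff_eq_intervalIntegral _ _ 0, zero_add, div_one, one_smul]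
    refine intervalIntegral.integral_congr fun z _ => ?_
    simp only [smul_eq_mul]
    rw [fourier_coe_apply, chr, mul_comm, Complex.ofReal_one, div_one]

/-- A solution of the velocity equation for `|t| < T` that is a continuous curve in `H^s`, with
`∑ ⟨k⟩² |v(k)|` bounded in time. -/
structure IsRegularVelocity (s T : ℝ) (v : ℝ → ℤ → ℂ) : Prop where
  sol : IsVelocitySolution T v
  bound : ∃ S, ∀ t ∈ Set.Ioo (-T) T, (Summable fun k => bracket 2 k * ‖v t k‖) ∧
    ∑' k, bracket 2 k * ‖v t k‖ ≤ S
  summable : ∀ t ∈ Set.Ioo (-T) T, Summable fun k => (bracket s k * ‖v t k‖) ^ 2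
  tendsto : ∀ t₀ ∈ Set.Ioo (-T) T,
    Filter.Tendsto (fun t => ∑' k, (bracket s k * ‖v t k - v t₀ k‖) ^ 2) (nhds t₀) (nhds 0)

theorem IsRegularVelocity.eq {s T T' : ℝ} {v w : ℝ → ℤ → ℂ} (hv : IsRegularVelocity s T v)
    (hw : IsRegularVelocity s T' w) (hT : 0 < T) (hTT : T ≤ T') (h0 : v 0 = w 0) {t : ℝ}
    (ht : t ∈ Set.Ioo (-T) T) : v t = w t := by
  have hsub : Set.Ioo (-T) T ⊆ Set.Ioo (-T') T' := Set.Ioo_subset_Ioo (by linarith) hTT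
  obtain ⟨S, hS⟩ := hv.bound
  obtain ⟨S', hS'⟩ := hw.bound
  exact IsVelocitySolution.unique hT hv.sol
    ⟨fun t ht => hw.sol.conj_symm t (hsub ht), fun t ht => hw.sol.hasDerivAt t (hsub ht)⟩ h0
    (S := max S S')
    (fun t ht => ⟨(hS t ht).1, (hS t ht).2.trans (le_max_left _ _)⟩)
    (fun t ht => ⟨(hS' t (hsub ht)).1, (hS' t (hsub ht)).2.trans (le_max_right _ _)⟩) ht

theorem IsMomentumSolution.isRegularVelocity {s T : ℝ} (hs : 5 / 2 < s) (hT : 0 < T)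
    {m : ℝ → ℤ → ℂ} (hm : IsMomentumSolution T m) (h0 : BddWeighted T 0 m)
    (hi : Summable fun k => (bracket (s - 2) k * ‖m 0 k‖) ^ 2) :
    IsRegularVelocity s T fun t => vel (m t) := by
  obtain ⟨⟨B, hB⟩, L, hL⟩ := hm.propagation (by linarith) hT h0 hi
  have hsm := fun t ht => summable_of_weighted (s := s - 2) (by linarith)
    (fun k => norm_nonneg (m t k)) (hB t ht).1
  have hle : ∀ (n : ℤ → ℂ) k, (bracket s k * ‖vel n k‖) ^ 2 ≤
      4 * (bracket (s - 2) k * ‖n k‖) ^ 2 := fun n k => by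
    have h1 := bracket_mul_norm_vel_le s n k
    have h2 := mul_nonneg (bracket_pos s k).le (norm_nonneg (vel n k))
    calc _ ≤ (2 * (bracket (s - 2) k * ‖n k‖)) ^ 2 := pow_le_pow_left₀ h2 h1 2
      _ = _ := by ring
  refine ⟨⟨fun t ht k => ?_, fun t ht k => ?_⟩, ?_, fun t ht => ?_, fun t₀ ht₀ => ?_⟩
  · exact vel_neg (hm.conj_symm t ht) k
  · rw [velocityRHS_vel (hsm t ht).1]
    exact (hm.hasDerivAt t ht k).div_const _
  · refine ⟨2 * √((∑' k, bracket (-(2 * (s - 2))) k) * B), fun t ht => ?_⟩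
    have h1 : ∀ k, bracket 2 k * ‖vel (m t) k‖ ≤ 2 * ‖m t k‖ := fun k => by
      have h := bracket_mul_norm_vel_le 2 (m t) k
      rwa [sub_self, bracket_zero, one_mul] at h
    have h2 := Summable.of_nonneg_of_le
      (fun k => mul_nonneg (bracket_pos 2 k).le (norm_nonneg _)) h1 ((hsm t ht).1.mul_left 2)
    refine ⟨h2, (h2.tsum_le_tsum h1 ((hsm t ht).1.mul_left 2)).trans ?_⟩
    rw [tsum_mul_left]
    gcongr
    refine Real.le_sqrt_of_sq_le ((hsm t ht).2.trans ?_)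
    exact mul_le_mul_of_nonneg_left (hB t ht).2 (tsum_nonneg fun k => (bracket_pos _ _).le)
  · exact Summable.of_nonneg_of_le (fun k => sq_nonneg _) (hle (m t)) ((hB t ht).1.mul_left 4)
  · have hnhds : Set.Ioo (-T) T ∈ nhds t₀ := isOpen_Ioo.mem_nhds ht₀
    have hE : ContinuousAt (fun t => ∑' k, (bracket (s - 2) k * ‖m t k‖) ^ 2) t₀ := by
      rw [ContinuousAt, tendsto_iff_norm_sub_tendsto_zero]
      have h1 : Filter.Tendsto (fun t => L * |t - t₀|) (nhds t₀) (nhds 0) := by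
        have : ContinuousAt (fun t => L * |t - t₀|) t₀ := by fun_prop
        simpa [ContinuousAt] using this
      refine squeeze_zero' (Filter.Eventually.of_forall fun t => norm_nonneg _) ?_ h1
      filter_upwards [hnhds] with t ht using hL t₀ ht₀ t ht
    have h1 := (tendsto_tsum_weighted_sub
      (fun k => (hm.hasDerivAt t₀ ht₀ k).continuousAt)
      (by filter_upwards [hnhds] with t ht using (hB t ht).1) hE).const_mul 4
    rw [mul_zero] at h1
    refine squeeze_zero' (Filter.Eventually.of_forall fun t => tsum_nonneg fun k => sq_nonneg _)
      ?_ h1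
    filter_upwards [hnhds] with t ht
    have hd : Summable fun k => (bracket (s - 2) k * ‖m t k - m t₀ k‖) ^ 2 := by
      refine Summable.of_nonneg_of_le (fun k => sq_nonneg _) (fun k => ?_)
        (((hB t ht).1.mul_left 2).add ((hB t₀ ht₀).1.mul_left 2))
      have h2 : ‖m t k - m t₀ k‖ ^ 2 ≤ 2 * ‖m t k‖ ^ 2 + 2 * ‖m t₀ k‖ ^ 2 := by
        nlinarith [norm_sub_le (m t k) (m t₀ k), norm_nonneg (m t k - m t₀ k),
          sq_nonneg (‖m t k‖ - ‖m t₀ k‖)]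
      nlinarith [mul_le_mul_of_nonneg_left h2 (sq_nonneg (bracket (s - 2) k))]
    have h3 : ∀ k, (bracket s k * ‖vel (m t) k - vel (m t₀) k‖) ^ 2 ≤
        4 * (bracket (s - 2) k * ‖m t k - m t₀ k‖) ^ 2 := fun k => by
      rw [vel_sub]; exact hle (m t - m t₀) k
    rw [← tsum_mul_left]
    exact (Summable.of_nonneg_of_le (fun k => sq_nonneg _) h3 (hd.mul_left 4)).tsum_le_tsum h3
      (hd.mul_left 4)

open Sobolev in
/-- Regular velocities on arbitrarily long time intervals, with the same initial value, glue to a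
global solution. -/
theorem exists_isGlobalSolution {s : ℝ} (h2 : 2 ≤ s) (hs : 5 / 2 < s) (u₀ : Sobolev s)
    (h : ∀ T, 0 < T → ∃ v, IsRegularVelocity s T v ∧ v 0 = coef (toL2 u₀)) :
    ∃ u, IsGlobalSolution h2 u₀ u := by
  have hpos : ∀ t : ℝ, 0 < |t| + 1 := fun t => by positivity
  choose v hv hv0 using fun t : ℝ => h (|t| + 1) (hpos t)
  have hmem : ∀ t : ℝ, t ∈ Set.Ioo (-(|t| + 1)) (|t| + 1) := fun t => abs_lt.1 (by linarith)
  choose u hu using fun t => exists_of_coef (s := s) (by linarith) (v t t)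
    (memlp_of_summable_sq ((hv t).summable t (hmem t))) ((hv t).sol.conj_symm t (hmem t))
  -- near `t₀`, the curve `u` is given by a single regular velocity
  have hloc : ∀ t₀ : ℝ, ∃ w, IsRegularVelocity s (|t₀| + 2) w ∧
      ∀ t ∈ Set.Ioo (t₀ - 1) (t₀ + 1), ∀ k, coef (toL2 (u t)) k = w t k := by
    intro t₀
    obtain ⟨w, hw, hw0⟩ := h (|t₀| + 2) (by positivity)
    refine ⟨w, hw, fun t ht k => ?_⟩
    have h1 : |t - t₀| < 1 := abs_lt.2 ⟨by linarith [ht.1], by linarith [ht.2]⟩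
    have h3 := abs_sub_abs_le_abs_sub t t₀
    rw [hu, (hv t).eq hw (hpos t) (by linarith) ((hv0 t).trans hw0.symm) (hmem t)]
  have hmem' : ∀ t₀ : ℝ, t₀ ∈ Set.Ioo (-(|t₀| + 2)) (|t₀| + 2) := fun t₀ =>
    abs_lt.1 (by linarith)
  have hnhds : ∀ t₀ : ℝ, Set.Ioo (t₀ - 1) (t₀ + 1) ∈ nhds t₀ := fun t₀ =>
    Ioo_mem_nhds (by linarith) (by linarith)
  have hc : Continuous u := by
    refine continuous_iff_continuousAt.2 fun t₀ => ?_
    obtain ⟨w, hw, hwu⟩ := hloc t₀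
    have h1 := hw.tendsto t₀ (hmem' t₀)
    have h3 : Filter.Tendsto (fun t => ‖u t - u t₀‖ ^ 2) (nhds t₀) (nhds 0) := by
      refine h1.congr' ?_
      filter_upwards [hnhds t₀] with t ht
      rw [norm_sq_eq]
      refine tsum_congr fun k => ?_
      rw [map_sub, coef_sub, hwu t ht, hwu t₀ ⟨by linarith, by linarith⟩]
    rw [ContinuousAt, tendsto_iff_norm_sub_tendsto_zero]
    have h4 := h3.sqrt
    simpa only [Real.sqrt_sq (norm_nonneg _), Real.sqrt_zero] using h4
  have hd : ∀ t k, HasDerivAt (fun τ => coef (toL2 (u τ)) k)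
      (velocityRHS (coef (toL2 (u t))) k) t := by
    intro t₀ k
    obtain ⟨w, hw, hwu⟩ := hloc t₀
    have h1 : coef (toL2 (u t₀)) = w t₀ := funext (hwu t₀ ⟨by linarith, by linarith⟩)
    rw [h1]
    refine (hw.sol.hasDerivAt t₀ (hmem' t₀) k).congr_of_eventuallyEq ?_
    filter_upwards [hnhds t₀] with t ht using hwu t ht k
  have h0 : u 0 = u₀ := ext_coef fun k => by rw [hu, hv0]
  exact ⟨u, h0 ▸ isGlobalSolution_of_coef h2 hs hc hd⟩

/-! ### Global existence and uniqueness -/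

theorem mainTheorem5 (s : ℝ) (hs : 5 / 2 < s) (u₀ : Sobolev s)
    (hmean : Sobolev.mean u₀ ≠ 0)
    (hsign : (∀ᵐ x ∂AddCircle.haarAddCircle, 0 ≤ Sobolev.muA (by linarith) u₀ x) ∨
      (∀ᵐ x ∂AddCircle.haarAddCircle, Sobolev.muA (by linarith) u₀ x ≤ 0)) :
    ∃! u : ℝ → Sobolev s, IsGlobalSolution (by linarith) u₀ u := by
  obtain ⟨f, C, hf, hC, hfC, hfs, hfk⟩ := exists_continuous_of_sign
    (Sobolev.summable_coef (by linarith) (Sobolev.muA (by linarith) u₀)) hsign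
  obtain ⟨u, hu⟩ := exists_isGlobalSolution (by linarith) hs u₀ fun T hT => by
    obtain ⟨m, hm, hm0, hmi⟩ := exists_isMomentumSolution hf hC hfC hfs hT
    simp_rw [hfk] at hmi
    refine ⟨fun t => vel (m t), hm.isRegularVelocity hs hT hm0 ?_, ?_⟩
    · simp_rw [hmi]
      exact Sobolev.summable_sq (Sobolev.muA (by linarith) u₀)
    · simp only [funext hmi]
      exact (Sobolev.coef_eq_vel (by linarith) u₀).symm
  exact ⟨u, hu, fun w hw => hw.unique hs hu⟩
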